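/- **Theorem.** Let $\hbar>0$, $m\ge 0$, $\varepsilon>0$, $\theta_1,\theta_2\in[0,2\pi)$, and let $\mu:[0,\infty)\to[0,1]$ be smooth with $\mu=0$ on $[0,\varepsilon]$ and $\mu=1$ on $[2\varepsilon,\infty)$. Let $$\mathcal S_1=\{(s_{\rm ph},s_{e_1},s_{e_2})\in\mathbb R^3: s_{e_1}<s_{\rm ph}<s_{e_2}\},$$ $\mathcal C_1=\{x\in\partial\mathcal S_1: s_{e_1}=s_{\rm ph}\}$, $\mathcal C_2=\{x\in\partial\mathcal S_1: s_{e_2}=s_{\rm ph}\}$. Write $\psi_{\varsigma_0\varsigma_1\varsigma_2}$, $\varsigma_i\in\{-,+\}$, for the components of $\Psi\in\mathbb C^8=\mathbb C^2\otimes\mathbb C^2\otimes\mathbb C^2$ (in each factor the basis is ordered $-,+$), and let $$\hat H=H_{\rm ph}\otimes 1\otimes 1+1\otimes H_{e_1}\otimes 1+1\otimes 1\otimes H_{e_2},\qquad H_{\rm ph}=-i\hbar\gamma^0\gamma^1\partial_{s_{\rm ph}},\quad H_{e_j}=\gamma^0\left(m-i\hbar\gamma^1\partial_{s_{e_j}}\right),$$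 with $\gamma^0=\begin{pmatrix}0&1\\1&0\end{pmatrix}$, $\gamma^1=\begin{pmatrix}0&-1\\1&0\end{pmatrix}$. For $\mathring\Psi:\mathcal S_1\to\mathbb C^8$ measurable, bounded and compactly supported in $\mathcal S_1$, consider the initial-boundary value problem $$\begin{cases} i\hbar\,\partial_t\Psi=\hat H\Psi & \text{in }(0,\infty)\times\mathcal S_1,\\ \Psi|_{t=0}=\mathring\Psi,\\ \psi_{-+\varsigma_2}=\mu(|s_{e_1}-s_{e_2}|)\,e^{i\theta_1}\,\psi_{+-\varsigma_2} & \text{on }\mathcal C_1,\ \varsigma_2=\pm,\\ \psi_{+\varsigma_1-}=\mu(|s_{e_1}-s_{e_2}|)\,e^{i\theta_2}\,\psi_{-\varsigma_1+} & \text{on }\mathcal C_2,\ \varsigma_1=\pm.\end{cases}$$ A solution is a measurable $\Psi$ with $t\mapsto\Psi(t)$ continuous from $[0,\infty)$ to $L^2(\mathcal S_1,\mathbb C^8)$ that satisfies the equation in the sense of distributions and the initial condition almost everywhere on $\mathcal S_1$, and whose components occurring in the boundary conditions have boundary values satisfying these conditions almost everywhere. Here the boundary value of a component $f$ on $\mathcal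 C_1$ is the measurable function $g(t,s,r)$, $s<r$, with $$\lim_{\delta\downarrow0}\frac1\delta\int_0^\delta\int_{\{0<t<R,\ |s|,|r|<R,\ s+h<r\}}|f(t,s+h,s-h,r)-g(t,s,r)|\,dt\,ds\,dr\,dh=0\quad\text{for all }R>0,$$ arguments of $f$ being ordered as $(t,s_{\rm ph},s_{e_1},s_{e_2})$; on $\mathcal C_2$ it is defined in the same way with $f(t,s-h,r,s+h)$ and $r<s-h$. Then for every such $\mathring\Psi$ the problem has a global-in-time solution, supported in $\overline{\mathcal S_1}$, and it is unique: any two solutions agree almost everywhere on $\mathcal S_1$ at every time $t\ge0$. The solution depends continuously on the data: for every $T>0$ there is a constant $K$, depending only on $T$ and on $\hbar,m,\varepsilon,\theta_1,\theta_2,\mu$, such that the solutions $\Psi,\Phi$ with data $\mathring\Psi,\mathring\Phi$ satisfy $$\|\Psi(t)-\Phi(t)\|_{L^p(\mathcal S_1)}\le K\,\|\mathring\Psi-\mathring\Phi\|_{L^p(\mathcal S_1)}\qquad\text{for } 0\le t\le T,\ p\in\{2,\infty\}.$$ -/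

import Mathlib

open MeasureTheory Set Filter Topology
open scoped ContDiff Kronecker ENNReal NNReal

namespace LeakyIBVP

/-- Configurations `(s_ph, s_e1, s_e2)` of photon, first electron and second electron. -/
abbrev Config : Type := ℝ × ℝ × ℝ

/-- Component labels `(ς₀, ς₁, ς₂)`; in every slot `0` stands for the sign `-` and `1` for `+`,
the order of the basis in which the gamma matrices are written. -/
abbrev Label : Type := Fin 2 × Fin 2 × Fin 2

/-- The spin space `ℂ⁸ = ℂ² ⊗ ℂ² ⊗ ℂ²` with its Hermitian norm. -/
abbrev Spinor : Type := EuclideanSpace ℂ Label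

/-- The configurations with the photon strictly between the two electrons. -/
def S1 : Set Config := {x | x.2.1 < x.1 ∧ x.1 < x.2.2}

/-- The gamma matrix `γ⁰`. -/
def gamma0 : Matrix (Fin 2) (Fin 2) ℂ := !![0, 1; 1, 0]

/-- The gamma matrix `γ¹`. -/
def gamma1 : Matrix (Fin 2) (Fin 2) ℂ := !![0, -1; 1, 0]

/-- `A ⊗ 𝟙 ⊗ 𝟙` acting on the spin space. -/
noncomputable def onPh (A : Matrix (Fin 2) (Fin 2) ℂ) : Spinor →ₗ[ℂ] Spinor :=
  Matrix.toEuclideanLin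
    (A ⊗ₖ ((1 : Matrix (Fin 2) (Fin 2) ℂ) ⊗ₖ (1 : Matrix (Fin 2) (Fin 2) ℂ)))

/-- `𝟙 ⊗ A ⊗ 𝟙` acting on the spin space. -/
noncomputable def onE1 (A : Matrix (Fin 2) (Fin 2) ℂ) : Spinor →ₗ[ℂ] Spinor :=
  Matrix.toEuclideanLin
    ((1 : Matrix (Fin 2) (Fin 2) ℂ) ⊗ₖ (A ⊗ₖ (1 : Matrix (Fin 2) (Fin 2) ℂ)))

/-- `𝟙 ⊗ 𝟙 ⊗ A` acting on the spin space. -/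
noncomputable def onE2 (A : Matrix (Fin 2) (Fin 2) ℂ) : Spinor →ₗ[ℂ] Spinor :=
  Matrix.toEuclideanLin
    ((1 : Matrix (Fin 2) (Fin 2) ℂ) ⊗ₖ ((1 : Matrix (Fin 2) (Fin 2) ℂ) ⊗ₖ A))

/-- The partial derivative in `s_ph`. -/
noncomputable def dPh (φ : Config → Spinor) (x : Config) : Spinor := fderiv ℝ φ x (1, 0, 0)

/-- The partial derivative in `s_e1`. -/
noncomputable def dE1 (φ : Config → Spinor) (x : Config) : Spinor := fderiv ℝ φ x (0, 1, 0)

/-- The partial derivative in `s_e2`. -/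
noncomputable def dE2 (φ : Config → Spinor) (x : Config) : Spinor := fderiv ℝ φ x (0, 0, 1)

/-- The three-body Hamiltonian
`H = H_ph ⊗ 𝟙 ⊗ 𝟙 + 𝟙 ⊗ H_e1 ⊗ 𝟙 + 𝟙 ⊗ 𝟙 ⊗ H_e2` with `H_ph = -iℏ γ⁰γ¹ ∂_{s_ph}` and
`H_e = γ⁰ (m - iℏ γ¹ ∂_{s_e})`, acting on differentiable functions. -/
noncomputable def hamiltonian (hbar m : ℝ) (φ : Config → Spinor) (x : Config) : Spinor :=
  (-(Complex.I * (hbar : ℂ))) • onPh (gamma0 * gamma1) (dPh φ x)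
  + ((m : ℂ) • onE1 gamma0 (φ x)
      - (Complex.I * (hbar : ℂ)) • onE1 (gamma0 * gamma1) (dE1 φ x))
  + ((m : ℂ) • onE2 gamma0 (φ x)
      - (Complex.I * (hbar : ℂ)) • onE2 (gamma0 * gamma1) (dE2 φ x))

/-- `iℏ ∂_t Ψ = H Ψ` in the sense of distributions on `(0, ∞) × S1`. The operator
`iℏ ∂_t - H` is formally self-adjoint, so it is moved to the test function. -/
def SolvesWeakly (hbar m : ℝ) (Ψ : ℝ → Config → Spinor) : Prop :=
  ∀ φ : ℝ × Config → Spinor, ContDiff ℝ ∞ φ → HasCompactSupport φ →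
    tsupport φ ⊆ Ioi (0 : ℝ) ×ˢ S1 →
    ∫ p in Ioi (0 : ℝ) ×ˢ S1,
      inner ℂ ((Complex.I * (hbar : ℂ)) • fderiv ℝ φ p (1, 0)
        - hamiltonian hbar m (fun x => φ (p.1, x)) p.2) (Ψ p.1 p.2) = 0

/-- `g`, a function of `(t, s, r)` with `t > 0`, `s < r`, is the boundary value on
`C₁ = {s_ph = s_e1 ≤ s_e2}` of the scalar function `f` on `(0, ∞) × S1`: the limit of
`f t (s + h, s - h, r)` as `h ↓ 0`, taken in `L¹` locally on `[0, ∞) × C₁` and averaged over `h`,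
so that it depends only on the almost-everywhere class of `f`.
The point of `C₁` with parameters `(s, r)` is `(s, s, r)`. -/
def HasTraceC1 (f : ℝ → Config → ℂ) (g : ℝ × ℝ × ℝ → ℂ) : Prop :=
  AEStronglyMeasurable g volume ∧
  ∀ R : ℝ, Tendsto
    (fun δ : ℝ => (ENNReal.ofReal δ)⁻¹ *
      ∫⁻ q in {q : (ℝ × ℝ × ℝ) × ℝ | 0 < q.1.1 ∧ q.1.1 < R ∧ |q.1.2.1| < R ∧ |q.1.2.2| < R ∧
          0 < q.2 ∧ q.2 < δ ∧ q.1.2.1 + q.2 < q.1.2.2},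
        ‖f q.1.1 (q.1.2.1 + q.2, q.1.2.1 - q.2, q.1.2.2) - g q.1‖ₑ)
    (𝓝[>] 0) (𝓝 0)

/-- `g`, a function of `(t, s, r)` with `t > 0`, `r < s`, is the boundary value on
`C₂ = {s_e1 ≤ s_ph = s_e2}` of the scalar function `f` on `(0, ∞) × S1`: the limit of
`f t (s - h, r, s + h)` as `h ↓ 0`, in the same sense as for `C₁`.
The point of `C₂` with parameters `(s, r)` is `(s, r, s)`. -/
def HasTraceC2 (f : ℝ → Config → ℂ) (g : ℝ × ℝ × ℝ → ℂ) : Prop :=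
  AEStronglyMeasurable g volume ∧
  ∀ R : ℝ, Tendsto
    (fun δ : ℝ => (ENNReal.ofReal δ)⁻¹ *
      ∫⁻ q in {q : (ℝ × ℝ × ℝ) × ℝ | 0 < q.1.1 ∧ q.1.1 < R ∧ |q.1.2.1| < R ∧ |q.1.2.2| < R ∧
          0 < q.2 ∧ q.2 < δ ∧ q.1.2.2 < q.1.2.1 - q.2},
        ‖f q.1.1 (q.1.2.1 - q.2, q.1.2.2, q.1.2.1 + q.2) - g q.1‖ₑ)
    (𝓝[>] 0) (𝓝 0)

/-- `ψ_{-+ς₂} = μ(|s_e1 - s_e2|) e^{iθ} ψ_{+-ς₂}` on `(0, ∞) × C₁`, for both signs `ς₂`. -/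
def BoundaryC1 (μ : ℝ → ℝ) (θ : ℝ) (Ψ : ℝ → Config → Spinor) : Prop :=
  ∀ c : Fin 2, ∃ g h : ℝ × ℝ × ℝ → ℂ,
    HasTraceC1 (fun t x => Ψ t x (0, 1, c)) g ∧ HasTraceC1 (fun t x => Ψ t x (1, 0, c)) h ∧
    ∀ᵐ p : ℝ × ℝ × ℝ, 0 < p.1 → p.2.1 < p.2.2 →
      g p = (μ |p.2.1 - p.2.2| : ℂ) * Complex.exp (Complex.I * (θ : ℂ)) * h p

/-- `ψ_{+ς₁-} = μ(|s_e1 - s_e2|) e^{iθ} ψ_{-ς₁+}` on `(0, ∞) × C₂`, for both signs `ς₁`. -/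
def BoundaryC2 (μ : ℝ → ℝ) (θ : ℝ) (Ψ : ℝ → Config → Spinor) : Prop :=
  ∀ b : Fin 2, ∃ g h : ℝ × ℝ × ℝ → ℂ,
    HasTraceC2 (fun t x => Ψ t x (1, b, 0)) g ∧ HasTraceC2 (fun t x => Ψ t x (0, b, 1)) h ∧
    ∀ᵐ p : ℝ × ℝ × ℝ, 0 < p.1 → p.2.2 < p.2.1 →
      g p = (μ |p.2.2 - p.2.1| : ℂ) * Complex.exp (Complex.I * (θ : ℂ)) * h p

/-- `Ψ` is a global-in-time (weak) solution of the leaky-boundary initial-boundary value problem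
with initial data `Ψ₀`: a jointly measurable function, continuous in time with values in
`L²(S1, ℂ⁸)`, that solves the evolution equation in `(0, ∞) × S1`, takes the initial value `Ψ₀`,
and has boundary values on `C₁` and `C₂` related by the two boundary conditions. -/
structure IsSolution (hbar m θ₁ θ₂ : ℝ) (μ : ℝ → ℝ) (Ψ₀ : Config → Spinor)
    (Ψ : ℝ → Config → Spinor) : Prop where
  measurable : AEStronglyMeasurable (fun p : ℝ × Config => Ψ p.1 p.2)
    (volume.restrict (Ioi (0 : ℝ) ×ˢ S1))
  memLp : ∀ t : ℝ, 0 ≤ t → MemLp (Ψ t) 2 (volume.restrict S1)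
  continuous : ∀ t₀ : ℝ, 0 ≤ t₀ →
    Tendsto (fun t => eLpNorm (Ψ t - Ψ t₀) 2 (volume.restrict S1)) (𝓝[Ici 0] t₀) (𝓝 0)
  equation : SolvesWeakly hbar m Ψ
  initial : Ψ 0 =ᵐ[volume.restrict S1] Ψ₀
  boundary₁ : BoundaryC1 μ θ₁ Ψ
  boundary₂ : BoundaryC2 μ θ₂ Ψ

/-- Initial data: (measurable,) bounded and compactly supported in `S1`, extended by zero. -/
structure IsData (Ψ₀ : Config → Spinor) : Prop where
  measurable : AEStronglyMeasurable Ψ₀ volume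
  bounded : ∃ K : ℝ, ∀ x, ‖Ψ₀ x‖ ≤ K
  compact : HasCompactSupport Ψ₀
  support : tsupport Ψ₀ ⊆ S1

end LeakyIBVP

/-!
In the chiral basis the equation decouples, up to the mass term, into transport equations: the
component with label `w` moves with the constant velocity `vel3 w`, all of whose entries are `±1`,
and the mass term couples it to the components with one electron sign flipped (`inner_equation`).
Followed backwards in time, a characteristic that starts in `S1` meets at most two walls. A wave
that enters through a wall is, by the boundary condition, the reflected outgoing wave times
`μ(|s_e1 - s_e2|) e^{iθ}`, and along the characteristic that amplitude is constant behind the wall.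
So the boundary conditions disappear when each component is extended to all configurations by
reflections (`unfolded`): the unfolded solution obeys the transport equation across the walls, with
the unfolded mass term as source.

Existence. Duhamel's formula for the unfolded problem is solved by Picard iteration in norms
weighted by `exp (rate κ * |t|)`, for which the source is a contraction both in the supremum norm
and in `L²` (`exists_isMild`). The fixed point is continuous in `L²`, is Lipschitz along its
characteristics, and therefore solves the equation weakly and has boundary values, because the
characteristics are transversal to the walls and translations are continuous in `L¹`
(`IsMild.isSolution`).

Uniqueness and the `L²` estimate. For an arbitrary weak solution the weak equation holds on the two
sides of each wall of the unfolded picture, and the boundary condition says that the two sides match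
in the mean over thin layers. Testing with cutoffs of the distance to the wall shows that then the
weak equation holds across the wall (`WeakTransport.glue`). A weak solution of a transport equation
satisfies the integrated equation along almost every characteristic (`WeakTransport.ae_eq`), so
every weak solution satisfies Duhamel's formula between almost every two times
(`IsWeakState.ae_unfolded_eq`). Taking norms and absorbing the source in the weighted norm gives the
energy estimate (`IsWeakState.le_of_continuousOn`), in which the initial time is reached by
continuity in `L²`. Solutions form a linear space (`IsEvolution.sub`), so the estimate yields
uniqueness and `L²` dependence on the data. The estimate in the supremum norm holds for the solution
constructed by iteration, hence by uniqueness for all solutions.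
-/

set_option linter.unusedSectionVars false

namespace LeakyIBVP

/-! ### The transport equation along one direction -/

section Transport

variable {E : Type*} [NormedAddCommGroup E] [NormedSpace ℝ E] [MeasurableSpace E]

/-- `∂_V u = G` in the sense of distributions on the set `D`, tested with real functions. -/
def WeakTransport (ν : Measure E) (V : E) (D : Set E) (u G : E → ℂ) : Prop :=
  ∀ φ : E → ℝ, ContDiff ℝ ∞ φ → HasCompactSupport φ → tsupport φ ⊆ D →
    ∫ p, (fderiv ℝ φ p V • u p + φ p • G p) ∂ν = 0

variable [BorelSpace E] [FiniteDimensional ℝ E] {ν : Measure E} {V : E} {D : Set E} {u G : E → ℂ}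

theorem WeakTransport.mono {D' : Set E} (h : WeakTransport ν V D u G) (hD : D' ⊆ D) :
    WeakTransport ν V D' u G :=
  fun φ h1 h2 h3 => h φ h1 h2 (h3.trans hD)

theorem WeakTransport.congr_on {u' G' : E → ℂ} (h : WeakTransport ν V D u G)
    (hu : ∀ p ∈ D, u' p = u p) (hG : ∀ p ∈ D, G' p = G p) : WeakTransport ν V D u' G' := by
  intro φ h1 h2 h3
  rw [← h φ h1 h2 h3]
  refine integral_congr_ae (Eventually.of_forall fun p => ?_)
  by_cases hp : p ∈ tsupport φ
  · simp only [hu p (h3 hp), hG p (h3 hp)]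
  · have h4 : fderiv ℝ φ p = 0 := by
      by_contra h5
      exact hp (support_fderiv_subset ℝ h5)
    simp [h4, image_eq_zero_of_notMem_tsupport hp]

theorem WeakTransport.const_mul (h : WeakTransport ν V D u G) (c : ℂ) :
    WeakTransport ν V D (fun p => c * u p) (fun p => c * G p) := by
  intro φ h1 h2 h3
  have h4 := h φ h1 h2 h3
  have h5 : (fun p => fderiv ℝ φ p V • (c * u p) + φ p • (c * G p))
      = fun p => c * (fderiv ℝ φ p V • u p + φ p • G p) := by
    funext p
    simp only [Complex.real_smul]
    ring
  rw [h5, integral_const_mul, h4, mul_zero]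

theorem WeakTransport.comp_equiv (e : E ≃L[ℝ] E) (he : MeasurePreserving e ν ν)
    (h : WeakTransport ν (e V) D u G) :
    WeakTransport ν V (e ⁻¹' D) (fun p => u (e p)) (fun p => G (e p)) := by
  intro φ h1 h2 h3
  have hs : tsupport (φ ∘ e.symm) = e.symm ⁻¹' tsupport φ :=
    tsupport_comp_eq_preimage φ e.symm.toHomeomorph
  have h4 := h (φ ∘ e.symm) (h1.comp e.symm.contDiff) (h2.comp_homeomorph e.symm.toHomeomorph)
    (by
      rw [hs]
      intro q hq
      simpa using h3 hq)
  rw [← he.integral_comp e.toHomeomorph.measurableEmbedding] at h4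
  rw [← h4]
  refine integral_congr_ae (Eventually.of_forall fun p => ?_)
  have h5 : fderiv ℝ (φ ∘ e.symm) (e p) (e V) = fderiv ℝ φ p V := by
    rw [fderiv_comp _ (by simpa using (h1.differentiable (by simp)) _)
      e.symm.differentiableAt, e.symm.fderiv]
    simp
  simp [h5]

/-- Solutions may be multiplied by smooth functions that do not vary in the direction `V`. -/
theorem WeakTransport.mul_invariant (h : WeakTransport ν V D u G) (hD : IsOpen D) {a : E → ℝ}
    (ha : ContDiffOn ℝ ∞ a D) (hV : ∀ (p : E) (s : ℝ), a (p + s • V) = a p) :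
    WeakTransport ν V D (fun p => a p • u p) (fun p => a p • G p) := by
  intro φ h1 h2 h3
  have hat : ∀ p ∈ D, ContDiffAt ℝ ∞ a p := fun p hp => ha.contDiffAt (hD.mem_nhds hp)
  have h4 : ContDiff ℝ ∞ (fun p => a p * φ p) := by
    rw [contDiff_iff_contDiffAt]
    intro p
    by_cases hp : p ∈ tsupport φ
    · exact (hat p (h3 hp)).mul h1.contDiffAt
    · have : (fun p => a p * φ p) =ᶠ[𝓝 p] fun _ => 0 := by
        filter_upwards [(isClosed_tsupport φ).isOpen_compl.mem_nhds hp] with q hq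
        simp [image_eq_zero_of_notMem_tsupport hq]
      exact contDiffAt_const.congr_of_eventuallyEq this
  have hsub : tsupport (fun p => a p * φ p) ⊆ tsupport φ :=
    closure_mono fun p hp => right_ne_zero_of_mul hp
  rw [← h _ h4 h2.mul_left (hsub.trans h3)]
  refine integral_congr_ae (Eventually.of_forall fun p => ?_)
  by_cases hp : p ∈ tsupport φ
  · have h5 : fderiv ℝ a p V = 0 := by
      have h6 := ((hat p (h3 hp)).differentiableAt (by simp)).hasFDerivAt.hasLineDerivAt V
      have h7 : HasDerivAt (fun s : ℝ => a (p + s • V)) 0 0 := by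
        simp only [hV]
        exact hasDerivAt_const _ _
      exact HasDerivAt.unique h6 h7
    have h8 : fderiv ℝ (fun p => a p * φ p) p V = a p * fderiv ℝ φ p V := by
      rw [fderiv_fun_mul ((hat p (h3 hp)).differentiableAt (by simp))
        ((h1.differentiable (by simp)) p)]
      simp [h5]
    simp only [h8, Complex.real_smul]
    push_cast
    ring
  · have h5 : ∀ f : E → ℝ, p ∉ tsupport f → fderiv ℝ f p = 0 := fun f hf => by
      by_contra h5
      exact hf (support_fderiv_subset ℝ h5)
    have h6 := h5 _ hp
    have h7 := h5 _ (fun h => hp (hsub h))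
    simp [h6, h7, image_eq_zero_of_notMem_tsupport hp]

/-- A characteristic segment with end points in a convex set stays in it. -/
theorem add_smul_mem_of_convex (hc : Convex ℝ D) {p : E} {σ s : ℝ} (hp : p ∈ D)
    (hσ : p + σ • V ∈ D) (hs : s ∈ Icc 0 σ) : p + s • V ∈ D := by
  rcases eq_or_lt_of_le (hs.1.trans hs.2) with h0 | h0
  · have : s = 0 := le_antisymm (h0 ▸ hs.2) hs.1
    simpa [this] using hp
  · have h1 := hc.add_smul_mem hp hσ (t := s / σ)
      ⟨div_nonneg hs.1 h0.le, (div_le_one h0).2 hs.2⟩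
    rwa [smul_smul, div_mul_cancel₀ _ h0.ne'] at h1

variable [ν.IsAddHaarMeasure]

theorem integrable_smul_of_test {f : E → ℂ} (hf : Integrable f ν) {φ : E → ℝ}
    (h1 : Continuous φ) (h2 : HasCompactSupport φ) : Integrable (fun p => φ p • f p) ν := by
  obtain ⟨C, hC⟩ := h1.bounded_above_of_compact_support h2
  exact hf.bdd_smul C h1.aestronglyMeasurable (Eventually.of_forall hC)

theorem continuous_fderiv_apply_const {φ : E → ℝ} (h1 : ContDiff ℝ ∞ φ) (V : E) :
    Continuous fun p => fderiv ℝ φ p V :=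
  (h1.continuous_fderiv (by simp)).clm_apply continuous_const

theorem hasCompactSupport_fderiv_apply_const {φ : E → ℝ} (h2 : HasCompactSupport φ) (V : E) :
    HasCompactSupport fun p => fderiv ℝ φ p V :=
  (h2.fderiv (𝕜 := ℝ)).comp_left (g := fun L : E →L[ℝ] ℝ => L V) (by simp)

theorem hasDerivAt_integral_translate {f : E → ℂ} (hf : Integrable f ν) {φ : E → ℝ}
    (h1 : ContDiff ℝ ∞ φ) (h2 : HasCompactSupport φ) (V : E) (s : ℝ) :
    HasDerivAt (fun s : ℝ => ∫ p, φ (p - s • V) • f p ∂ν)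
      (-∫ p, fderiv ℝ φ (p - s • V) V • f p ∂ν) s := by
  obtain ⟨C, hC⟩ := (continuous_fderiv_apply_const h1 V).bounded_above_of_compact_support
    (hasCompactSupport_fderiv_apply_const h2 V)
  obtain ⟨C', hC'⟩ := h1.continuous.bounded_above_of_compact_support h2
  rw [← integral_neg]
  refine (hasDerivAt_integral_of_dominated_loc_of_deriv_le (s := univ) (bound := fun p => C * ‖f p‖)
    (F' := fun s p => -(fderiv ℝ φ (p - s • V) V • f p)) univ_mem ?_ ?_ ?_ ?_ ?_ ?_).2
  · exact Eventually.of_forall fun s =>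
      ((h1.continuous.comp (by fun_prop)).aestronglyMeasurable).smul
      hf.1
  · exact hf.bdd_smul C'
      (h1.continuous.comp (g := φ) (f := fun p => p - s • V) (by fun_prop)).aestronglyMeasurable
      (Eventually.of_forall fun p => hC' _)
  · exact ((((continuous_fderiv_apply_const h1 V).comp
      (by fun_prop)).aestronglyMeasurable).smul hf.1).neg
  · refine Eventually.of_forall fun p s _ => ?_
    rw [norm_neg, norm_smul]
    exact mul_le_mul_of_nonneg_right (hC _) (norm_nonneg _)
  · exact hf.norm.const_mul C
  · refine Eventually.of_forall fun p s _ => ?_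
    have h3 : HasDerivAt (fun s : ℝ => p - s • V) (-V) s := by
      simpa using ((hasDerivAt_id s).smul_const V).const_sub p
    have h4 := ((h1.differentiable (by simp)) (p - s • V)).hasFDerivAt.comp_hasDerivAt s h3
    simpa [neg_smul] using h4.smul_const (f p)

theorem integral_translate_eq {f : E → ℂ} (φ : E → ℝ) (W : E) :
    ∫ p, φ (p - W) • f p ∂ν = ∫ p, φ p • f (p + W) ∂ν := by
  rw [← integral_add_right_eq_self (fun p => φ (p - W) • f p) W]
  simp

theorem integrable_shear {f : E → ℂ} (hf : Integrable f ν) (V : E) (σ : ℝ) :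
    Integrable (fun q : ℝ × E => f (q.2 + q.1 • V)) ((volume.restrict (Ioc 0 σ)).prod ν) := by
  have h1 : MeasurePreserving (fun q : ℝ × E => (q.1, q.2 + q.1 • V))
      ((volume.restrict (Ioc 0 σ)).prod ν) ((volume.restrict (Ioc 0 σ)).prod ν) := by
    refine MeasurePreserving.skew_product (g := fun s p => p + s • V) (MeasurePreserving.id _)
      (by fun_prop) ?_
    exact Eventually.of_forall fun s => (measurePreserving_add_right ν (s • V)).map_eq
  have h2 : Integrable (fun q : ℝ × E => f q.2) ((volume.restrict (Ioc 0 σ)).prod ν) :=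
    hf.comp_snd _
  exact h1.integrable_comp_of_integrable h2

theorem integral_shear_swap {f : E → ℂ} (hf : Integrable f ν) {φ : E → ℝ} (h1 : Continuous φ)
    (h2 : HasCompactSupport φ) (V : E) {σ : ℝ} (hσ : 0 ≤ σ) :
    ∫ s in (0 : ℝ)..σ, ∫ p, φ (p - s • V) • f p ∂ν
      = ∫ p, φ p • (∫ s in (0 : ℝ)..σ, f (p + s • V)) ∂ν := by
  obtain ⟨C, hC⟩ := h1.bounded_above_of_compact_support h2
  simp only [integral_translate_eq, intervalIntegral.integral_of_le hσ]
  rw [integral_integral_swap (f := fun s p => φ p • f (p + s • V))]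
  · simp only [integral_smul]
  · exact (integrable_shear hf V σ).bdd_smul C
      (h1.comp continuous_snd).aestronglyMeasurable (Eventually.of_forall fun q => hC _)

/-- A distributional solution grows along almost every characteristic by the integral of the
source. It is tested with the translates `φ (· - s V)` of a test function, `0 ≤ s ≤ σ`. -/
theorem WeakTransport.ae_eq (h : WeakTransport ν V D u G) (hu : Integrable u ν)
    (hG : Integrable G ν) (hD : IsOpen D) (hc : Convex ℝ D) {σ : ℝ} (hσ : 0 ≤ σ) :
    ∀ᵐ p ∂ν, p ∈ D → p + σ • V ∈ D → u (p + σ • V) = u p + ∫ s in (0 : ℝ)..σ, G (p + s • V) := by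
  have hO : IsOpen (D ∩ (fun p => p + σ • V) ⁻¹' D) :=
    hD.inter (hD.preimage (by fun_prop))
  have hint : Integrable (fun p => ∫ s in (0 : ℝ)..σ, G (p + s • V)) ν := by
    simp only [intervalIntegral.integral_of_le hσ]
    exact (integrable_shear hG V σ).integral_prod_right
  have hush : Integrable (fun p => u (p + σ • V)) ν := hu.comp_add_right (σ • V)
  have key := hO.ae_eq_zero_of_integral_contDiff_smul_eq_zero (μ := ν)
    (f := fun p => u (p + σ • V) - u p - ∫ s in (0 : ℝ)..σ, G (p + s • V))
    (((hush.sub hu).sub hint).locallyIntegrable.locallyIntegrableOn _) ?_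
  · filter_upwards [key] with p hp h1 h2
    have := hp ⟨h1, h2⟩
    linear_combination this
  intro φ h1 h2 h3
  have hder : ∀ s ∈ uIcc 0 σ, HasDerivAt (fun s : ℝ => ∫ p, φ (p - s • V) • u p ∂ν)
      (∫ p, φ (p - s • V) • G p ∂ν) s := by
    intro s hs
    rw [uIcc_of_le hσ] at hs
    have h4 := hasDerivAt_integral_translate hu h1 h2 V s
    have hs1 : ContDiff ℝ ∞ fun p => φ (p - s • V) := h1.comp (by fun_prop)
    have hs2 : HasCompactSupport fun p => φ (p - s • V) :=
      h2.comp_homeomorph (Homeomorph.subRight (s • V))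
    have hts : tsupport (fun p => φ (p - s • V)) = (fun p => p - s • V) ⁻¹' tsupport φ :=
      tsupport_comp_eq_preimage φ (Homeomorph.subRight (s • V))
    have h5 := h _ hs1 hs2 (by
      rw [hts]
      intro q hq
      have h6 := h3 hq
      have h7 : q - s • V + s • V ∈ D := add_smul_mem_of_convex hc h6.1 h6.2 hs
      rwa [sub_add_cancel] at h7)
    have h6 : ∀ p, fderiv ℝ (fun p => φ (p - s • V)) p V = fderiv ℝ φ (p - s • V) V := by
      intro p
      simp only [sub_eq_add_neg]
      rw [fderiv_comp_add_right]
    simp only [h6] at h5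
    rw [integral_add (integrable_smul_of_test hu (φ := fun p => fderiv ℝ φ (p - s • V) V)
        ((continuous_fderiv_apply_const h1 V).comp (by fun_prop))
        ((hasCompactSupport_fderiv_apply_const h2 V).comp_homeomorph
        (Homeomorph.subRight (s • V)))) (integrable_smul_of_test hG hs1.continuous hs2)] at h5
    rwa [neg_eq_of_add_eq_zero_right h5] at h4
  have hcont : Continuous fun s : ℝ => ∫ p, φ (p - s • V) • G p ∂ν :=
    continuous_iff_continuousAt.2 fun s =>
      (hasDerivAt_integral_translate hG h1 h2 V s).continuousAt
  have h4 := intervalIntegral.integral_eq_sub_of_hasDerivAt hder (hcont.intervalIntegrable _ _)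
  rw [integral_shear_swap hG h1.continuous h2 V hσ, integral_translate_eq] at h4
  simp only [zero_smul, sub_zero] at h4
  simp only [smul_sub]
  rw [integral_sub, integral_sub, h4]
  · ring
  · exact integrable_smul_of_test hush h1.continuous h2
  · exact integrable_smul_of_test hu h1.continuous h2
  · exact (integrable_smul_of_test hush h1.continuous h2).sub
      (integrable_smul_of_test hu h1.continuous h2)
  · exact integrable_smul_of_test hint h1.continuous h2

theorem integrable_smul_of_locallyIntegrable {f : E → ℂ} (hf : LocallyIntegrable f ν) {φ : E → ℝ}
    (h1 : Continuous φ) (h2 : HasCompactSupport φ) : Integrable (fun p => φ p • f p) ν :=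
  hf.integrable_smul_left_of_hasCompactSupport h1 h2

/-- A function that grows along characteristics by the integral of the source solves the transport
equation: both sides of the relation, integrated against a test function, are differentiated in
the length of the characteristic segment. -/
theorem WeakTransport.of_ae_eq (hu : LocallyIntegrable u ν) (hG : LocallyIntegrable G ν)
    (h : ∀ s : ℝ, 0 ≤ s → ∀ᵐ p ∂ν, p ∈ D →
      u (p + s • V) = u p + ∫ r in (0 : ℝ)..s, G (p + r • V)) : WeakTransport ν V D u G := by
  intro φ h1 h2 h3
  obtain ⟨R, hR⟩ := h2.isCompact.isBounded.subset_closedBall (0 : E)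
  set K : Set E := Metric.closedBall 0 (R + ‖V‖) with hK
  have hKc : IsCompact K := isCompact_closedBall _ _
  have hRV : Metric.closedBall (0 : E) R ⊆ K :=
    Metric.closedBall_subset_closedBall (by linarith [norm_nonneg V])
  have hsh : ∀ p ∈ tsupport φ, ∀ r ∈ Icc (0 : ℝ) 1, p + r • V ∈ K := by
    intro p hp r hr
    have h4 := hR hp
    rw [mem_closedBall_zero_iff] at h4 ⊢
    calc ‖p + r • V‖ ≤ ‖p‖ + ‖r • V‖ := norm_add_le _ _
      _ ≤ R + ‖V‖ := by
        rw [norm_smul, Real.norm_of_nonneg hr.1]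
        nlinarith [norm_nonneg V, hr.2]
  have hu' : Integrable (K.indicator u) ν :=
    (hu.integrableOn_isCompact hKc).integrable_indicator hKc.measurableSet
  have hG' : Integrable (K.indicator G) ν :=
    (hG.integrableOn_isCompact hKc).integrable_indicator hKc.measurableSet
  have hcont : Continuous fun s : ℝ => ∫ p, φ (p - s • V) • K.indicator G p ∂ν :=
    continuous_iff_continuousAt.2 fun s =>
      (hasDerivAt_integral_translate hG' h1 h2 V s).continuousAt
  have hd1 := hasDerivAt_integral_translate hu' h1 h2 V 0
  have hd2 : HasDerivAt (fun s : ℝ => (∫ p, φ p • K.indicator u p ∂ν)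
      + ∫ r in (0 : ℝ)..s, ∫ p, φ (p - r • V) • K.indicator G p ∂ν)
      (∫ p, φ (p - (0 : ℝ) • V) • K.indicator G p ∂ν) 0 :=
    (intervalIntegral.integral_hasDerivAt_right (hcont.intervalIntegrable _ _)
      hcont.stronglyMeasurable.stronglyMeasurableAtFilter hcont.continuousAt).const_add _
  have hint : Integrable (fun p => φ p • K.indicator u p) ν :=
    integrable_smul_of_test hu' h1.continuous h2
  have heq : ∀ s ∈ Icc (0 : ℝ) 1, ∫ p, φ (p - s • V) • K.indicator u p ∂ν
      = (∫ p, φ p • K.indicator u p ∂ν)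
      + ∫ r in (0 : ℝ)..s, ∫ p, φ (p - r • V) • K.indicator G p ∂ν := by
    intro s hs
    rw [integral_shear_swap hG' h1.continuous h2 V hs.1, integral_translate_eq, ← integral_add hint]
    · refine integral_congr_ae ?_
      filter_upwards [h s hs.1] with p hp
      by_cases hps : p ∈ tsupport φ
      · have h4 : ∫ r in (0 : ℝ)..s, K.indicator G (p + r • V)
            = ∫ r in (0 : ℝ)..s, G (p + r • V) := by
          refine intervalIntegral.integral_congr fun r hr => ?_
          rw [uIcc_of_le hs.1] at hr
          exact indicator_of_mem (hsh p hps r ⟨hr.1, hr.2.trans hs.2⟩) _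
        rw [h4, indicator_of_mem (hsh p hps s hs), indicator_of_mem (hRV (hR hps)), hp (h3 hps),
          smul_add]
      · simp [image_eq_zero_of_notMem_tsupport hps]
    · refine integrable_smul_of_test ?_ h1.continuous h2
      simp only [intervalIntegral.integral_of_le hs.1]
      exact (integrable_shear hG' V s).integral_prod_right
  have h5 := (hd2.hasDerivWithinAt (s := Icc (0 : ℝ) 1)).congr heq (heq 0 (by simp))
  have h6 := (uniqueDiffOn_Icc (zero_lt_one' ℝ) 0 (by simp)).eq_deriv _
    (hd1.hasDerivWithinAt (s := Icc (0 : ℝ) 1)) h5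
  simp only [zero_smul, sub_zero] at h6
  have hφV := continuous_fderiv_apply_const h1 V
  have hφV' := hasCompactSupport_fderiv_apply_const h2 V
  rw [integral_add (integrable_smul_of_locallyIntegrable hu hφV hφV')
    (integrable_smul_of_locallyIntegrable hG h1.continuous h2)]
  have hoff : ∀ (f : E → ℂ) (ψ : E → ℝ), tsupport ψ ⊆ tsupport φ →
      ∫ p, ψ p • K.indicator f p ∂ν = ∫ p, ψ p • f p ∂ν := by
    intro f ψ hψ
    congr 1
    funext p
    by_cases hps : p ∈ tsupport φ
    · rw [indicator_of_mem (hRV (hR hps))]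
    · simp [image_eq_zero_of_notMem_tsupport fun h' => hps (hψ h')]
  rw [hoff _ _ subset_rfl, hoff u (fun p => fderiv ℝ φ p V)] at h6
  · rw [← h6]
    ring
  · refine (closure_mono fun p hp => ?_).trans (tsupport_fderiv_subset ℝ)
    intro h7
    exact hp (by simp [h7])

/-- The weak transport equation may be tested with complex functions: their real and imaginary parts
are admissible. -/
theorem WeakTransport.complex_test (h : WeakTransport ν V D u G) (hu : LocallyIntegrable u ν)
    (hG : LocallyIntegrable G ν) {φ : E → ℂ} (h1 : ContDiff ℝ ∞ φ) (h2 : HasCompactSupport φ)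
    (h3 : tsupport φ ⊆ D) : ∫ p, (fderiv ℝ φ p V * u p + φ p * G p) ∂ν = 0 := by
  have hpart : ∀ L : ℂ →L[ℝ] ℝ, ContDiff ℝ ∞ (fun p => L (φ p)) ∧
      HasCompactSupport (fun p => L (φ p)) ∧ tsupport (fun p => L (φ p)) ⊆ D ∧
      ∀ p, fderiv ℝ (fun p => L (φ p)) p V = L (fderiv ℝ φ p V) := by
    intro L
    refine ⟨L.contDiff.comp h1, h2.comp_left (g := L) (by simp), ?_, fun p => ?_⟩
    · refine Subset.trans (closure_mono fun p hp => ?_) h3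
      intro h0
      exact hp (by simp [h0])
    · have := (L.hasFDerivAt.comp p ((h1.differentiable (by simp)) p).hasFDerivAt).fderiv
      simp only [Function.comp_def] at this
      rw [this]
      rfl
  obtain ⟨a1, a2, a3, a4⟩ := hpart Complex.reCLM
  obtain ⟨b1, b2, b3, b4⟩ := hpart Complex.imCLM
  have ha := h _ a1 a2 a3
  have hb := h _ b1 b2 b3
  have hia : ∀ ψ : E → ℝ, ContDiff ℝ ∞ ψ → HasCompactSupport ψ →
      Integrable (fun p => fderiv ℝ ψ p V • u p + ψ p • G p) ν := fun ψ c1 c2 =>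
    (integrable_smul_of_locallyIntegrable hu (continuous_fderiv_apply_const c1 V)
      (hasCompactSupport_fderiv_apply_const c2 V)).add
      (integrable_smul_of_locallyIntegrable hG c1.continuous c2)
  have hsplit : ∀ p, fderiv ℝ φ p V * u p + φ p * G p
      = (fderiv ℝ (fun p => Complex.reCLM (φ p)) p V • u p + Complex.reCLM (φ p) • G p)
        + Complex.I * (fderiv ℝ (fun p => Complex.imCLM (φ p)) p V • u p
          + Complex.imCLM (φ p) • G p) := by
    intro p
    rw [a4, b4]
    simp only [Complex.reCLM_apply, Complex.imCLM_apply, Complex.real_smul]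
    conv_lhs => rw [← Complex.re_add_im (fderiv ℝ φ p V), ← Complex.re_add_im (φ p)]
    ring
  simp only [hsplit]
  rw [integral_add (hia _ a1 a2) ((hia _ b1 b2).const_mul _), integral_const_mul, ha, hb]
  simp

/-! ### Gluing solutions across a hyperplane -/

theorem tendsto_lintegral_layer {α : Type*} [MeasurableSpace α] {m : Measure α} {f : α → ℝ≥0∞}
    (hf : AEMeasurable f m) (hfin : ∫⁻ p, f p ∂m ≠ ⊤) {ℓ : α → ℝ} (hℓ : Measurable ℓ) :
    Tendsto (fun δ : ℝ => ∫⁻ p in {p | 0 < ℓ p ∧ ℓ p < δ}, f p ∂m) (𝓝[>] 0) (𝓝 0) := by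
  have hmeas : ∀ δ, MeasurableSet {p | 0 < ℓ p ∧ ℓ p < δ} := fun δ =>
    (measurableSet_lt measurable_const hℓ).inter (measurableSet_lt hℓ measurable_const)
  have h := tendsto_lintegral_filter_of_dominated_convergence (μ := m) (l := 𝓝[>] (0 : ℝ))
    (F := fun δ => {p | 0 < ℓ p ∧ ℓ p < δ}.indicator (hf.mk f)) (f := fun _ => 0) (hf.mk f)
    (Eventually.of_forall fun δ => hf.measurable_mk.indicator (hmeas δ))
    (Eventually.of_forall fun δ => Eventually.of_forall fun p => indicator_le_self _ _ _)
    (by rwa [← lintegral_congr_ae hf.ae_eq_mk])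
    (Eventually.of_forall fun p => by
      refine tendsto_const_nhds.congr' ?_
      by_cases hp : 0 < ℓ p
      · filter_upwards [Ioo_mem_nhdsGT hp] with δ hδ
        rw [indicator_of_notMem]
        exact fun h => absurd h.2 (not_lt.2 hδ.2.le)
      · filter_upwards with δ
        rw [indicator_of_notMem]
        exact fun h => hp h.1)
  have h2 : ∀ δ : ℝ, ∫⁻ p in {p | 0 < ℓ p ∧ ℓ p < δ}, f p ∂m
      = ∫⁻ p in {p | 0 < ℓ p ∧ ℓ p < δ}, hf.mk f p ∂m := fun δ =>
    lintegral_congr_ae (ae_restrict_of_ae hf.ae_eq_mk)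
  simpa only [h2, lintegral_indicator (hmeas _), lintegral_zero] using h

/-- A smooth function on the line vanishing on `(-∞, 1/2]` and equal to `1` on `[1, ∞)`. -/
noncomputable def cutoff (x : ℝ) : ℝ := Real.smoothTransition (2 * x - 1)

theorem contDiff_cutoff : ContDiff ℝ ∞ cutoff :=
  Real.smoothTransition.contDiff.comp (by fun_prop)

theorem cutoff_of_le {x : ℝ} (hx : x ≤ 1 / 2) : cutoff x = 0 :=
  Real.smoothTransition.zero_of_nonpos (by linarith)

theorem cutoff_of_ge {x : ℝ} (hx : 1 ≤ x) : cutoff x = 1 :=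
  Real.smoothTransition.one_of_one_le (by linarith)

theorem norm_cutoff_le (x : ℝ) : ‖cutoff x‖ ≤ 1 := by
  rw [cutoff, Real.norm_of_nonneg (Real.smoothTransition.nonneg _)]
  exact Real.smoothTransition.le_one _

theorem deriv_cutoff_of_notMem {x : ℝ} (hx : x ∉ Ioo (0 : ℝ) 1) : deriv cutoff x = 0 := by
  by_cases h : x ≤ 0
  · have : cutoff =ᶠ[𝓝 x] fun _ => 0 := by
      filter_upwards [Iio_mem_nhds (show x < 1 / 2 by linarith)] with y hy
      exact cutoff_of_le (le_of_lt hy)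
    rw [this.deriv_eq, deriv_const]
  · have h1 : 1 ≤ x := by
      by_contra h2
      exact hx ⟨not_le.1 h, not_le.1 h2⟩
    -- at `x = 1` only the right-hand neighbourhood is known, which determines the derivative
    have h3 : HasDerivWithinAt cutoff (deriv cutoff x) (Ici x) x :=
      ((contDiff_cutoff.differentiable (by simp)) x).hasDerivAt.hasDerivWithinAt
    have h4 : HasDerivWithinAt cutoff 0 (Ici x) x :=
      (hasDerivWithinAt_const x (Ici x) (1 : ℝ)).congr
        (fun y hy => cutoff_of_ge (h1.trans hy)) (cutoff_of_ge h1)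
    exact (uniqueDiffOn_Ici x x self_mem_Ici).eq_deriv _ h3 h4

theorem exists_norm_deriv_cutoff_le : ∃ C : ℝ, ∀ x, ‖deriv cutoff x‖ ≤ C := by
  refine (contDiff_cutoff.continuous_deriv (by simp)).bounded_above_of_compact_support ?_
  exact HasCompactSupport.of_support_subset_isCompact (isCompact_Icc (a := (0 : ℝ)) (b := 1))
    fun x hx => by
      by_contra h
      exact hx (deriv_cutoff_of_notMem fun h' => h (Ioo_subset_Icc_self h'))

/-- The equation tested with `φ` cut off to the side of the hyperplane `ℓ = 0` on which `c ℓ > 0`,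
at distance of order `1 / |c|`. -/
theorem WeakTransport.integral_cutoff (ℓ : E →L[ℝ] ℝ) (c : ℝ)
    (hu : Integrable u ν) (hG : Integrable G ν)
    (h : WeakTransport ν V (D ∩ {p | 0 < c * ℓ p}) u G) {φ : E → ℝ} (h1 : ContDiff ℝ ∞ φ)
    (h2 : HasCompactSupport φ) (h3 : tsupport φ ⊆ D) :
    ∫ p, cutoff (c * ℓ p) • (fderiv ℝ φ p V • u p + φ p • G p) ∂ν
      = -(c * ℓ V) • ∫ p, deriv cutoff (c * ℓ p) • φ p • u p ∂ν := by
  have hχ : ContDiff ℝ ∞ fun p => cutoff (c * ℓ p) :=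
    contDiff_cutoff.comp (contDiff_const.mul ℓ.contDiff)
  have hsub : tsupport (fun p => φ p * cutoff (c * ℓ p)) ⊆ D ∩ {p | 0 < c * ℓ p} := by
    have hcl : tsupport (fun p => φ p * cutoff (c * ℓ p)) ⊆ {p | 1 / 2 ≤ c * ℓ p} := by
      refine closure_minimal (fun p hp => ?_) (isClosed_le (by fun_prop) (by fun_prop))
      by_contra h4
      exact hp (by simp [cutoff_of_le (not_le.1 h4).le])
    intro p hp
    refine ⟨h3 (closure_mono (fun q hq => left_ne_zero_of_mul hq) hp), ?_⟩
    have : 1 / 2 ≤ c * ℓ p := hcl hp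
    show 0 < c * ℓ p
    linarith
  have h4 := h _ (h1.mul hχ) h2.mul_right hsub
  have hder : ∀ p, fderiv ℝ (fun p => φ p * cutoff (c * ℓ p)) p V
      = cutoff (c * ℓ p) * fderiv ℝ φ p V + φ p * (deriv cutoff (c * ℓ p) * (c * ℓ V)) := by
    intro p
    have h5 : HasFDerivAt (fun p => c * ℓ p) (c • ℓ : E →L[ℝ] ℝ) p := ℓ.hasFDerivAt.const_mul c
    have h6 := ((contDiff_cutoff.differentiable (by simp)) (c * ℓ p)).hasDerivAt.comp_hasFDerivAt
      p h5
    have h7 := (((h1.differentiable (by simp)) p).hasFDerivAt.mul h6).fderiv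
    simp only [Function.comp_def] at h7
    have h8 : (φ * fun p => cutoff (c * ℓ p)) = fun p => φ p * cutoff (c * ℓ p) := rfl
    rw [h8] at h7
    rw [h7]
    simp
    ring
  have hi1 : Integrable (fun p => cutoff (c * ℓ p) • (fderiv ℝ φ p V • u p + φ p • G p)) ν :=
    ((integrable_smul_of_test hu (continuous_fderiv_apply_const h1 V)
      (hasCompactSupport_fderiv_apply_const h2 V)).add
      (integrable_smul_of_test hG h1.continuous h2)).bdd_smul 1
      hχ.continuous.aestronglyMeasurable (Eventually.of_forall fun p => norm_cutoff_le _)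
  obtain ⟨C, hC⟩ := exists_norm_deriv_cutoff_le
  have hi2 : Integrable (fun p => deriv cutoff (c * ℓ p) • φ p • u p) ν :=
    (integrable_smul_of_test hu h1.continuous h2).bdd_smul C
      ((contDiff_cutoff.continuous_deriv (by simp)).comp
        (continuous_const.mul ℓ.continuous)).aestronglyMeasurable
      (Eventually.of_forall fun p => hC _)
  have h5 : (fun p => fderiv ℝ (fun p => φ p * cutoff (c * ℓ p)) p V • u p
      + (φ p * cutoff (c * ℓ p)) • G p)
      = fun p => cutoff (c * ℓ p) • (fderiv ℝ φ p V • u p + φ p • G p)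
        + (c * ℓ V) • (deriv cutoff (c * ℓ p) • φ p • u p) := by
    funext p
    rw [hder]
    simp only [Complex.real_smul]
    push_cast
    ring
  have hi3 : Integrable (fun p => (c * ℓ V) • (deriv cutoff (c * ℓ p) • φ p • u p)) ν :=
    hi2.smul (c * ℓ V)
  rw [h5, integral_add hi1 hi3, integral_smul] at h4
  rw [neg_smul]
  exact eq_neg_of_add_eq_zero_left h4

/-- Solutions on the two sides of the hyperplane `ℓ = 0` whose boundary values agree form a solution
across it. The test functions are cut off near the hyperplane by functions of `ℓ / δ`; the error
is a mean over the layer `0 < ℓ < δ` of the difference of `φ u` and its mirror image. -/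
theorem WeakTransport.glue (ℓ : E →L[ℝ] ℝ) {n : E} {ρ : E → E}
    (hρ : ∀ p, ρ p = p - (2 * ℓ p) • n) (hρℓ : ∀ p, ℓ (ρ p) = -ℓ p)
    (hρν : MeasurePreserving ρ ν ν) (hρe : MeasurableEmbedding ρ)
    (hu : Integrable u ν) (hG : Integrable G ν) (hℓ0 : ℓ ≠ 0) (hD : MeasurableSet D)
    (hpos : WeakTransport ν V (D ∩ {p | 0 < ℓ p}) u G)
    (hneg : WeakTransport ν V (D ∩ {p | ℓ p < 0}) u G)
    (hmatch : Tendsto (fun δ : ℝ => (ENNReal.ofReal δ)⁻¹ *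
      ∫⁻ p in D ∩ {p | 0 < ℓ p ∧ ℓ p < δ}, ‖u p - u (ρ p)‖ₑ ∂ν) (𝓝[>] 0) (𝓝 0)) :
    WeakTransport ν V D u G := by
  intro φ h1 h2 h3
  set W : E → ℂ := fun p => fderiv ℝ φ p V • u p + φ p • G p with hW
  have hWi : Integrable W ν := (integrable_smul_of_test hu (continuous_fderiv_apply_const h1 V)
      (hasCompactSupport_fderiv_apply_const h2 V)).add
      (integrable_smul_of_test hG h1.continuous h2)
  have hWc : ∀ c : ℝ, Integrable (fun p => cutoff (c * ℓ p) • W p) ν := fun c =>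
    hWi.bdd_smul 1 ((contDiff_cutoff.continuous.comp (continuous_const.mul
      ℓ.continuous)).aestronglyMeasurable) (Eventually.of_forall fun p => norm_cutoff_le _)
  have hφu := integrable_smul_of_test hu h1.continuous h2
  obtain ⟨C, hC⟩ := exists_norm_deriv_cutoff_le
  obtain ⟨M, hM⟩ := h1.continuous.bounded_above_of_compact_support h2
  obtain ⟨K, hK⟩ := h1.lipschitzWith_of_hasCompactSupport h2 (by simp)
  have huρ : Integrable (fun p => u (ρ p)) ν := hρν.integrable_comp_of_integrable hu
  have hφuρ : Integrable (fun p => φ (ρ p) • u (ρ p)) ν :=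
    hρν.integrable_comp_of_integrable hφu
  have hχ' : ∀ c : ℝ, Continuous fun p => deriv cutoff (c * ℓ p) := fun c =>
    (contDiff_cutoff.continuous_deriv (by simp)).comp (continuous_const.mul ℓ.continuous)
  -- the error term for a given layer width
  set B : ℝ → ℂ := fun δ =>
    ∫ p, deriv cutoff (δ⁻¹ * ℓ p) • (φ p • u p - φ (ρ p) • u (ρ p)) ∂ν with hB
  have hident : ∀ δ : ℝ, 0 < δ → ∫ p, (cutoff (δ⁻¹ * ℓ p) + cutoff (-δ⁻¹ * ℓ p)) • W p ∂ν
      = -(δ⁻¹ * ℓ V) • B δ := by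
    intro δ hδ
    have hδ' : 0 < δ⁻¹ := inv_pos.2 hδ
    have e1 := WeakTransport.integral_cutoff ℓ δ⁻¹ hu hG (hpos.mono (D' := D ∩ {p | 0 < δ⁻¹ * ℓ p})
      (inter_subset_inter_right _ fun p hp => by
        exact pos_of_mul_pos_right hp hδ'.le)) h1 h2 h3
    have e2 := WeakTransport.integral_cutoff ℓ (-δ⁻¹) hu hG (hneg.mono
      (D' := D ∩ {p | 0 < -δ⁻¹ * ℓ p}) (inter_subset_inter_right _ fun p hp => by
        have hp' : 0 < δ⁻¹ * (-ℓ p) := by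
          have : 0 < -δ⁻¹ * ℓ p := hp
          linarith
        have := pos_of_mul_pos_right hp' hδ'.le
        show ℓ p < 0
        linarith)) h1 h2 h3
    have e3 : ∫ p, deriv cutoff (-δ⁻¹ * ℓ p) • φ p • u p ∂ν
        = ∫ p, deriv cutoff (δ⁻¹ * ℓ p) • φ (ρ p) • u (ρ p) ∂ν := by
      rw [← hρν.integral_comp hρe]
      simp only [hρℓ, neg_mul_neg]
    have i1 : Integrable (fun p => deriv cutoff (δ⁻¹ * ℓ p) • φ p • u p) ν :=
      hφu.bdd_smul C (hχ' _).aestronglyMeasurable (Eventually.of_forall fun p => hC _)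
    have i2 : Integrable (fun p => deriv cutoff (δ⁻¹ * ℓ p) • φ (ρ p) • u (ρ p)) ν :=
      hφuρ.bdd_smul C (hχ' _).aestronglyMeasurable (Eventually.of_forall fun p => hC _)
    simp only [add_smul]
    rw [integral_add (hWc _) (hWc _), e1, e2, e3, hB]
    simp only [smul_sub]
    rw [integral_sub i1 i2]
    simp only [Complex.real_smul]
    push_cast
    ring
  have hlim1 : Tendsto (fun δ : ℝ => ∫ p, (cutoff (δ⁻¹ * ℓ p) + cutoff (-δ⁻¹ * ℓ p)) • W p ∂ν)
      (𝓝[>] 0) (𝓝 (∫ p, W p ∂ν)) := by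
    refine tendsto_integral_filter_of_dominated_convergence (fun p => 2 * ‖W p‖) ?_ ?_ ?_ ?_
    · refine Eventually.of_forall fun δ => ?_
      simp only [add_smul]
      exact ((hWc _).add (hWc _)).1
    · refine Eventually.of_forall fun δ => Eventually.of_forall fun p => ?_
      rw [norm_smul]
      refine mul_le_mul_of_nonneg_right ((norm_add_le _ _).trans ?_) (norm_nonneg _)
      linarith [norm_cutoff_le (δ⁻¹ * ℓ p), norm_cutoff_le (-δ⁻¹ * ℓ p)]
    · exact hWi.norm.const_mul 2
    · have hnull : ν {p | ℓ p = 0} = 0 :=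
        Measure.addHaar_submodule ν (LinearMap.ker (ℓ : E →ₗ[ℝ] ℝ)) (by
          intro h
          exact hℓ0 (ContinuousLinearMap.coe_injective (LinearMap.ker_eq_top.1 h)))
      filter_upwards [measure_eq_zero_iff_ae_notMem.1 hnull] with p hp
      have hp' : 0 < |ℓ p| := abs_pos.2 hp
      refine tendsto_const_nhds.congr' ?_
      filter_upwards [Ioo_mem_nhdsGT hp'] with δ hδ
      have hδ1 : 1 ≤ δ⁻¹ * |ℓ p| := by
        rw [inv_mul_eq_div, one_le_div hδ.1]
        exact hδ.2.le
      rcases abs_cases (ℓ p) with ⟨h4, h5⟩ | ⟨h4, h5⟩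
      · rw [h4] at hδ1
        rw [cutoff_of_ge hδ1, cutoff_of_le (by linarith)]
        simp
      · rw [h4] at hδ1
        rw [cutoff_of_ge (x := -δ⁻¹ * ℓ p) (by linarith), cutoff_of_le (by linarith)]
        simp
  have hBle : ∀ δ : ℝ, 0 < δ → ‖-(δ⁻¹ * ℓ V) • B δ‖ₑ ≤ ‖ℓ V‖ₑ * (ENNReal.ofReal C *
      (ENNReal.ofReal M * ((ENNReal.ofReal δ)⁻¹ *
        ∫⁻ p in D ∩ {p | 0 < ℓ p ∧ ℓ p < δ}, ‖u p - u (ρ p)‖ₑ ∂ν)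
      + K * ENNReal.ofReal (2 * ‖n‖) *
        ∫⁻ p in {p | 0 < ℓ p ∧ ℓ p < δ}, ‖u (ρ p)‖ₑ ∂ν)) := by
    intro δ hδ
    set S : Set E := {p | 0 < ℓ p ∧ ℓ p < δ} with hS
    have hSm : MeasurableSet S := (measurableSet_lt measurable_const ℓ.continuous.measurable).inter
      (measurableSet_lt ℓ.continuous.measurable measurable_const)
    have hδe : ENNReal.ofReal δ ≠ 0 := by simpa using hδ
    have hpt : ∀ p, ‖deriv cutoff (δ⁻¹ * ℓ p) • (φ p • u p - φ (ρ p) • u (ρ p))‖ₑ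
        ≤ ENNReal.ofReal C * (ENNReal.ofReal M * (D ∩ S).indicator (fun p => ‖u p - u (ρ p)‖ₑ) p
          + K * ENNReal.ofReal (2 * ‖n‖) * ENNReal.ofReal δ
            * S.indicator (fun p => ‖u (ρ p)‖ₑ) p) := by
      intro p
      by_cases hp : p ∈ S
      · rw [enorm_smul]
        refine mul_le_mul' ?_ ?_
        · rw [← ofReal_norm]
          exact ENNReal.ofReal_le_ofReal (hC _)
        · have h4 : φ p • u p - φ (ρ p) • u (ρ p)
              = φ p • (u p - u (ρ p)) + (φ p - φ (ρ p)) • u (ρ p) := by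
            simp only [smul_sub, sub_smul]
            abel
          rw [h4, indicator_of_mem hp]
          refine (enorm_add_le _ _).trans (add_le_add ?_ ?_)
          · rw [enorm_smul]
            by_cases hpD : p ∈ D
            · rw [indicator_of_mem (show p ∈ D ∩ S from ⟨hpD, hp⟩), ← ofReal_norm (φ p)]
              exact mul_le_mul' (ENNReal.ofReal_le_ofReal (hM p)) le_rfl
            · simp [image_eq_zero_of_notMem_tsupport fun h' => hpD (h3 h')]
          · rw [enorm_smul]
            refine mul_le_mul' ?_ le_rfl
            rw [← edist_eq_enorm_sub]
            refine (hK p (ρ p)).trans ?_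
            rw [mul_assoc]
            refine mul_le_mul' le_rfl ?_
            rw [← ENNReal.ofReal_mul (by positivity), edist_dist, dist_eq_norm]
            refine ENNReal.ofReal_le_ofReal ?_
            rw [hρ, sub_sub_cancel, norm_smul, Real.norm_of_nonneg (by linarith [hp.1])]
            nlinarith [norm_nonneg n, hp.2]
      · have h5 : δ⁻¹ * ℓ p ∉ Ioo (0 : ℝ) 1 := fun h6 => hp
          ⟨pos_of_mul_pos_right h6.1 (inv_pos.2 hδ).le, by
            have := h6.2
            rwa [inv_mul_lt_iff₀ hδ, mul_one] at this⟩
        simp [deriv_cutoff_of_notMem h5]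
    have hBb : ‖B δ‖ₑ ≤ ENNReal.ofReal C * (ENNReal.ofReal M *
        ∫⁻ p in D ∩ S, ‖u p - u (ρ p)‖ₑ ∂ν + K * ENNReal.ofReal (2 * ‖n‖) * ENNReal.ofReal δ
          * ∫⁻ p in S, ‖u (ρ p)‖ₑ ∂ν) := by
      refine (enorm_integral_le_lintegral_enorm _).trans ((lintegral_mono hpt).trans ?_)
      rw [lintegral_const_mul' _ _ ENNReal.ofReal_ne_top,
        lintegral_add_right' _ ((huρ.1.enorm.indicator hSm).const_mul _),
        lintegral_const_mul' _ _ ENNReal.ofReal_ne_top,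
        lintegral_const_mul' _ _ (by finiteness),
        lintegral_indicator (hD.inter hSm), lintegral_indicator hSm]
    rw [enorm_smul, enorm_neg, enorm_mul, enorm_inv hδ.ne', Real.enorm_of_nonneg hδ.le,
      mul_comm _ ‖ℓ V‖ₑ, mul_assoc]
    refine mul_le_mul' le_rfl ((mul_le_mul' le_rfl hBb).trans (le_of_eq ?_))
    have hcancel : (ENNReal.ofReal δ)⁻¹ * ENNReal.ofReal δ = 1 :=
      ENNReal.inv_mul_cancel hδe ENNReal.ofReal_ne_top
    calc _ = ENNReal.ofReal C * (ENNReal.ofReal M * ((ENNReal.ofReal δ)⁻¹ *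
          ∫⁻ p in D ∩ S, ‖u p - u (ρ p)‖ₑ ∂ν) + K * ENNReal.ofReal (2 * ‖n‖)
          * ((ENNReal.ofReal δ)⁻¹ * ENNReal.ofReal δ) * ∫⁻ p in S, ‖u (ρ p)‖ₑ ∂ν) := by ring
      _ = _ := by rw [hcancel, mul_one]
  have hlim2 : Tendsto (fun δ : ℝ => -(δ⁻¹ * ℓ V) • B δ) (𝓝[>] 0) (𝓝 0) := by
    rw [tendsto_zero_iff_enorm_tendsto_zero]
    have hl := tendsto_lintegral_layer huρ.1.enorm huρ.2.ne ℓ.continuous.measurable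
    refine tendsto_of_tendsto_of_tendsto_of_le_of_le' tendsto_const_nhds (h := fun δ => _) ?_
      (Eventually.of_forall fun _ => zero_le) (by
        filter_upwards [self_mem_nhdsWithin] with δ hδ
        exact hBle δ hδ)
    have a1 := ENNReal.Tendsto.const_mul (a := ENNReal.ofReal M) hmatch
      (Or.inr ENNReal.ofReal_ne_top)
    have a2 := ENNReal.Tendsto.const_mul (a := K * ENNReal.ofReal (2 * ‖n‖)) hl
      (Or.inr (by finiteness))
    have a3 := ENNReal.Tendsto.const_mul (a := ‖ℓ V‖ₑ) (ENNReal.Tendsto.const_mul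
      (a := ENNReal.ofReal C) (a1.add a2) (Or.inr ENNReal.ofReal_ne_top)) (Or.inr (by finiteness))
    simpa using a3
  refine tendsto_nhds_unique hlim1 (hlim2.congr' ?_)
  filter_upwards [self_mem_nhdsWithin] with δ hδ
  exact (hident δ hδ).symm

end Transport

/-! ### Velocities, reflections and unfolding -/

/-- The velocity of a particle whose spin index is `i`: the sign `-` moves to the right. -/
def vel : Fin 2 → ℝ := ![1, -1]

@[simp] theorem vel_zero : vel 0 = 1 := rfl

@[simp] theorem vel_one : vel 1 = -1 := rfl

/-- The velocity of the configuration in the component with label `w`. -/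
def vel3 (w : Label) : Config := (vel w.1, vel w.2.1, vel w.2.2)

/-- The exchange of the photon and the first electron. -/
def swapL {α : Type} (x : α × α × α) : α × α × α := (x.2.1, x.1, x.2.2)

/-- The exchange of the photon and the second electron. -/
def swapR {α : Type} (x : α × α × α) : α × α × α := (x.2.2, x.2.1, x.1)

/-- The amplitude with which a wave crosses the wall `C₁`, as a function of any point of the
characteristic: the argument of `μ` is the distance of the electrons at the crossing. It vanishes
for the labels that do not enter the domain through `C₁`. -/
noncomputable def ampL (μ : ℝ → ℝ) (θ : ℝ) (w : Label) (x : Config) : ℂ :=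
  if w.1 = 0 ∧ w.2.1 = 1 then
    (μ |x.2.2 - ((1 + vel w.2.2) / 2 * x.1 + (1 - vel w.2.2) / 2 * x.2.1)| : ℂ)
      * Complex.exp (Complex.I * (θ : ℂ)) else 0

/-- The amplitude with which a wave crosses the wall `C₂`; see `ampL`. -/
noncomputable def ampR (μ : ℝ → ℝ) (θ : ℝ) (w : Label) (x : Config) : ℂ :=
  if w.1 = 1 ∧ w.2.2 = 0 then
    (μ |(1 - vel w.2.1) / 2 * x.1 + (1 + vel w.2.1) / 2 * x.2.2 - x.2.1| : ℂ)
      * Complex.exp (Complex.I * (θ : ℂ)) else 0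

/-- The component `w` of a state, extended by zero from `S1`. -/
noncomputable def onS1 (φ : Label → Config → ℂ) (w : Label) (x : Config) : ℂ :=
  S1.indicator (φ w) x

/-- The state `φ` unfolded along the characteristics of the component `w`: at a point behind the
walls it is the value of `φ` at the reflected point, in the reflected component, times the
amplitudes of the walls in between. A characteristic crosses at most two walls. -/
noncomputable def unfolded (μ : ℝ → ℝ) (θ₁ θ₂ : ℝ) (φ : Label → Config → ℂ) (w : Label)
    (x : Config) : ℂ :=
  onS1 φ w x
  + ampL μ θ₁ w x * (onS1 φ (swapL w) (swapL x)
      + ampR μ θ₂ (swapL w) (swapL x) * onS1 φ (swapR (swapL w)) (swapR (swapL x)))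
  + ampR μ θ₂ w x * (onS1 φ (swapR w) (swapR x)
      + ampL μ θ₁ (swapR w) (swapR x) * onS1 φ (swapL (swapR w)) (swapL (swapR x)))

/-- The mass term: the source in the transport equation of the component `w`, with `κ = m / ℏ`. -/
noncomputable def massTerm (κ : ℝ) (φ : Label → Config → ℂ) (w : Label) (x : Config) : ℂ :=
  -(Complex.I * (κ : ℂ)) * (φ (w.1, 1 - w.2.1, w.2.2) x + φ (w.1, w.2.1, 1 - w.2.2) x)

instance : (volume : Measure (ℝ × ℝ × ℝ)).IsAddHaarMeasure :=
  have : (volume : Measure (ℝ × ℝ)).IsAddHaarMeasure :=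
    Measure.prod.instIsAddHaarMeasure volume volume
  Measure.prod.instIsAddHaarMeasure (volume : Measure ℝ) (volume : Measure (ℝ × ℝ))

instance : (volume : Measure (ℝ × ℝ × ℝ × ℝ)).IsAddHaarMeasure :=
  Measure.prod.instIsAddHaarMeasure (volume : Measure ℝ) (volume : Measure (ℝ × ℝ × ℝ))

instance : (volume : Measure ((ℝ × ℝ × ℝ) × ℝ)).IsAddHaarMeasure :=
  Measure.prod.instIsAddHaarMeasure (volume : Measure (ℝ × ℝ × ℝ)) (volume : Measure ℝ)

theorem isOpen_S1 : IsOpen S1 :=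
  (isOpen_lt (f := fun x : Config => x.2.1) (g := fun x => x.1) (by fun_prop) (by fun_prop)).inter
    (isOpen_lt (f := fun x : Config => x.1) (g := fun x => x.2.2) (by fun_prop) (by fun_prop))

theorem measurableSet_S1 : MeasurableSet S1 := isOpen_S1.measurableSet

theorem convex_S1 : Convex ℝ S1 := by
  rintro x ⟨h1, h2⟩ y ⟨h3, h4⟩ a b ha hb hab
  simp only [S1, mem_ofPred_eq, Prod.fst_add, Prod.snd_add, Prod.smul_fst, Prod.smul_snd,
    smul_eq_mul]
  rcases eq_or_lt_of_le ha with rfl | ha'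
  · have : b = 1 := by linarith
    subst this
    constructor <;> linarith
  · constructor <;> nlinarith

section Amplitudes

variable {μ : ℝ → ℝ} {θ : ℝ}

theorem norm_ampL_le (hμ : ∀ s, ‖μ |s|‖ ≤ 1) (w : Label) (x : Config) : ‖ampL μ θ w x‖ ≤ 1 := by
  unfold ampL
  split_ifs
  · rw [norm_mul, mul_comm Complex.I, Complex.norm_exp_ofReal_mul_I, mul_one, Complex.norm_real]
    exact hμ _
  · simp

theorem norm_ampR_le (hμ : ∀ s, ‖μ |s|‖ ≤ 1) (w : Label) (x : Config) : ‖ampR μ θ w x‖ ≤ 1 := by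
  unfold ampR
  split_ifs
  · rw [norm_mul, mul_comm Complex.I, Complex.norm_exp_ofReal_mul_I, mul_one, Complex.norm_real]
    exact hμ _
  · simp

theorem ampL_add_smul (w : Label) (x : Config) (s : ℝ) :
    ampL μ θ w (x + s • vel3 w) = ampL μ θ w x := by
  unfold ampL
  split_ifs with h
  · simp only [vel3, h.1, h.2, Prod.fst_add, Prod.snd_add, Prod.smul_fst, Prod.smul_snd,
      smul_eq_mul, vel_zero, vel_one]
    congr 4
    ring_nf
  · rfl

theorem ampR_add_smul (w : Label) (x : Config) (s : ℝ) :
    ampR μ θ w (x + s • vel3 w) = ampR μ θ w x := by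
  unfold ampR
  split_ifs with h
  · simp only [vel3, h.1, h.2, Prod.fst_add, Prod.snd_add, Prod.smul_fst, Prod.smul_snd,
      smul_eq_mul, vel_zero, vel_one]
    congr 4
    ring_nf
  · rfl

theorem measurable_ampL (hμ : Measurable fun s => μ |s|) (w : Label) :
    Measurable (ampL μ θ w) := by
  unfold ampL
  split_ifs
  · exact (Complex.measurable_ofReal.comp (hμ.comp (by fun_prop))).mul_const _
  · exact measurable_const

theorem measurable_ampR (hμ : Measurable fun s => μ |s|) (w : Label) :
    Measurable (ampR μ θ w) := by
  unfold ampR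
  split_ifs
  · exact (Complex.measurable_ofReal.comp (hμ.comp (by fun_prop))).mul_const _
  · exact measurable_const

theorem ampL_eq_zero {w : Label} (h : ¬(w.1 = 0 ∧ w.2.1 = 1)) (x : Config) : ampL μ θ w x = 0 :=
  if_neg h

theorem ampR_eq_zero {w : Label} (h : ¬(w.1 = 1 ∧ w.2.2 = 0)) (x : Config) : ampR μ θ w x = 0 :=
  if_neg h

end Amplitudes

theorem swapL_add_smul (x y : Config) (s : ℝ) : swapL (x + s • y) = swapL x + s • swapL y := rfl

theorem swapR_add_smul (x y : Config) (s : ℝ) : swapR (x + s • y) = swapR x + s • swapR y := rfl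

/-- The exchange of the photon and the first electron as a linear equivalence. -/
noncomputable def swapLₗ : Config ≃L[ℝ] Config :=
  LinearEquiv.toContinuousLinearEquiv
    { toFun := swapL, invFun := swapL, map_add' := fun _ _ => rfl, map_smul' := fun _ _ => rfl,
      left_inv := fun _ => rfl, right_inv := fun _ => rfl }

/-- The exchange of the photon and the second electron as a linear equivalence. -/
noncomputable def swapRₗ : Config ≃L[ℝ] Config :=
  LinearEquiv.toContinuousLinearEquiv
    { toFun := swapR, invFun := swapR, map_add' := fun _ _ => rfl, map_smul' := fun _ _ => rfl,
      left_inv := fun _ => rfl, right_inv := fun _ => rfl }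

theorem measurable_swapL : Measurable (swapL : Config → Config) := swapLₗ.continuous.measurable

theorem measurable_swapR : Measurable (swapR : Config → Config) := swapRₗ.continuous.measurable

theorem measurePreserving_swapL : MeasurePreserving (swapL : Config → Config) volume volume := by
  -- reassociate, exchange the first pair, reassociate back
  have h1 : MeasurePreserving (MeasurableEquiv.prodAssoc (α := ℝ) (β := ℝ) (γ := ℝ))
      volume volume := measurePreserving_prodAssoc volume volume volume
  have h2 : MeasurePreserving (Prod.swap : ℝ × ℝ → ℝ × ℝ) volume volume :=
    Measure.measurePreserving_swap
  have h3 : MeasurePreserving (Prod.map (Prod.swap : ℝ × ℝ → ℝ × ℝ) (id : ℝ → ℝ)) volume volume :=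
    h2.prod (MeasurePreserving.id volume)
  exact (h1.comp h3).comp h1.symm

theorem measurePreserving_swapR : MeasurePreserving (swapR : Config → Config) volume volume := by
  -- this exchange is conjugate to `swapL` under the exchange of the last two coordinates
  have h2 : MeasurePreserving (Prod.swap : ℝ × ℝ → ℝ × ℝ) volume volume :=
    Measure.measurePreserving_swap
  have h3 : MeasurePreserving (Prod.map (id : ℝ → ℝ) (Prod.swap : ℝ × ℝ → ℝ × ℝ)) volume volume :=
    (MeasurePreserving.id volume).prod h2
  exact (h3.comp measurePreserving_swapL).comp h3

section Unfolded

variable {μ : ℝ → ℝ} {θ₁ θ₂ : ℝ} {φ χ : Label → Config → ℂ}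

theorem onS1_of_mem {x : Config} (hx : x ∈ S1) (w : Label) : onS1 φ w x = φ w x :=
  indicator_of_mem hx _

theorem onS1_of_notMem {x : Config} (hx : x ∉ S1) (w : Label) : onS1 φ w x = 0 :=
  indicator_of_notMem hx _

theorem unfolded_of_mem {x : Config} (hx : x ∈ S1) (w : Label) :
    unfolded μ θ₁ θ₂ φ w x = φ w x := by
  obtain ⟨h1, h2⟩ := hx
  have a1 : swapL x ∉ S1 := fun h => lt_asymm h1 h.1
  have a2 : swapR (swapL x) ∉ S1 := fun h => by
    have := h.1; have := h.2; simp only [swapL, swapR] at *; linarith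
  have a3 : swapR x ∉ S1 := fun h => lt_asymm h2 h.2
  have a4 : swapL (swapR x) ∉ S1 := fun h => by
    have := h.1; have := h.2; simp only [swapL, swapR] at *; linarith
  simp [unfolded, onS1_of_mem (show x ∈ S1 from ⟨h1, h2⟩), onS1_of_notMem a1, onS1_of_notMem a2,
    onS1_of_notMem a3, onS1_of_notMem a4]

/-- Behind the wall `C₁`, the unfolded state is reflected with the amplitude of `C₁`. -/
theorem unfolded_swapL (c : Fin 2) {x : Config} (hx : x.1 ≤ x.2.1) :
    unfolded μ θ₁ θ₂ φ (0, 1, c) x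
      = ampL μ θ₁ (0, 1, c) x * unfolded μ θ₁ θ₂ φ (1, 0, c) (swapL x) := by
  have h1 : x ∉ S1 := fun h => absurd h.1 (not_lt.2 hx)
  have h2 : ∀ d : Fin 2,
      ¬((swapR ((1, 0, d) : Label)).1 = 0 ∧ (swapR ((1, 0, d) : Label)).2.1 = 1) :=
    fun d h => by simp [swapR] at h
  have h3 : ∀ y, ampR μ θ₂ (0, 1, c) y = 0 := fun y => ampR_eq_zero (by simp) y
  have h4 : ∀ y, ampL μ θ₁ (1, 0, c) y = 0 := fun y => ampL_eq_zero (by simp) y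
  simp only [unfolded, onS1_of_notMem h1, h3, h4,
    show swapL ((0, 1, c) : Label) = (1, 0, c) from rfl,
    ampL_eq_zero (h2 c)]
  ring

/-- Behind the wall `C₂`, the unfolded state is reflected with the amplitude of `C₂`. -/
theorem unfolded_swapR (b : Fin 2) {x : Config} (hx : x.2.2 ≤ x.1) :
    unfolded μ θ₁ θ₂ φ (1, b, 0) x
      = ampR μ θ₂ (1, b, 0) x * unfolded μ θ₁ θ₂ φ (0, b, 1) (swapR x) := by
  have h1 : x ∉ S1 := fun h => absurd h.2 (not_lt.2 hx)
  have h2 : ∀ d : Fin 2,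
      ¬((swapL ((0, d, 1) : Label)).1 = 1 ∧ (swapL ((0, d, 1) : Label)).2.2 = 0) :=
    fun d h => by simp [swapL] at h
  have h3 : ∀ y, ampL μ θ₁ (1, b, 0) y = 0 := fun y => ampL_eq_zero (by simp) y
  have h4 : ∀ y, ampR μ θ₂ (0, b, 1) y = 0 := fun y => ampR_eq_zero (by simp) y
  simp only [unfolded, onS1_of_notMem h1, h3, h4,
    show swapR ((1, b, 0) : Label) = (0, b, 1) from rfl,
    ampR_eq_zero (h2 b)]
  ring

theorem unfolded_sub (w : Label) (x : Config) :
    unfolded μ θ₁ θ₂ (fun w x => φ w x - χ w x) w x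
      = unfolded μ θ₁ θ₂ φ w x - unfolded μ θ₁ θ₂ χ w x := by
  have h : ∀ w x, onS1 (fun w x => φ w x - χ w x) w x = onS1 φ w x - onS1 χ w x := by
    intro w x
    by_cases hx : x ∈ S1
    · simp [onS1_of_mem hx]
    · simp [onS1_of_notMem hx]
  simp only [unfolded, h]
  ring

theorem norm_unfolded_le (hμ : ∀ s, ‖μ |s|‖ ≤ 1) {B : ℝ} (hB : 0 ≤ B)
    (h : ∀ w, ∀ x ∈ S1, ‖φ w x‖ ≤ B) (w : Label) (x : Config) :
    ‖unfolded μ θ₁ θ₂ φ w x‖ ≤ 5 * B := by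
  have h0 : ∀ w x, ‖onS1 φ w x‖ ≤ B := by
    intro w x
    by_cases hx : x ∈ S1
    · rw [onS1_of_mem hx]
      exact h w x hx
    · rwa [onS1_of_notMem hx, norm_zero]
  have hm : ∀ {a z : ℂ} {C : ℝ}, ‖a‖ ≤ 1 → ‖z‖ ≤ C → ‖a * z‖ ≤ C := fun {a z C} ha hz => by
    rw [norm_mul]
    nlinarith [norm_nonneg a, norm_nonneg z]
  have h1 := hm (norm_ampR_le (θ := θ₂) hμ (swapL w) (swapL x))
    (h0 (swapR (swapL w)) (swapR (swapL x)))
  have h2 := hm (norm_ampL_le (θ := θ₁) hμ (swapR w) (swapR x))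
    (h0 (swapL (swapR w)) (swapL (swapR x)))
  have h3 := hm (norm_ampL_le (θ := θ₁) hμ w x) ((norm_add_le _ _).trans
    (add_le_add (h0 (swapL w) (swapL x)) h1))
  have h4 := hm (norm_ampR_le (θ := θ₂) hμ w x) ((norm_add_le _ _).trans
    (add_le_add (h0 (swapR w) (swapR x)) h2))
  have h5 := (norm_add_le _ _).trans (add_le_add ((norm_add_le _ _).trans
    (add_le_add (h0 w x) h3)) h4)
  exact h5.trans (by linarith)

/-- Unfolding at each value of a parameter preserves joint measurability. -/
theorem measurable_unfolded (hμ : Measurable fun s => μ |s|) {α : Type*} [MeasurableSpace α]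
    {ψ : α → Label → Config → ℂ} (h : ∀ w, Measurable fun p : α × Config => ψ p.1 w p.2)
    (w : Label) : Measurable fun p : α × Config => unfolded μ θ₁ θ₂ (ψ p.1) w p.2 := by
  have h0 : ∀ w, Measurable fun p : α × Config => onS1 (ψ p.1) w p.2 := by
    intro w
    have : (fun p : α × Config => onS1 (ψ p.1) w p.2)
        = (Prod.snd ⁻¹' S1).indicator fun p : α × Config => ψ p.1 w p.2 := by
      rfl
    rw [this]
    exact (h w).indicator (measurable_snd measurableSet_S1)
  have hL : Measurable fun p : α × Config => (p.1, swapL p.2) :=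
    measurable_fst.prodMk (measurable_swapL.comp measurable_snd)
  have hR : Measurable fun p : α × Config => (p.1, swapR p.2) :=
    measurable_fst.prodMk (measurable_swapR.comp measurable_snd)
  have aL : ∀ w, Measurable fun p : α × Config => ampL μ θ₁ w p.2 := fun w =>
    (measurable_ampL hμ w).comp measurable_snd
  have aR : ∀ w, Measurable fun p : α × Config => ampR μ θ₂ w p.2 := fun w =>
    (measurable_ampR hμ w).comp measurable_snd
  exact ((h0 w).add ((aL w).mul (((h0 _).comp hL).add
    (((aR _).comp hL).mul ((h0 _).comp (hR.comp hL)))))).add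
    ((aR w).mul (((h0 _).comp hR).add (((aL _).comp hR).mul ((h0 _).comp (hL.comp hR)))))

theorem measurable_unfolded_state (hμ : Measurable fun s => μ |s|) (h : ∀ w, Measurable (φ w))
    (w : Label) : Measurable (unfolded μ θ₁ θ₂ φ w) :=
  (measurable_unfolded (α := Unit) (ψ := fun _ => φ) hμ
    (fun w => (h w).comp measurable_snd) w).comp
    (measurable_const (a := ()) |>.prodMk measurable_id)

/-- The unfolded function has at most five terms, each of them a rearrangement of a component cut
off to `S1`, multiplied by a factor of modulus at most one. -/
theorem eLpNorm_unfolded_le (hμ : ∀ s, ‖μ |s|‖ ≤ 1) (hμm : Measurable fun s => μ |s|)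
    (hφ : ∀ w, Measurable (φ w)) {B : ℝ≥0∞}
    (h : ∀ w, eLpNorm (φ w) 2 (volume.restrict S1) ≤ B) (w : Label) :
    eLpNorm (unfolded μ θ₁ θ₂ φ w) 2 volume ≤ 5 * B := by
  have hm : ∀ w, Measurable (onS1 φ w) := fun w => (hφ w).indicator measurableSet_S1
  have h0 : ∀ w, eLpNorm (onS1 φ w) 2 volume ≤ B := fun w => by
    have : onS1 φ w = S1.indicator (φ w) := rfl
    rw [this, eLpNorm_indicator_eq_eLpNorm_restrict measurableSet_S1]
    exact h w
  have hmul : ∀ {a f : Config → ℂ} {C : ℝ≥0∞}, (∀ x, ‖a x‖ ≤ 1) → eLpNorm f 2 volume ≤ C →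
      eLpNorm (fun x => a x * f x) 2 volume ≤ C := fun {a f C} ha hf =>
    (eLpNorm_mono fun x => by
      rw [norm_mul]
      nlinarith [norm_nonneg (a x), norm_nonneg (f x), ha x]).trans hf
  have hadd : ∀ {f g : Config → ℂ} {C C' : ℝ≥0∞}, Measurable f → Measurable g →
      eLpNorm f 2 volume ≤ C → eLpNorm g 2 volume ≤ C' →
      eLpNorm (fun x => f x + g x) 2 volume ≤ C + C' := fun {f g C C'} hf hg h1 h2 =>
    (eLpNorm_add_le hf.aestronglyMeasurable hg.aestronglyMeasurable (by norm_num)).trans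
      (add_le_add h1 h2)
  have hL : ∀ {f : Config → ℂ} {C : ℝ≥0∞}, Measurable f → eLpNorm f 2 volume ≤ C →
      eLpNorm (fun x => f (swapL x)) 2 volume ≤ C := fun {f C} hf h1 =>
    (eLpNorm_comp_measurePreserving hf.aestronglyMeasurable measurePreserving_swapL).trans_le h1
  have hR : ∀ {f : Config → ℂ} {C : ℝ≥0∞}, Measurable f → eLpNorm f 2 volume ≤ C →
      eLpNorm (fun x => f (swapR x)) 2 volume ≤ C := fun {f C} hf h1 =>
    (eLpNorm_comp_measurePreserving hf.aestronglyMeasurable measurePreserving_swapR).trans_le h1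
  have mL := fun w => measurable_ampL (θ := θ₁) hμm w
  have mR := fun w => measurable_ampR (θ := θ₂) hμm w
  have sL := measurable_swapL
  have sR := measurable_swapR
  have t1 := hmul (fun x => norm_ampL_le (θ := θ₁) hμ w x) (hadd
    ((hm (swapL w)).comp sL)
    (((mR (swapL w)).comp sL).mul ((hm (swapR (swapL w))).comp (sR.comp sL)))
    (hL (hm (swapL w)) (h0 (swapL w)))
    (hmul (fun x => norm_ampR_le (θ := θ₂) hμ (swapL w) (swapL x))
      (hL (f := fun x => onS1 φ (swapR (swapL w)) (swapR x)) ((hm _).comp sR)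
        (hR (hm _) (h0 (swapR (swapL w)))))))
  have t2 := hmul (fun x => norm_ampR_le (θ := θ₂) hμ w x) (hadd
    ((hm (swapR w)).comp sR)
    (((mL (swapR w)).comp sR).mul ((hm (swapL (swapR w))).comp (sL.comp sR)))
    (hR (hm (swapR w)) (h0 (swapR w)))
    (hmul (fun x => norm_ampL_le (θ := θ₁) hμ (swapR w) (swapR x))
      (hR (f := fun x => onS1 φ (swapL (swapR w)) (swapL x)) ((hm _).comp sL)
        (hL (hm _) (h0 (swapL (swapR w)))))))
  have m1 : Measurable fun x => ampL μ θ₁ w x * (onS1 φ (swapL w) (swapL x)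
      + ampR μ θ₂ (swapL w) (swapL x) * onS1 φ (swapR (swapL w)) (swapR (swapL x))) :=
    (mL w).mul (((hm _).comp sL).add (((mR _).comp sL).mul ((hm _).comp (sR.comp sL))))
  have m2 : Measurable fun x => ampR μ θ₂ w x * (onS1 φ (swapR w) (swapR x)
      + ampL μ θ₁ (swapR w) (swapR x) * onS1 φ (swapL (swapR w)) (swapL (swapR x))) :=
    (mR w).mul (((hm _).comp sR).add (((mL _).comp sR).mul ((hm _).comp (sL.comp sR))))
  refine (hadd ((hm w).add m1) m2 (hadd (hm w) m1 (h0 w) t1) t2).trans (le_of_eq ?_)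
  ring

end Unfolded

section MassTerm

variable {κ : ℝ} {φ χ : Label → Config → ℂ}

theorem norm_massTerm_le (hκ : 0 ≤ κ) {B : ℝ} {x : Config} (h : ∀ w, ‖φ w x‖ ≤ B) (w : Label) :
    ‖massTerm κ φ w x‖ ≤ 2 * κ * B := by
  unfold massTerm
  rw [norm_mul, norm_neg, norm_mul, Complex.norm_I, one_mul, Complex.norm_real,
    Real.norm_of_nonneg hκ]
  have := (norm_add_le _ _).trans
    (add_le_add (h (w.1, 1 - w.2.1, w.2.2)) (h (w.1, w.2.1, 1 - w.2.2)))
  nlinarith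

theorem massTerm_sub (w : Label) (x : Config) :
    massTerm κ (fun w x => φ w x - χ w x) w x = massTerm κ φ w x - massTerm κ χ w x := by
  unfold massTerm
  ring

theorem measurable_massTerm {α : Type*} [MeasurableSpace α] {ψ : α → Label → Config → ℂ}
    (h : ∀ w, Measurable fun p : α × Config => ψ p.1 w p.2) (w : Label) :
    Measurable fun p : α × Config => massTerm κ (ψ p.1) w p.2 :=
  ((h _).add (h _)).const_mul _

theorem measurable_massTerm_state (h : ∀ w, Measurable (φ w)) (w : Label) :
    Measurable (massTerm κ φ w) :=
  ((h _).add (h _)).const_mul _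

theorem eLpNorm_massTerm_le (hκ : 0 ≤ κ) {m : Measure Config} (hφ : ∀ w, Measurable (φ w))
    {B : ℝ≥0∞} (h : ∀ w, eLpNorm (φ w) 2 m ≤ B) (w : Label) :
    eLpNorm (massTerm κ φ w) 2 m ≤ ENNReal.ofReal (2 * κ) * B := by
  have h1 : massTerm κ φ w = (-(Complex.I * (κ : ℂ))) •
      (φ (w.1, 1 - w.2.1, w.2.2) + φ (w.1, w.2.1, 1 - w.2.2)) := rfl
  rw [h1, eLpNorm_const_smul]
  have h2 : ‖-(Complex.I * (κ : ℂ))‖ₑ = ENNReal.ofReal κ := by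
    rw [← ofReal_norm, norm_neg, norm_mul, Complex.norm_I, one_mul, Complex.norm_real,
      Real.norm_of_nonneg hκ]
  rw [h2]
  refine (mul_le_mul' le_rfl ((eLpNorm_add_le (hφ _).aestronglyMeasurable
    (hφ _).aestronglyMeasurable (by norm_num)).trans (add_le_add (h _) (h _)))).trans
    (le_of_eq ?_)
  rw [ENNReal.ofReal_mul (by norm_num), ENNReal.ofReal_ofNat]
  ring

end MassTerm

/-! ### Existence of mild solutions -/

section Minkowski

variable {α β : Type*} [MeasurableSpace α] [MeasurableSpace β]

theorem eLpNorm_two_sq {m : Measure β} (f : β → ℂ) :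
    eLpNorm f 2 m ^ 2 = ∫⁻ x, ‖f x‖ₑ ^ 2 ∂m := by
  have h := eLpNorm_nnreal_pow_eq_lintegral (f := f) (μ := m) (p := 2) (by norm_num)
  simpa using h

theorem lintegral_sq_le {m : Measure α} {f ρ : α → ℝ≥0∞} (hf : Measurable f) (hρ : Measurable ρ)
    (h0 : ∀ s, ρ s ≠ 0) (htop : ∀ s, ρ s ≠ ⊤) :
    (∫⁻ s, f s ∂m) ^ 2 ≤ (∫⁻ s, ρ s ∂m) * ∫⁻ s, f s ^ 2 / ρ s ∂m := by
  have h1 := ENNReal.lintegral_mul_le_Lp_mul_Lq m Real.HolderConjugate.two_two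
    (f := fun s => ρ s ^ (1 / 2 : ℝ)) (g := fun s => f s * ρ s ^ (-(1 / 2) : ℝ))
    (hρ.pow_const _).aemeasurable (hf.mul (hρ.pow_const _)).aemeasurable
  have h2 : ∀ s, ((fun s => ρ s ^ (1 / 2 : ℝ)) * fun s => f s * ρ s ^ (-(1 / 2) : ℝ)) s = f s := by
    intro s
    rw [Pi.mul_apply, mul_left_comm, ← ENNReal.rpow_add _ _ (h0 s) (htop s)]
    simp
  have h3 : ∀ s, (ρ s ^ (1 / 2 : ℝ)) ^ (2 : ℝ) = ρ s := fun s => by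
    rw [← ENNReal.rpow_mul]
    simp
  have h4 : ∀ s, (f s * ρ s ^ (-(1 / 2) : ℝ)) ^ (2 : ℝ) = f s ^ 2 / ρ s := fun s => by
    rw [ENNReal.mul_rpow_of_nonneg _ _ (by norm_num), ← ENNReal.rpow_mul, ENNReal.rpow_two,
      div_eq_mul_inv]
    congr 1
    rw [← ENNReal.rpow_neg_one]
    norm_num
  simp only [h2, h3, h4] at h1
  refine (pow_le_pow_left₀ (zero_le) h1 2).trans (le_of_eq ?_)
  rw [mul_pow, ← ENNReal.rpow_two, ← ENNReal.rpow_two, ← ENNReal.rpow_mul, ← ENNReal.rpow_mul]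
  simp

/-- Minkowski's integral inequality in `L²`, with a weight bounding the norms of the slices. -/
theorem eLpNorm_integral_le_of_weight {m : Measure α} [SFinite m] {n : Measure β} [SFinite n]
    {H : α × β → ℂ} (hH : Measurable H) {ρ : α → ℝ≥0∞} (hρ : Measurable ρ) (h0 : ∀ s, ρ s ≠ 0)
    (htop : ∀ s, ρ s ≠ ⊤) {S : ℝ≥0∞}
    (h : ∀ᵐ s ∂m, eLpNorm (fun x => H (s, x)) 2 n ≤ S * ρ s) :
    eLpNorm (fun x => ∫ s, H (s, x) ∂m) 2 n ≤ S * ∫⁻ s, ρ s ∂m := by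
  have h1 : eLpNorm (fun x => ∫ s, H (s, x) ∂m) 2 n ^ 2 ≤ (S * ∫⁻ s, ρ s ∂m) ^ 2 := by
    rw [eLpNorm_two_sq]
    calc ∫⁻ x, ‖∫ s, H (s, x) ∂m‖ₑ ^ 2 ∂n
        ≤ ∫⁻ x, (∫⁻ s, ρ s ∂m) * ∫⁻ s, ‖H (s, x)‖ₑ ^ 2 / ρ s ∂m ∂n := by
          refine lintegral_mono fun x => ?_
          refine (pow_le_pow_left₀ (zero_le) (enorm_integral_le_lintegral_enorm _) 2).trans ?_
          exact lintegral_sq_le (hH.comp measurable_prodMk_right).enorm hρ h0 htop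
      _ = (∫⁻ s, ρ s ∂m) * ∫⁻ s, (∫⁻ x, ‖H (s, x)‖ₑ ^ 2 ∂n) / ρ s ∂m := by
          have hm : Measurable fun q : β × α => ‖H (q.2, q.1)‖ₑ ^ 2 / ρ q.2 :=
            ((hH.comp measurable_swap).enorm.pow_const 2).div (hρ.comp measurable_snd)
          rw [lintegral_const_mul _ hm.lintegral_prod_right',
            lintegral_lintegral_swap hm.aemeasurable]
          congr 1
          refine lintegral_congr fun s => ?_
          simp only [div_eq_mul_inv]
          exact lintegral_mul_const _ ((hH.comp measurable_prodMk_left).enorm.pow_const 2)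
      _ ≤ (∫⁻ s, ρ s ∂m) * ∫⁻ s, S ^ 2 * ρ s ∂m := by
          refine mul_le_mul' le_rfl (lintegral_mono_ae ?_)
          filter_upwards [h] with s hs
          rw [← eLpNorm_two_sq]
          refine ENNReal.div_le_of_le_mul ?_
          calc eLpNorm (fun x => H (s, x)) 2 n ^ 2 ≤ (S * ρ s) ^ 2 :=
              pow_le_pow_left₀ (zero_le) hs 2
            _ = S ^ 2 * ρ s * ρ s := by ring
      _ = (S * ∫⁻ s, ρ s ∂m) ^ 2 := by
          rw [lintegral_const_mul _ hρ]
          ring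
  exact (ENNReal.pow_le_pow_left_iff two_ne_zero).1 h1

end Minkowski

section Duhamel

/-- The rate of exponential growth allowed in the estimates for the mass parameter `κ`. -/
noncomputable def rate (κ : ℝ) : ℝ := 20 * κ + 1

theorem rate_pos {κ : ℝ} (hκ : 0 ≤ κ) : 0 < rate κ := by
  unfold rate
  positivity

theorem integral_exp_rate_le {κ : ℝ} (hκ : 0 ≤ κ) (t : ℝ) :
    ∫ s in Ioc 0 t, Real.exp (rate κ * |s|) ≤ Real.exp (rate κ * |t|) / rate κ := by
  have hr := rate_pos hκ
  rcases le_or_gt t 0 with ht | ht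
  · rw [Ioc_eq_empty (not_lt.2 ht)]
    simp only [setIntegral_empty]
    positivity
  · have h1 : ∫ s in Ioc 0 t, Real.exp (rate κ * |s|)
        = ∫ s in (0 : ℝ)..t, Real.exp (rate κ * s) := by
      rw [intervalIntegral.integral_of_le ht.le]
      refine setIntegral_congr_fun measurableSet_Ioc fun s hs => ?_
      simp only [abs_of_pos hs.1]
    have h2 : ∀ s ∈ uIcc 0 t, HasDerivAt (fun s => Real.exp (rate κ * s) / rate κ)
        (Real.exp (rate κ * s)) s := by
      intro s _
      have := (((hasDerivAt_id s).const_mul (rate κ)).exp).div_const (rate κ)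
      simp only [id, mul_one] at this
      rwa [mul_div_cancel_right₀ _ hr.ne'] at this
    rw [h1, intervalIntegral.integral_eq_sub_of_hasDerivAt h2
      (Continuous.intervalIntegrable (by fun_prop) _ _), abs_of_pos ht]
    simp only [mul_zero, Real.exp_zero]
    have : 0 < 1 / rate κ := by positivity
    linarith

theorem integrableOn_exp_rate (κ t : ℝ) :
    IntegrableOn (fun s => Real.exp (rate κ * |s|)) (Ioc 0 t) :=
  (Continuous.integrableOn_Icc (by fun_prop)).mono_set Ioc_subset_Icc_self

variable {μ : ℝ → ℝ} {θ₁ θ₂ κ : ℝ} {φ₀ : Label → Config → ℂ} {ψ χ : ℝ → Label → Config → ℂ}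

/-- The source of the component `w`, unfolded, at the time `s` on the characteristic of that
component through `(t, x)`. -/
noncomputable def sourceAlong (μ : ℝ → ℝ) (θ₁ θ₂ κ : ℝ) (ψ : ℝ → Label → Config → ℂ) (w : Label)
    (t s : ℝ) (x : Config) : ℂ :=
  unfolded μ θ₁ θ₂ (massTerm κ (ψ s)) w (x - (t - s) • vel3 w)

/-- Duhamel's formula along the reflected characteristics, whose fixed points are the mild
solutions with initial value `φ₀`. -/
noncomputable def duhamel (μ : ℝ → ℝ) (θ₁ θ₂ κ : ℝ) (φ₀ : Label → Config → ℂ)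
    (ψ : ℝ → Label → Config → ℂ) (t : ℝ) (w : Label) (x : Config) : ℂ :=
  unfolded μ θ₁ θ₂ φ₀ w (x - t • vel3 w) + ∫ s in Ioc 0 t, sourceAlong μ θ₁ θ₂ κ ψ w t s x

theorem measurable_sourceAlong (hμ : Measurable fun s => μ |s|)
    (hψ : ∀ w, Measurable fun p : ℝ × Config => ψ p.1 w p.2) (w : Label) :
    Measurable fun q : (ℝ × Config) × ℝ => sourceAlong μ θ₁ θ₂ κ ψ w q.1.1 q.2 q.1.2 :=
  (measurable_unfolded hμ (ψ := fun s => massTerm κ (ψ s))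
    (fun w => measurable_massTerm hψ w) w).comp
    (g := fun p : ℝ × Config => unfolded μ θ₁ θ₂ (massTerm κ (ψ p.1)) w p.2)
    (f := fun q : (ℝ × Config) × ℝ => (q.2, q.1.2 - (q.1.1 - q.2) • vel3 w)) (by fun_prop)

theorem measurable_sourceAlong_right (hμ : Measurable fun s => μ |s|)
    (hψ : ∀ w, Measurable fun p : ℝ × Config => ψ p.1 w p.2) (w : Label) (t : ℝ) (x : Config) :
    Measurable fun s => sourceAlong μ θ₁ θ₂ κ ψ w t s x :=
  (measurable_sourceAlong hμ hψ w).comp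
    (f := fun s : ℝ => ((t, x), s)) (by fun_prop)

theorem measurable_duhamel (hμ : Measurable fun s => μ |s|) (h₀ : ∀ w, Measurable (φ₀ w))
    (hψ : ∀ w, Measurable fun p : ℝ × Config => ψ p.1 w p.2) (w : Label) :
    Measurable fun p : ℝ × Config => duhamel μ θ₁ θ₂ κ φ₀ ψ p.1 w p.2 := by
  refine Measurable.add ((measurable_unfolded_state hμ h₀ w).comp
    (f := fun p : ℝ × Config => p.2 - p.1 • vel3 w) (by fun_prop)) ?_
  have h1 : ∀ p : ℝ × Config, ∫ s in Ioc 0 p.1, sourceAlong μ θ₁ θ₂ κ ψ w p.1 s p.2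
      = ∫ s, {q : (ℝ × Config) × ℝ | 0 < q.2 ∧ q.2 ≤ q.1.1}.indicator
        (fun q => sourceAlong μ θ₁ θ₂ κ ψ w q.1.1 q.2 q.1.2) (p, s) := fun p =>
    (integral_indicator measurableSet_Ioc).symm
  simp only [h1]
  refine (StronglyMeasurable.integral_prod_right' (f := {q : (ℝ × Config) × ℝ |
    0 < q.2 ∧ q.2 ≤ q.1.1}.indicator fun q => sourceAlong μ θ₁ θ₂ κ ψ w q.1.1 q.2 q.1.2)
    (Measurable.stronglyMeasurable ?_)).measurable
  exact (measurable_sourceAlong hμ hψ w).indicator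
    ((measurableSet_lt measurable_const measurable_snd).inter
      (measurableSet_le measurable_snd (measurable_fst.comp measurable_fst)))

theorem norm_sourceAlong_le (hμ : ∀ s, ‖μ |s|‖ ≤ 1) (hκ : 0 ≤ κ) {C : ℝ} {s : ℝ}
    (hC : ∀ w x, ‖ψ s w x‖ ≤ C) (w : Label) (t : ℝ) (x : Config) :
    ‖sourceAlong μ θ₁ θ₂ κ ψ w t s x‖ ≤ 10 * κ * C := by
  have h0 : 0 ≤ C := (norm_nonneg _).trans (hC w x)
  refine (norm_unfolded_le hμ (by positivity)
    (fun w x _ => norm_massTerm_le hκ (fun w => hC w x) w) w _).trans (le_of_eq ?_)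
  ring

theorem integrableOn_sourceAlong (hμ : ∀ s, ‖μ |s|‖ ≤ 1) (hμm : Measurable fun s => μ |s|)
    (hκ : 0 ≤ κ) (hψ : ∀ w, Measurable fun p : ℝ × Config => ψ p.1 w p.2) {C : ℝ}
    (hC : ∀ t w x, ‖ψ t w x‖ ≤ C * Real.exp (rate κ * |t|)) (w : Label) (t : ℝ) (x : Config)
    (a : ℝ) : IntegrableOn (fun s => sourceAlong μ θ₁ θ₂ κ ψ w t s x) (Ioc 0 a) :=
  ((integrableOn_exp_rate κ a).const_mul (10 * κ * C)).mono'
    (measurable_sourceAlong_right hμm hψ w t x).aestronglyMeasurable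
    (Eventually.of_forall fun s => (norm_sourceAlong_le hμ hκ (hC s) w t x).trans
      (by rw [mul_assoc (10 * κ)]))

theorem norm_integral_sourceAlong_le (hμ : ∀ s, ‖μ |s|‖ ≤ 1) (hκ : 0 ≤ κ) {C : ℝ} (hC0 : 0 ≤ C)
    (hC : ∀ t w x, ‖ψ t w x‖ ≤ C * Real.exp (rate κ * |t|)) (w : Label) (t : ℝ) (x : Config) :
    ‖∫ s in Ioc 0 t, sourceAlong μ θ₁ θ₂ κ ψ w t s x‖ ≤ C / 2 * Real.exp (rate κ * |t|) := by
  refine (norm_integral_le_of_norm_le ((integrableOn_exp_rate κ t).const_mul (10 * κ * C))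
    (Eventually.of_forall fun s => (norm_sourceAlong_le hμ hκ (hC s) w t x).trans
      (by rw [mul_assoc (10 * κ)]))).trans ?_
  rw [integral_const_mul]
  have h1 := integral_exp_rate_le hκ t
  have h2 : 10 * κ * (Real.exp (rate κ * |t|) / rate κ) ≤ 1 / 2 * Real.exp (rate κ * |t|) := by
    rw [mul_div_assoc', div_le_iff₀ (rate_pos hκ)]
    unfold rate
    nlinarith [Real.exp_pos ((20 * κ + 1) * |t|)]
  calc 10 * κ * C * ∫ s in Ioc 0 t, Real.exp (rate κ * |s|)
      ≤ 10 * κ * C * (Real.exp (rate κ * |t|) / rate κ) := by gcongr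
    _ = C * (10 * κ * (Real.exp (rate κ * |t|) / rate κ)) := by ring
    _ ≤ C * (1 / 2 * Real.exp (rate κ * |t|)) := by gcongr
    _ = _ := by ring

theorem norm_duhamel_le (hμ : ∀ s, ‖μ |s|‖ ≤ 1) (hκ : 0 ≤ κ) {B : ℝ} (hB : 0 ≤ B)
    (h₀ : ∀ w x, ‖φ₀ w x‖ ≤ B)
    (hC : ∀ t w x, ‖ψ t w x‖ ≤ 10 * B * Real.exp (rate κ * |t|)) (t : ℝ) (w : Label) (x : Config) :
    ‖duhamel μ θ₁ θ₂ κ φ₀ ψ t w x‖ ≤ 10 * B * Real.exp (rate κ * |t|) := by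
  have h1 := norm_unfolded_le (θ₁ := θ₁) (θ₂ := θ₂) hμ hB (fun w x _ => h₀ w x) w (x - t • vel3 w)
  have h2 := norm_integral_sourceAlong_le (θ₁ := θ₁) (θ₂ := θ₂) hμ hκ (by positivity) hC w t x
  have h3 : 1 ≤ Real.exp (rate κ * |t|) :=
    Real.one_le_exp (mul_nonneg (rate_pos hκ).le (abs_nonneg t))
  refine (norm_add_le _ _).trans ((add_le_add h1 h2).trans ?_)
  nlinarith

theorem norm_duhamel_sub_le (hμ : ∀ s, ‖μ |s|‖ ≤ 1) (hμm : Measurable fun s => μ |s|)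
    (hκ : 0 ≤ κ) (hψ : ∀ w, Measurable fun p : ℝ × Config => ψ p.1 w p.2)
    (hχ : ∀ w, Measurable fun p : ℝ × Config => χ p.1 w p.2) {C C' : ℝ} (hC'0 : 0 ≤ C')
    (hC : ∀ t w x, ‖ψ t w x‖ ≤ C * Real.exp (rate κ * |t|))
    (hCχ : ∀ t w x, ‖χ t w x‖ ≤ C * Real.exp (rate κ * |t|))
    (hC' : ∀ t w x, ‖ψ t w x - χ t w x‖ ≤ C' * Real.exp (rate κ * |t|))
    (t : ℝ) (w : Label) (x : Config) :
    ‖duhamel μ θ₁ θ₂ κ φ₀ ψ t w x - duhamel μ θ₁ θ₂ κ φ₀ χ t w x‖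
      ≤ C' / 2 * Real.exp (rate κ * |t|) := by
  unfold duhamel
  rw [add_sub_add_left_eq_sub, ← integral_sub (integrableOn_sourceAlong hμ hμm hκ hψ hC w t x t)
    (integrableOn_sourceAlong hμ hμm hκ hχ hCχ w t x t)]
  refine le_trans (le_of_eq ?_) (norm_integral_sourceAlong_le (μ := μ) (θ₁ := θ₁) (θ₂ := θ₂)
    (ψ := fun t w x => ψ t w x - χ t w x) hμ hκ hC'0 hC' w t x)
  congr 2
  funext s
  unfold sourceAlong
  rw [← unfolded_sub]
  congr 1
  funext w x
  exact (massTerm_sub w x).symm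

theorem measurable_slice (hψ : ∀ w, Measurable fun p : ℝ × Config => ψ p.1 w p.2) (t : ℝ)
    (w : Label) : Measurable (ψ t w) :=
  (hψ w).comp measurable_prodMk_left

theorem eLpNorm_comp_sub {f : Config → ℂ} (hf : Measurable f) (y : Config) :
    eLpNorm (fun x => f (x - y)) 2 volume = eLpNorm f 2 volume :=
  eLpNorm_comp_measurePreserving hf.aestronglyMeasurable (measurePreserving_sub_right volume y)

theorem eLpNorm_sourceAlong_le (hμ : ∀ s, ‖μ |s|‖ ≤ 1) (hμm : Measurable fun s => μ |s|)
    (hκ : 0 ≤ κ) {s : ℝ} (hψ : ∀ w, Measurable (ψ s w)) {S : ℝ≥0∞}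
    (hS : ∀ w, eLpNorm (ψ s w) 2 (volume.restrict S1) ≤ S) (w : Label) (t : ℝ) :
    eLpNorm (fun x => sourceAlong μ θ₁ θ₂ κ ψ w t s x) 2 volume
      ≤ ENNReal.ofReal (10 * κ) * S := by
  have h2 : ∀ w, Measurable (massTerm κ (ψ s) w) := fun w => measurable_massTerm_state hψ w
  unfold sourceAlong
  rw [eLpNorm_comp_sub (measurable_unfolded_state hμm h2 w)]
  refine (eLpNorm_unfolded_le hμ hμm h2 (eLpNorm_massTerm_le hκ hψ hS) w).trans
    (le_of_eq ?_)
  rw [← mul_assoc, ← ENNReal.ofReal_ofNat 5, ← ENNReal.ofReal_mul (by norm_num)]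
  congr 2
  ring

/-- The `L²` norm of the Duhamel integral over a time interval of positive numbers. -/
theorem eLpNorm_integral_sourceAlong_le (hμ : ∀ s, ‖μ |s|‖ ≤ 1)
    (hμm : Measurable fun s => μ |s|)
    (hκ : 0 ≤ κ) (hψ : ∀ w, Measurable fun p : ℝ × Config => ψ p.1 w p.2) {S : ℝ≥0∞} {T : ℝ}
    (hS : ∀ᵐ s : ℝ, s ∈ Ioc 0 T → ∀ w,
      eLpNorm (ψ s w) 2 (volume.restrict S1) ≤ S * ENNReal.ofReal (Real.exp (rate κ * |s|)))
    (w : Label) {I : Set ℝ} (hI : MeasurableSet I) (hIT : I ⊆ Ioc 0 T) (t : ℝ) :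
    eLpNorm (fun x => ∫ s in I, sourceAlong μ θ₁ θ₂ κ ψ w t s x) 2 volume
      ≤ ENNReal.ofReal (10 * κ) * S * ENNReal.ofReal (∫ s in I, Real.exp (rate κ * |s|)) := by
  rw [ofReal_integral_eq_lintegral_ofReal ((integrableOn_exp_rate κ T).mono_set hIT)
    (Eventually.of_forall fun s => (Real.exp_pos _).le)]
  refine eLpNorm_integral_le_of_weight (m := volume.restrict I) (n := volume)
    (H := fun q : ℝ × Config => sourceAlong μ θ₁ θ₂ κ ψ w t q.1 q.2) ?_ (by fun_prop)
    (fun s => by simpa using Real.exp_pos _) (fun s => ENNReal.ofReal_ne_top) ?_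
  · exact (measurable_sourceAlong hμm hψ w).comp
      (f := fun q : ℝ × Config => ((t, q.2), q.1)) (by fun_prop)
  · filter_upwards [ae_restrict_of_ae hS, ae_restrict_mem hI] with s hs hsI
    rw [mul_assoc]
    exact eLpNorm_sourceAlong_le hμ hμm hκ (fun w => measurable_slice hψ s w) (hs (hIT hsI)) w t

theorem ofReal_rate_mul_integral_le (hκ : 0 ≤ κ) (S : ℝ≥0∞) (t : ℝ) :
    ENNReal.ofReal (10 * κ) * S * ENNReal.ofReal (∫ s in Ioc 0 t, Real.exp (rate κ * |s|))
      ≤ S / 2 * ENNReal.ofReal (Real.exp (rate κ * |t|)) := by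
  have h1 := integral_exp_rate_le hκ t
  have h2 : 10 * κ * (Real.exp (rate κ * |t|) / rate κ) ≤ 1 / 2 * Real.exp (rate κ * |t|) := by
    rw [mul_div_assoc', div_le_iff₀ (rate_pos hκ)]
    unfold rate
    nlinarith [Real.exp_pos ((20 * κ + 1) * |t|)]
  have h3 : 10 * κ * ∫ s in Ioc 0 t, Real.exp (rate κ * |s|)
      ≤ 1 / 2 * Real.exp (rate κ * |t|) :=
    (mul_le_mul_of_nonneg_left h1 (by positivity)).trans h2
  calc _ = S * ENNReal.ofReal (10 * κ * ∫ s in Ioc 0 t, Real.exp (rate κ * |s|)) := by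
        rw [ENNReal.ofReal_mul (p := 10 * κ) (by positivity)]
        ring
    _ ≤ S * ENNReal.ofReal (1 / 2 * Real.exp (rate κ * |t|)) := by gcongr
    _ = _ := by
      rw [ENNReal.ofReal_mul (by norm_num), ← mul_assoc, div_eq_mul_inv]
      congr 2
      rw [one_mul, ENNReal.ofReal_inv_of_pos (by norm_num), ENNReal.ofReal_ofNat]

theorem eLpNorm_duhamel_le (hμ : ∀ s, ‖μ |s|‖ ≤ 1) (hμm : Measurable fun s => μ |s|)
    (hκ : 0 ≤ κ) (h₀m : ∀ w, Measurable (φ₀ w))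
    (hψ : ∀ w, Measurable fun p : ℝ × Config => ψ p.1 w p.2) {N : ℝ≥0∞}
    (h₀ : ∀ w, eLpNorm (φ₀ w) 2 (volume.restrict S1) ≤ N)
    (hS : ∀ s w, eLpNorm (ψ s w) 2 (volume.restrict S1)
      ≤ 10 * N * ENNReal.ofReal (Real.exp (rate κ * |s|))) (t : ℝ) (w : Label) :
    eLpNorm (duhamel μ θ₁ θ₂ κ φ₀ ψ t w) 2 volume
      ≤ 10 * N * ENNReal.ofReal (Real.exp (rate κ * |t|)) := by
  have m1 := measurable_unfolded_state (θ₁ := θ₁) (θ₂ := θ₂) hμm h₀m w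
  have h1 : eLpNorm (fun x => unfolded μ θ₁ θ₂ φ₀ w (x - t • vel3 w)) 2 volume
      ≤ 5 * N * ENNReal.ofReal (Real.exp (rate κ * |t|)) := by
    rw [eLpNorm_comp_sub m1]
    refine (eLpNorm_unfolded_le hμ hμm h₀m h₀ w).trans (le_mul_of_one_le_right' ?_)
    rw [ENNReal.one_le_ofReal]
    exact Real.one_le_exp (mul_nonneg (rate_pos hκ).le (abs_nonneg t))
  have h2 := (eLpNorm_integral_sourceAlong_le (θ₁ := θ₁) (θ₂ := θ₂) hμ hμm hκ hψ (T := t)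
    (Eventually.of_forall fun s _ w => hS s w) w measurableSet_Ioc subset_rfl t).trans
    (ofReal_rate_mul_integral_le hκ _ t)
  have h3 : 10 * N / 2 = 5 * N := by
    rw [show (10 : ℝ≥0∞) = 5 * 2 by norm_num, mul_right_comm]
    exact ENNReal.mul_div_cancel_right (by norm_num) (by norm_num)
  rw [h3] at h2
  have m2 : Measurable fun x => ∫ s in Ioc 0 t, sourceAlong μ θ₁ θ₂ κ ψ w t s x :=
    (((measurable_sourceAlong hμm hψ w).comp
      (f := fun q : Config × ℝ => ((t, q.1), q.2)) (by fun_prop)).stronglyMeasurable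
      |>.integral_prod_right').measurable
  refine (eLpNorm_add_le (f := fun x => unfolded μ θ₁ θ₂ φ₀ w (x - t • vel3 w))
    (g := fun x => ∫ s in Ioc 0 t, sourceAlong μ θ₁ θ₂ κ ψ w t s x)
    (m1.comp (by fun_prop)).aestronglyMeasurable m2.aestronglyMeasurable (by norm_num)).trans
    ((add_le_add h1 h2).trans (le_of_eq ?_))
  ring

/-- A fixed point of Duhamel's formula, defined everywhere on space, with its growth bounds in the
supremum and the `L²` norm. -/
structure IsMild (μ : ℝ → ℝ) (θ₁ θ₂ κ : ℝ) (φ₀ : Label → Config → ℂ) (B : ℝ) (N : ℝ≥0∞)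
    (ψ : ℝ → Label → Config → ℂ) : Prop where
  measurable : ∀ w, Measurable fun p : ℝ × Config => ψ p.1 w p.2
  norm_le : ∀ t w x, ‖ψ t w x‖ ≤ 10 * B * Real.exp (rate κ * |t|)
  eLpNorm_le : ∀ t w, eLpNorm (ψ t w) 2 volume ≤ 10 * N * ENNReal.ofReal (Real.exp (rate κ * |t|))
  eq_duhamel : ∀ t w x, ψ t w x = duhamel μ θ₁ θ₂ κ φ₀ ψ t w x

/-- Picard iteration for Duhamel's formula. -/
noncomputable def picard (μ : ℝ → ℝ) (θ₁ θ₂ κ : ℝ) (φ₀ : Label → Config → ℂ) :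
    ℕ → ℝ → Label → Config → ℂ
  | 0 => fun _ _ _ => 0
  | n + 1 => duhamel μ θ₁ θ₂ κ φ₀ (picard μ θ₁ θ₂ κ φ₀ n)

/-- The iteration contracts by the factor `1 / 2` in the supremum norm weighted by
`exp (-rate κ * |t|)`, so that it converges everywhere; the `L²` bound passes to the limit by
Fatou's lemma. -/
theorem exists_isMild (hμ : ∀ s, ‖μ |s|‖ ≤ 1) (hμm : Measurable fun s => μ |s|)
    (hκ : 0 ≤ κ) (θ₁ θ₂ : ℝ) {B : ℝ} (hB : 0 ≤ B) {N : ℝ≥0∞} (h₀m : ∀ w, Measurable (φ₀ w))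
    (h₀ : ∀ w x, ‖φ₀ w x‖ ≤ B) (h₀N : ∀ w, eLpNorm (φ₀ w) 2 (volume.restrict S1) ≤ N) :
    ∃ ψ, IsMild μ θ₁ θ₂ κ φ₀ B N ψ := by
  set P := picard μ θ₁ θ₂ κ φ₀ with hP
  have hm : ∀ n w, Measurable fun p : ℝ × Config => P n p.1 w p.2 := by
    intro n
    induction n with
    | zero => exact fun w => measurable_const
    | succ n ih => exact fun w => measurable_duhamel hμm h₀m ih w
  have hb : ∀ n t w x, ‖P n t w x‖ ≤ 10 * B * Real.exp (rate κ * |t|) := by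
    intro n
    induction n with
    | zero =>
      intro t w x
      simp only [hP, picard, norm_zero]
      positivity
    | succ n ih => exact norm_duhamel_le hμ hκ hB h₀ ih
  have hN : ∀ n t w, eLpNorm (P n t w) 2 volume
      ≤ 10 * N * ENNReal.ofReal (Real.exp (rate κ * |t|)) := by
    intro n
    induction n with
    | zero =>
      intro t w
      have : P 0 t w = 0 := rfl
      rw [this, eLpNorm_zero]
      exact zero_le
    | succ n ih =>
      exact eLpNorm_duhamel_le hμ hμm hκ h₀m (hm n) h₀N
        fun s w => (eLpNorm_mono_measure _ Measure.restrict_le_self).trans (ih s w)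
  have hd : ∀ n t w x, ‖P n t w x - P (n + 1) t w x‖
      ≤ 10 * B * (1 / 2) ^ n * Real.exp (rate κ * |t|) := by
    intro n
    induction n with
    | zero =>
      intro t w x
      have : P 0 t w x = 0 := rfl
      rw [this, zero_sub, norm_neg, pow_zero, mul_one]
      exact hb 1 t w x
    | succ n ih =>
      intro t w x
      refine (norm_duhamel_sub_le hμ hμm hκ (hm n) (hm (n + 1)) (by positivity) (hb n) (hb (n + 1))
        ih t w x).trans (le_of_eq ?_)
      rw [pow_succ]
      ring
  have hd' : ∀ t w x n, dist (P n t w x) (P (n + 1) t w x)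
      ≤ 10 * B * Real.exp (rate κ * |t|) * (1 / 2) ^ n := fun t w x n => by
    rw [dist_eq_norm]
    exact (hd n t w x).trans (le_of_eq (by ring))
  have hlim : ∀ t w x, ∃ z, Tendsto (fun n => P n t w x) atTop (𝓝 z) := fun t w x =>
    cauchySeq_tendsto_of_complete (cauchySeq_of_le_geometric _ _ (by norm_num) (hd' t w x))
  choose ψ hψ using hlim
  have hψm : ∀ w, Measurable fun p : ℝ × Config => ψ p.1 w p.2 := fun w =>
    measurable_of_tendsto_metrizable (fun n => hm n w)
      (tendsto_pi_nhds.2 fun p => hψ p.1 w p.2)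
  have hψb : ∀ t w x, ‖ψ t w x‖ ≤ 10 * B * Real.exp (rate κ * |t|) := fun t w x =>
    le_of_tendsto (hψ t w x).norm (Eventually.of_forall fun n => hb n t w x)
  refine ⟨ψ, hψm, hψb, fun t w => ?_, fun t w x => ?_⟩
  · refine (Lp.eLpNorm_lim_le_liminf_eLpNorm
      (fun n => (measurable_slice (hm n) t w).aestronglyMeasurable) (ψ t w)
      (Eventually.of_forall fun x => hψ t w x)).trans ?_
    exact liminf_le_of_frequently_le' (Frequently.of_forall fun n => hN n t w)
  · have h1 : Tendsto (fun n => P (n + 1) t w x) atTop (𝓝 (duhamel μ θ₁ θ₂ κ φ₀ ψ t w x)) := by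
      rw [tendsto_iff_norm_sub_tendsto_zero]
      have h2 : ∀ n t w x, ‖P n t w x - ψ t w x‖
          ≤ 20 * B * (1 / 2) ^ n * Real.exp (rate κ * |t|) := by
        intro n t w x
        have := dist_le_of_le_geometric_of_tendsto _ _ (by norm_num) (hd' t w x) (hψ t w x) n
        rw [dist_eq_norm] at this
        refine this.trans (le_of_eq ?_)
        ring
      refine squeeze_zero (fun _ => norm_nonneg _) (fun n => norm_duhamel_sub_le hμ hμm hκ (hm n)
        hψm (by positivity) (hb n) hψb (h2 n) t w x) ?_
      have h3 := (tendsto_pow_atTop_nhds_zero_of_lt_one (r := (1 / 2 : ℝ)) (by norm_num)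
        (by norm_num)).const_mul (20 * B / 2 * Real.exp (rate κ * |t|))
      rw [mul_zero] at h3
      refine h3.congr fun n => ?_
      ring
    exact tendsto_nhds_unique ((hψ t w x).comp (tendsto_add_atTop_nat 1)) h1

end Duhamel

/-! ### Regularity of mild solutions -/

theorem tendsto_eLpNorm_translate {E : Type*} [NormedAddCommGroup E] [NormedSpace ℝ E]
    [FiniteDimensional ℝ E] [MeasurableSpace E] [BorelSpace E] {ν : Measure E} [ν.IsAddHaarMeasure]
    {p : ℝ≥0∞} [Fact (1 ≤ p)] (hp : p ≠ ⊤) {f : E → ℂ} (hf : MemLp f p ν) :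
    Tendsto (fun y => eLpNorm (fun x => f (x + y) - f x) p ν) (𝓝 0) (𝓝 0) := by
  have : Fact (p ≠ ⊤) := ⟨hp⟩
  have h1 : Continuous fun y : E => DomAddAct.mk y +ᵥ hf.toLp f :=
    (continuous_id.vadd continuous_const).comp DomAddAct.continuous_mk
  have h2 := ((h1.sub continuous_const).tendsto'
    (f := fun y : E => (DomAddAct.mk y +ᵥ hf.toLp f) - hf.toLp f) 0 0 (by simp)).enorm
  rw [enorm_zero] at h2
  refine h2.congr fun y => ?_
  rw [DomAddAct.mk_vadd_toLp, ← MemLp.toLp_sub, Lp.enorm_toLp]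
  simp only [vadd_eq_add, Pi.sub_def, add_comm y]

variable {μ : ℝ → ℝ} {θ₁ θ₂ κ : ℝ} {φ₀ : Label → Config → ℂ} {ψ : ℝ → Label → Config → ℂ}
  {B : ℝ} {N : ℝ≥0∞}

/-- The source runs along the same characteristic through `(t, x)` and `(t + h, x + h v)`. -/
theorem sourceAlong_add (w : Label) (t h s : ℝ) (x : Config) :
    sourceAlong μ θ₁ θ₂ κ ψ w (t + h) s (x + h • vel3 w) = sourceAlong μ θ₁ θ₂ κ ψ w t s x := by
  unfold sourceAlong
  congr 1
  module

theorem sourceAlong_shift (w : Label) (t s : ℝ) (x : Config) :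
    sourceAlong μ θ₁ θ₂ κ ψ w t (t + s) x
      = unfolded μ θ₁ θ₂ (massTerm κ (ψ (t + s))) w (x + s • vel3 w) := by
  unfold sourceAlong
  congr 1
  module

theorem IsMild.bound_nonneg (hψ : IsMild μ θ₁ θ₂ κ φ₀ B N ψ) : 0 ≤ B := by
  have := (norm_nonneg _).trans (hψ.norm_le 0 (0, 0, 0) 0)
  simp at this
  linarith

/-- The change of a mild solution along a characteristic segment is the integral of the source
over it; before the initial time the source is switched off. -/
theorem IsMild.sub_eq (hψ : IsMild μ θ₁ θ₂ κ φ₀ B N ψ) (hμ : ∀ s, ‖μ |s|‖ ≤ 1)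
    (hμm : Measurable fun s => μ |s|) (hκ : 0 ≤ κ) (w : Label) (t : ℝ) {h : ℝ} (hh : 0 ≤ h)
    (x : Config) :
    ψ (t + h) w (x + h • vel3 w) - ψ t w x
      = ∫ s in Ioc 0 (t + h) \ Ioc 0 t, sourceAlong μ θ₁ θ₂ κ ψ w t s x := by
  rw [hψ.eq_duhamel, hψ.eq_duhamel t, duhamel, duhamel]
  simp only [sourceAlong_add]
  rw [setIntegral_sdiff measurableSet_Ioc
    (integrableOn_sourceAlong hμ hμm hκ hψ.measurable hψ.norm_le
    w t x _) (Ioc_subset_Ioc_right (by linarith))]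
  rw [show x + h • vel3 w - (t + h) • vel3 w = x - t • vel3 w by module]
  ring

theorem Ioc_sdiff_Ioc_subset (t h : ℝ) : Ioc 0 (t + h) \ Ioc 0 t ⊆ Ioc t (t + h) :=
  fun s hs => ⟨by
    by_contra h'
    exact hs.2 ⟨hs.1.1, not_lt.1 h'⟩, hs.1.2⟩

theorem Ioc_sdiff_Ioc_eq {t : ℝ} (ht : 0 ≤ t) (h : ℝ) :
    Ioc 0 (t + h) \ Ioc 0 t = Ioc t (t + h) :=
  (Ioc_sdiff_Ioc_subset t h).antisymm fun _ hs =>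
    ⟨⟨lt_of_le_of_lt ht hs.1, hs.2⟩, fun h' => absurd h'.2 (not_le.2 hs.1)⟩

theorem exp_rate_mono (hκ : 0 ≤ κ) {s T : ℝ} (h : |s| ≤ T) :
    Real.exp (rate κ * |s|) ≤ Real.exp (rate κ * T) :=
  Real.exp_le_exp.2 (mul_le_mul_of_nonneg_left h (rate_pos hκ).le)

/-- On bounded time intervals a mild solution is Lipschitz along the characteristics, uniformly in
the starting point. This is what produces its boundary values. -/
theorem IsMild.exists_norm_sub_le (hψ : IsMild μ θ₁ θ₂ κ φ₀ B N ψ) (hμ : ∀ s, ‖μ |s|‖ ≤ 1)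
    (hμm : Measurable fun s => μ |s|) (hκ : 0 ≤ κ) (T : ℝ) :
    ∃ K : ℝ, 0 ≤ K ∧ ∀ w t h x, |t| ≤ T → |t + h| ≤ T →
      ‖ψ (t + h) w (x + h • vel3 w) - ψ t w x‖ ≤ K * |h| := by
  have hB := hψ.bound_nonneg
  set K : ℝ := 10 * κ * (10 * B * Real.exp (rate κ * T)) with hK
  have key : ∀ w t h x, 0 ≤ h → |t| ≤ T → |t + h| ≤ T →
      ‖ψ (t + h) w (x + h • vel3 w) - ψ t w x‖ ≤ K * |h| := by
    intro w t h x hh h1 h2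
    rw [hψ.sub_eq hμ hμm hκ w t hh x]
    have hfin : volume (Ioc 0 (t + h) \ Ioc 0 t) < ⊤ :=
      (measure_mono sdiff_subset).trans_lt measure_Ioc_lt_top
    refine (norm_setIntegral_le_of_norm_le_const (C := K) hfin fun s hs => ?_).trans ?_
    · refine norm_sourceAlong_le hμ hκ (fun w x => (hψ.norm_le s w x).trans ?_) w t x
      have h3 := Ioc_sdiff_Ioc_subset t h hs
      have h4 : |s| ≤ T := by
        rw [abs_le] at h1 h2 ⊢
        constructor <;> linarith [h3.1, h3.2]
      gcongr
      exact (rate_pos hκ).le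
    · refine mul_le_mul_of_nonneg_left ?_ (by positivity)
      have h3 : volume.real (Ioc 0 (t + h) \ Ioc 0 t) ≤ volume.real (Ioc t (t + h)) :=
        measureReal_mono (Ioc_sdiff_Ioc_subset t h) measure_Ioc_lt_top.ne
      rw [Real.volume_real_Ioc_of_le (by linarith)] at h3
      rw [abs_of_nonneg hh]
      linarith
  refine ⟨K, by positivity, fun w t h x h1 h2 => ?_⟩
  rcases le_total 0 h with hh | hh
  · exact key w t h x hh h1 h2
  · have h3 := key w (t + h) (-h) (x + h • vel3 w) (by linarith) h2 (by simpa using h1)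
    rw [norm_sub_rev, abs_neg] at h3
    simpa using h3

theorem IsMild.exists_eLpNorm_sub_le (hψ : IsMild μ θ₁ θ₂ κ φ₀ B N ψ) (hμ : ∀ s, ‖μ |s|‖ ≤ 1)
    (hμm : Measurable fun s => μ |s|) (hκ : 0 ≤ κ) (hN : N ≠ ⊤) (T : ℝ) :
    ∃ K : ℝ≥0∞, K ≠ ⊤ ∧ ∀ w t h, 0 ≤ t → 0 ≤ h → t + h ≤ T →
      eLpNorm (fun x => ψ (t + h) w (x + h • vel3 w) - ψ t w x) 2 volume
        ≤ K * ENNReal.ofReal h := by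
  refine ⟨ENNReal.ofReal (10 * κ) * (10 * N) * ENNReal.ofReal (Real.exp (rate κ * T)),
    by finiteness, fun w t h ht hh hT => ?_⟩
  simp only [hψ.sub_eq hμ hμm hκ w t hh]
  rw [Ioc_sdiff_Ioc_eq ht]
  refine (eLpNorm_integral_sourceAlong_le (S := 10 * N) (T := T) hμ hμm hκ hψ.measurable
    (Eventually.of_forall fun s _ w => (eLpNorm_mono_measure _ Measure.restrict_le_self).trans
      (hψ.eLpNorm_le s w)) w measurableSet_Ioc (Ioc_subset_Ioc ht hT) t).trans ?_
  rw [mul_assoc _ _ (ENNReal.ofReal h), ← ENNReal.ofReal_mul (Real.exp_pos _).le]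
  gcongr
  have h1 : ∫ s in Ioc t (t + h), Real.exp (rate κ * |s|)
      ≤ ∫ s in Ioc t (t + h), Real.exp (rate κ * T) := by
    refine setIntegral_mono_on ((integrableOn_exp_rate κ T).mono_set (Ioc_subset_Ioc ht hT))
      (by simp) measurableSet_Ioc fun s hs => exp_rate_mono hκ ?_
    rw [abs_of_nonneg (by linarith [hs.1])]
    linarith [hs.2]
  refine h1.trans (le_of_eq ?_)
  rw [setIntegral_const, Real.volume_real_Ioc_of_le (by linarith), smul_eq_mul]
  ring

/-- The `L²` continuity of a mild solution: the change along the characteristics is of order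
`|t - t₀|`, and translations act continuously on `L²`. -/
theorem IsMild.tendsto_eLpNorm_sub (hψ : IsMild μ θ₁ θ₂ κ φ₀ B N ψ) (hμ : ∀ s, ‖μ |s|‖ ≤ 1)
    (hμm : Measurable fun s => μ |s|) (hκ : 0 ≤ κ) (hN : N ≠ ⊤) (w : Label) {t₀ : ℝ}
    (ht₀ : 0 ≤ t₀) :
    Tendsto (fun t => eLpNorm (fun x => ψ t w x - ψ t₀ w x) 2 volume) (𝓝[Ici 0] t₀) (𝓝 0) := by
  obtain ⟨K, hK, hKle⟩ := hψ.exists_eLpNorm_sub_le hμ hμm hκ hN (t₀ + 1)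
  have hmem : MemLp (ψ t₀ w) 2 volume :=
    ⟨(measurable_slice hψ.measurable t₀ w).aestronglyMeasurable,
      (hψ.eLpNorm_le t₀ w).trans_lt (by finiteness)⟩
  have h1 := tendsto_eLpNorm_translate (by norm_num) hmem
  have h2 : Tendsto (fun t : ℝ => (t₀ - t) • vel3 w) (𝓝[Ici 0] t₀) (𝓝 0) :=
    ((by fun_prop : Continuous fun t : ℝ => (t₀ - t) • vel3 w).tendsto' t₀ 0
      (by simp)).mono_left nhdsWithin_le_nhds
  have h3 : Tendsto (fun t : ℝ => K * ENNReal.ofReal |t - t₀|) (𝓝[Ici 0] t₀) (𝓝 0) := by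
    have : Tendsto (fun t : ℝ => ENNReal.ofReal |t - t₀|) (𝓝[Ici 0] t₀) (𝓝 0) :=
      ((ENNReal.continuous_ofReal.comp (by fun_prop : Continuous fun t : ℝ => |t - t₀|)).tendsto'
        t₀ 0 (by simp)).mono_left nhdsWithin_le_nhds
    simpa using ENNReal.Tendsto.const_mul this (Or.inr hK)
  have h4 := h3.add (h1.comp h2)
  rw [add_zero] at h4
  refine tendsto_of_tendsto_of_tendsto_of_le_of_le' tendsto_const_nhds h4
    (Eventually.of_forall fun _ => zero_le) ?_
  filter_upwards [self_mem_nhdsWithin,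
    mem_nhdsWithin_of_mem_nhds (Iio_mem_nhds (show t₀ < t₀ + 1 by linarith))] with t ht ht1
  have ht' : 0 ≤ t := ht
  have hm : ∀ t y, Measurable fun x => ψ t w (x + y) := fun t y =>
    (measurable_slice hψ.measurable t w).comp (by fun_prop)
  have hm' : ∀ t, Measurable (ψ t w) := fun t => measurable_slice hψ.measurable t w
  have h5 : eLpNorm (fun x => ψ t w x - ψ t₀ w (x + (t₀ - t) • vel3 w)) 2 volume
      ≤ K * ENNReal.ofReal |t - t₀| := by
    rcases le_total t t₀ with h | h
    · have h6 := hKle w t (t₀ - t) ht' (by linarith) (by linarith)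
      rw [abs_sub_comm, abs_of_nonneg (by linarith)]
      refine le_trans (le_of_eq ?_) h6
      rw [← eLpNorm_neg]
      congr 1
      funext x
      simp
    · have h6 := hKle w t₀ (t - t₀) ht₀ (by linarith) (by simpa using le_of_lt ht1)
      rw [abs_of_nonneg (by linarith)]
      refine le_trans (le_of_eq ?_) h6
      rw [← eLpNorm_comp_sub (f := fun x => ψ (t₀ + (t - t₀)) w (x + (t - t₀) • vel3 w) - ψ t₀ w x)
        ((hm (t₀ + (t - t₀)) _).sub (hm' t₀)) ((t - t₀) • vel3 w)]
      congr 1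
      funext x
      simp only [add_sub_cancel, sub_add_cancel]
      congr 2
      module
  refine le_trans (le_of_eq ?_) ((eLpNorm_add_le ((hm' t).sub (hm t₀ _)).aestronglyMeasurable
    ((hm t₀ _).sub (hm' t₀)).aestronglyMeasurable (by norm_num)).trans (add_le_add h5 le_rfl))
  congr 1
  funext x
  simp

/-- The velocity of the component `w` in space-time. -/
def velST (w : Label) : ℝ × Config := (1, vel3 w)

theorem locallyIntegrable_of_norm_le_exp {f : ℝ × Config → ℂ} (hf : Measurable f) {C : ℝ}
    (h : ∀ p, ‖f p‖ ≤ C * Real.exp (rate κ * |p.1|)) : LocallyIntegrable f volume := by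
  have h1 : LocallyIntegrable (fun p : ℝ × Config => C * Real.exp (rate κ * |p.1|)) volume :=
    Continuous.locallyIntegrable (by fun_prop)
  exact h1.mono hf.aestronglyMeasurable
    (Eventually.of_forall fun p => (h p).trans (le_abs_self _))

theorem IsMild.locallyIntegrable (hψ : IsMild μ θ₁ θ₂ κ φ₀ B N ψ) (w : Label) :
    LocallyIntegrable (fun p : ℝ × Config => ψ p.1 w p.2) volume :=
  locallyIntegrable_of_norm_le_exp (hψ.measurable w) fun p => hψ.norm_le p.1 w p.2

theorem IsMild.locallyIntegrable_massTerm (hψ : IsMild μ θ₁ θ₂ κ φ₀ B N ψ) (hκ : 0 ≤ κ)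
    (w : Label) : LocallyIntegrable (fun p : ℝ × Config => massTerm κ (ψ p.1) w p.2) volume := by
  refine locallyIntegrable_of_norm_le_exp (κ := κ) (C := 2 * κ * (10 * B))
    (measurable_massTerm hψ.measurable w) fun p => ?_
  rw [mul_assoc (2 * κ)]
  exact norm_massTerm_le hκ (fun w => hψ.norm_le p.1 w p.2) w

/-- Inside `S1` the unfolded source is the mass term itself, so that Duhamel's formula is the
integrated transport equation. -/
theorem IsMild.weakTransport (hψ : IsMild μ θ₁ θ₂ κ φ₀ B N ψ) (hμ : ∀ s, ‖μ |s|‖ ≤ 1)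
    (hμm : Measurable fun s => μ |s|) (hκ : 0 ≤ κ) (w : Label) :
    WeakTransport volume (velST w) (Ioi (0 : ℝ) ×ˢ S1) (fun p => ψ p.1 w p.2)
      (fun p => massTerm κ (ψ p.1) w p.2) := by
  have hG : LocallyIntegrable
      (fun p : ℝ × Config => unfolded μ θ₁ θ₂ (massTerm κ (ψ p.1)) w p.2) volume := by
    refine locallyIntegrable_of_norm_le_exp (κ := κ) (C := 5 * (2 * κ * (10 * B)))
      (measurable_unfolded hμm (ψ := fun t => massTerm κ (ψ t))
        (fun w => measurable_massTerm hψ.measurable w) w) fun p => ?_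
    have hB := hψ.bound_nonneg
    refine (norm_unfolded_le hμ (B := 2 * κ * (10 * B * Real.exp (rate κ * |p.1|)))
      (by positivity) (fun w x _ => norm_massTerm_le hκ (fun w => hψ.norm_le p.1 w x) w)
      w p.2).trans (le_of_eq (by ring))
  refine (WeakTransport.of_ae_eq (hψ.locallyIntegrable w) hG fun s hs =>
    Eventually.of_forall fun p hp => ?_).congr_on (fun _ _ => rfl)
    fun p hp => (unfolded_of_mem hp.2 w).symm
  have hp0 : (0 : ℝ) < p.1 := hp.1
  have h1 := hψ.sub_eq hμ hμm hκ w p.1 hs p.2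
  rw [Ioc_sdiff_Ioc_eq hp0.le, ← intervalIntegral.integral_of_le (by linarith)] at h1
  have h2 := intervalIntegral.integral_comp_add_left (a := 0) (b := s)
    (fun s => sourceAlong μ θ₁ θ₂ κ ψ w p.1 s p.2) p.1
  rw [add_zero] at h2
  rw [← h2] at h1
  simp only [sourceAlong_shift] at h1
  simp only [velST, Prod.fst_add, Prod.snd_add, Prod.smul_fst, Prod.smul_snd, smul_eq_mul, mul_one]
  rw [← h1]
  ring

/-! ### The Dirac system in components -/

section Components

theorem onPh_gamma_apply (z : Spinor) (w : Label) :
    onPh (gamma0 * gamma1) z w = (vel w.1 : ℂ) * z w := by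
  obtain ⟨a, b, c⟩ := w
  fin_cases a <;> fin_cases b <;> fin_cases c <;>
    simp [onPh, gamma0, gamma1, Matrix.mulVec, dotProduct, Fintype.sum_prod_type,
      Matrix.kroneckerMap_apply, Matrix.one_apply]

theorem onE1_gamma_apply (z : Spinor) (w : Label) :
    onE1 (gamma0 * gamma1) z w = (vel w.2.1 : ℂ) * z w := by
  obtain ⟨a, b, c⟩ := w
  fin_cases a <;> fin_cases b <;> fin_cases c <;>
    simp [onE1, gamma0, gamma1, Matrix.mulVec, dotProduct, Fintype.sum_prod_type,
      Matrix.kroneckerMap_apply, Matrix.one_apply]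

theorem onE2_gamma_apply (z : Spinor) (w : Label) :
    onE2 (gamma0 * gamma1) z w = (vel w.2.2 : ℂ) * z w := by
  obtain ⟨a, b, c⟩ := w
  fin_cases a <;> fin_cases b <;> fin_cases c <;>
    simp [onE2, gamma0, gamma1, Matrix.mulVec, dotProduct, Fintype.sum_prod_type,
      Matrix.kroneckerMap_apply, Matrix.one_apply]

theorem onE1_gamma0_apply (z : Spinor) (w : Label) :
    onE1 gamma0 z w = z (w.1, 1 - w.2.1, w.2.2) := by
  obtain ⟨a, b, c⟩ := w
  fin_cases a <;> fin_cases b <;> fin_cases c <;>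
    simp [onE1, gamma0, Matrix.mulVec, dotProduct, Fintype.sum_prod_type,
      Matrix.kroneckerMap_apply, Matrix.one_apply]

theorem onE2_gamma0_apply (z : Spinor) (w : Label) :
    onE2 gamma0 z w = z (w.1, w.2.1, 1 - w.2.2) := by
  obtain ⟨a, b, c⟩ := w
  fin_cases a <;> fin_cases b <;> fin_cases c <;>
    simp [onE2, gamma0, Matrix.mulVec, dotProduct, Fintype.sum_prod_type,
      Matrix.kroneckerMap_apply, Matrix.one_apply]

variable {hbar m : ℝ} {φ : ℝ × Config → Spinor}

theorem hasFDerivAt_component {p : ℝ × Config} (h : DifferentiableAt ℝ φ p) (w : Label) :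
    HasFDerivAt (fun p => φ p w)
      (((EuclideanSpace.proj w : Spinor →L[ℂ] ℂ).restrictScalars ℝ).comp (fderiv ℝ φ p)) p :=
  ((EuclideanSpace.proj w : Spinor →L[ℂ] ℂ).restrictScalars ℝ).hasFDerivAt.comp p h.hasFDerivAt

/-- In components, the operator `iℏ ∂_t - H` is the derivative along the velocity of the component,
minus a mass term flipping the signs of the electrons. -/
theorem equation_apply (p : ℝ × Config) (h : DifferentiableAt ℝ φ p) (w : Label) :
    ((Complex.I * (hbar : ℂ)) • fderiv ℝ φ p (1, 0)
        - hamiltonian hbar m (fun x => φ (p.1, x)) p.2) w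
      = Complex.I * hbar * fderiv ℝ (fun p => φ p w) p (velST w)
        - m * (φ p (w.1, 1 - w.2.1, w.2.2) + φ p (w.1, w.2.1, 1 - w.2.2)) := by
  have hsl : ∀ y : Config, fderiv ℝ (fun x => φ (p.1, x)) p.2 y = fderiv ℝ φ p (0, y) := by
    intro y
    have h1 : HasFDerivAt (fun x : Config => (p.1, x)) (ContinuousLinearMap.inr ℝ ℝ Config) p.2 :=
      hasFDerivAt_prodMk_right p.1 p.2
    have h2 := HasFDerivAt.comp (f := fun x : Config => (p.1, x)) p.2
      (show HasFDerivAt φ (fderiv ℝ φ p) (p.1, p.2) from h.hasFDerivAt) h1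
    simp only [Function.comp_def] at h2
    rw [h2.fderiv]
    rfl
  have hdec : velST w = (1, 0) + (vel w.1 • ((0, (1, 0, 0)) : ℝ × Config)
      + vel w.2.1 • ((0, (0, 1, 0)) : ℝ × Config) + vel w.2.2 • ((0, (0, 0, 1)) : ℝ × Config)) := by
    simp [velST, vel3]
  rw [(hasFDerivAt_component h w).fderiv]
  simp only [hamiltonian, dPh, dE1, dE2, hsl]
  rw [hdec]
  simp only [ContinuousLinearMap.comp_apply, map_add, map_smul, PiLp.sub_apply, PiLp.add_apply,
    PiLp.smul_apply, smul_eq_mul, onPh_gamma_apply, onE1_gamma_apply, onE2_gamma_apply,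
    onE1_gamma0_apply, onE2_gamma0_apply, Complex.real_smul]
  have hproj : ∀ z : Spinor, (EuclideanSpace.proj w : Spinor →L[ℂ] ℂ) z = z w := fun _ => rfl
  simp only [ContinuousLinearMap.coe_restrictScalars', hproj, neg_mul]
  ring

theorem contDiff_component (h : ContDiff ℝ ∞ φ) (w : Label) : ContDiff ℝ ∞ fun p => φ p w :=
  ((EuclideanSpace.proj w : Spinor →L[ℂ] ℂ).restrictScalars ℝ).contDiff.comp h

/-- The integrand of the weak Dirac equation, as a sum over the components of the integrands of the
weak transport equations, with the conjugate of the test spinor. -/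
theorem inner_equation (hh : hbar ≠ 0) (p : ℝ × Config) (h : DifferentiableAt ℝ φ p) (z : Spinor) :
    inner ℂ ((Complex.I * (hbar : ℂ)) • fderiv ℝ φ p (1, 0)
        - hamiltonian hbar m (fun x => φ (p.1, x)) p.2) z
      = -(Complex.I * hbar) * ∑ w : Label,
        (fderiv ℝ (fun p => starRingEnd ℂ (φ p w)) p (velST w) * z w
          + starRingEnd ℂ (φ p w) * massTerm (m / hbar) (fun w _ => z w) w p.2) := by
  have hconj : ∀ w y, fderiv ℝ (fun p => starRingEnd ℂ (φ p w)) p y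
      = starRingEnd ℂ (fderiv ℝ (fun p => φ p w) p y) := by
    intro w y
    have h1 := Complex.conjCLE.hasFDerivAt.comp p (hasFDerivAt_component h w)
    simp only [Function.comp_def, Complex.conjCLE_apply] at h1
    rw [h1.fderiv, (hasFDerivAt_component h w).fderiv]
    simp
  have hh' : (hbar : ℂ) ≠ 0 := by exact_mod_cast hh
  have hmass : ∀ A C S : ℂ, -(Complex.I * hbar) * (A + C * (-(Complex.I * (m / hbar)) * S))
      = -(Complex.I * hbar) * A - m * (C * S) := by
    intro A C S
    have h1 : (m : ℂ) = m / hbar * hbar := by field_simp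
    linear_combination (C * S) * h1 + (m / hbar * hbar * C * S) * Complex.I_sq
  rw [PiLp.inner_apply, Finset.mul_sum]
  simp only [equation_apply p h, hconj, massTerm, RCLike.inner_apply, map_sub, map_mul, map_add,
    Complex.conj_I, Complex.conj_ofReal, Complex.ofReal_div, hmass]
  simp only [Fintype.sum_prod_type, Fin.sum_univ_two, sub_zero, sub_self]
  ring

/-- The spinor-valued function with the components `ψ` on `S1`, extended by zero. -/
noncomputable def ofComponents (ψ : ℝ → Label → Config → ℂ) (t : ℝ) (x : Config) : Spinor :=
  WithLp.toLp 2 fun w => onS1 (ψ t) w x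

theorem ofComponents_apply (ψ : ℝ → Label → Config → ℂ) (t : ℝ) (x : Config) (w : Label) :
    ofComponents ψ t x w = onS1 (ψ t) w x := rfl

theorem integrable_mul_of_locallyIntegrable {f g : ℝ × Config → ℂ}
    (hf : LocallyIntegrable f volume) (h1 : Continuous g) (h2 : HasCompactSupport g) :
    Integrable (fun p => g p * f p) volume :=
  hf.integrable_smul_left_of_hasCompactSupport h1 h2

/-- The Dirac equation holds if each component satisfies its transport equation: the conjugates of
the components of a test spinor are test functions. -/
theorem solvesWeakly_ofComponents (hh : hbar ≠ 0) {ψ : ℝ → Label → Config → ℂ}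
    (hψ : ∀ w, LocallyIntegrable (fun p : ℝ × Config => ψ p.1 w p.2) volume)
    (hG : ∀ w, LocallyIntegrable
      (fun p : ℝ × Config => massTerm (m / hbar) (ψ p.1) w p.2) volume)
    (h : ∀ w, WeakTransport volume (velST w) (Ioi (0 : ℝ) ×ˢ S1) (fun p => ψ p.1 w p.2)
      (fun p => massTerm (m / hbar) (ψ p.1) w p.2)) :
    SolvesWeakly hbar m (ofComponents ψ) := by
  intro φ h1 h2 h3
  have hD : MeasurableSet (Ioi (0 : ℝ) ×ˢ S1) := measurableSet_Ioi.prod measurableSet_S1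
  have hc1 : ∀ w, ContDiff ℝ ∞ fun p => starRingEnd ℂ (φ p w) := fun w =>
    Complex.conjCLE.contDiff.comp (contDiff_component h1 w)
  have hsub : ∀ w, tsupport (fun p => starRingEnd ℂ (φ p w)) ⊆ tsupport φ := fun w =>
    closure_mono fun p hp h0 => hp (by simp [h0])
  have hc2 : ∀ w, HasCompactSupport fun p => starRingEnd ℂ (φ p w) := fun w =>
    h2.isCompact.of_isClosed_subset (isClosed_tsupport _) (hsub w)
  have hpt : ∀ p ∈ Ioi (0 : ℝ) ×ˢ S1,
      inner ℂ ((Complex.I * (hbar : ℂ)) • fderiv ℝ φ p (1, 0)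
        - hamiltonian hbar m (fun x => φ (p.1, x)) p.2) (ofComponents ψ p.1 p.2)
      = -(Complex.I * hbar) * ∑ w : Label,
        (fderiv ℝ (fun p => starRingEnd ℂ (φ p w)) p (velST w) * ψ p.1 w p.2
          + starRingEnd ℂ (φ p w) * massTerm (m / hbar) (ψ p.1) w p.2) := by
    intro p hp
    rw [inner_equation hh p ((h1.differentiable (by simp)) p)]
    simp only [ofComponents_apply, onS1_of_mem hp.2, massTerm]
  rw [setIntegral_congr_fun hD hpt, setIntegral_eq_integral_of_forall_compl_eq_zero,
    integral_const_mul, integral_finsetSum]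
  · rw [Finset.sum_eq_zero fun w _ => (h w).complex_test (hψ w) (hG w) (hc1 w) (hc2 w)
      ((hsub w).trans h3), mul_zero]
  · intro w _
    refine (integrable_mul_of_locallyIntegrable (hψ w)
      (g := fun p => fderiv ℝ (fun p => starRingEnd ℂ (φ p w)) p (velST w)) ?_ ?_).add
      (integrable_mul_of_locallyIntegrable (hG w) (hc1 w).continuous (hc2 w))
    · exact ((hc1 w).continuous_fderiv (by simp)).clm_apply continuous_const
    · exact ((hc2 w).fderiv (𝕜 := ℝ)).comp_left (g := fun L : (ℝ × Config) →L[ℝ] ℂ => L (velST w))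
        (by simp)
  · intro p hp
    rw [Finset.sum_eq_zero, mul_zero]
    intro w _
    have hp1 : p ∉ tsupport fun p => starRingEnd ℂ (φ p w) := fun h' => hp (h3 (hsub w h'))
    have hp2 : fderiv ℝ (fun p => starRingEnd ℂ (φ p w)) p = 0 := by
      by_contra h5
      exact hp1 (support_fderiv_subset ℝ h5)
    have hp3 : starRingEnd ℂ (φ p w) = 0 :=
      image_eq_zero_of_notMem_tsupport (f := fun p => starRingEnd ℂ (φ p w)) hp1
    rw [hp2, hp3]
    simp

theorem norm_spinor_le_sum (z : Spinor) : ‖z‖ ≤ ∑ w : Label, ‖z w‖ := by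
  rw [EuclideanSpace.norm_eq]
  refine Real.sqrt_le_iff.2 ⟨Finset.sum_nonneg fun w _ => norm_nonneg _, ?_⟩
  exact Finset.sum_sq_le_sq_sum_of_nonneg fun w _ => norm_nonneg _

theorem eLpNorm_le_sum_component {f : Config → Spinor} {p : ℝ≥0∞} (hp : 1 ≤ p) {ν : Measure Config}
    (hf : AEStronglyMeasurable f ν) :
    eLpNorm f p ν ≤ ∑ w : Label, eLpNorm (fun x => f x w) p ν := by
  have hm : ∀ w : Label, AEStronglyMeasurable (fun x => f x w) ν := fun w =>
    (EuclideanSpace.proj w : Spinor →L[ℂ] ℂ).continuous.comp_aestronglyMeasurable hf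
  calc eLpNorm f p ν ≤ eLpNorm (∑ w : Label, fun x => ‖f x w‖) p ν := by
        refine eLpNorm_mono_real fun x => ?_
        rw [Finset.sum_apply]
        exact norm_spinor_le_sum (f x)
    _ ≤ ∑ w : Label, eLpNorm (fun x => ‖f x w‖) p ν :=
        eLpNorm_sum_le (fun w _ => (hm w).norm) hp
    _ = ∑ w : Label, eLpNorm (fun x => f x w) p ν := by
        simp only [eLpNorm_norm]

theorem eLpNorm_component_le (f : Config → Spinor) (p : ℝ≥0∞) (ν : Measure Config) (w : Label) :
    eLpNorm (fun x => f x w) p ν ≤ eLpNorm f p ν :=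
  eLpNorm_mono fun x => PiLp.norm_apply_le (f x) w

theorem measurable_toLp {α : Type*} [MeasurableSpace α] {f : α → Label → ℂ}
    (h : ∀ w, Measurable fun x => f x w) : Measurable fun x => (WithLp.toLp 2 (f x) : Spinor) :=
  (WithLp.measurable_toLp 2 (Label → ℂ)).comp (measurable_pi_lambda _ h)

theorem measurable_ofComponents {ψ : ℝ → Label → Config → ℂ}
    (h : ∀ w, Measurable fun p : ℝ × Config => ψ p.1 w p.2) :
    Measurable fun p : ℝ × Config => ofComponents ψ p.1 p.2 :=
  measurable_toLp fun w => (h w).indicator (measurable_snd measurableSet_S1)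

end Components

/-! ### Boundary values -/

/-- The point at depth `q.2` below the point `(s, s, r)` of the wall `C₁`, `q.1 = (t, s, r)`. -/
def chartL (q : (ℝ × ℝ × ℝ) × ℝ) : Config := (q.1.2.1 + q.2, q.1.2.1 - q.2, q.1.2.2)

/-- The point at depth `q.2` below the point `(s, r, s)` of the wall `C₂`, `q.1 = (t, s, r)`. -/
def chartR (q : (ℝ × ℝ × ℝ) × ℝ) : Config := (q.1.2.1 - q.2, q.1.2.2, q.1.2.1 + q.2)

/-- The layer of depth `δ` at the part of size `R` of a wall with chart `y`. -/
def layer (y : (ℝ × ℝ × ℝ) × ℝ → Config) (R δ : ℝ) : Set ((ℝ × ℝ × ℝ) × ℝ) :=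
  {q | 0 < q.1.1 ∧ q.1.1 < R ∧ |q.1.2.1| < R ∧ |q.1.2.2| < R ∧ 0 < q.2 ∧ q.2 < δ ∧ y q ∈ S1}

/-- `g` is the boundary value of `f` on the wall with chart `y`. -/
def HasTraceAlong (y : (ℝ × ℝ × ℝ) × ℝ → Config) (f : ℝ → Config → ℂ) (g : ℝ × ℝ × ℝ → ℂ) : Prop :=
  AEStronglyMeasurable g volume ∧
  ∀ R : ℝ, Tendsto (fun δ : ℝ => (ENNReal.ofReal δ)⁻¹ *
    ∫⁻ q in layer y R δ, ‖f q.1.1 (y q) - g q.1‖ₑ) (𝓝[>] 0) (𝓝 0)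

theorem hasTraceC1_iff {f : ℝ → Config → ℂ} {g : ℝ × ℝ × ℝ → ℂ} :
    HasTraceC1 f g ↔ HasTraceAlong chartL f g := by
  have h : ∀ R δ, {q : (ℝ × ℝ × ℝ) × ℝ | 0 < q.1.1 ∧ q.1.1 < R ∧ |q.1.2.1| < R ∧ |q.1.2.2| < R ∧
      0 < q.2 ∧ q.2 < δ ∧ q.1.2.1 + q.2 < q.1.2.2} = layer chartL R δ := by
    intro R δ
    ext q
    refine and_congr_right fun _ => and_congr_right fun _ => and_congr_right fun _ =>
      and_congr_right fun _ => and_congr_right fun h0 => and_congr_right fun _ =>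
      ⟨fun h => ⟨?_, h⟩, fun h => h.2⟩
    simp only [chartL]
    linarith
  simp only [HasTraceC1, HasTraceAlong, h]
  rfl

theorem hasTraceC2_iff {f : ℝ → Config → ℂ} {g : ℝ × ℝ × ℝ → ℂ} :
    HasTraceC2 f g ↔ HasTraceAlong chartR f g := by
  have h : ∀ R δ, {q : (ℝ × ℝ × ℝ) × ℝ | 0 < q.1.1 ∧ q.1.1 < R ∧ |q.1.2.1| < R ∧ |q.1.2.2| < R ∧
      0 < q.2 ∧ q.2 < δ ∧ q.1.2.2 < q.1.2.1 - q.2} = layer chartR R δ := by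
    intro R δ
    ext q
    refine and_congr_right fun _ => and_congr_right fun _ => and_congr_right fun _ =>
      and_congr_right fun _ => and_congr_right fun h0 => and_congr_right fun _ =>
      ⟨fun h => ⟨h, ?_⟩, fun h => h.1⟩
    simp only [chartR]
    linarith
  simp only [HasTraceC2, HasTraceAlong, h]
  rfl

theorem measurable_chartL : Measurable chartL := by unfold chartL; fun_prop

theorem measurable_chartR : Measurable chartR := by unfold chartR; fun_prop

theorem measurableSet_layer {y : (ℝ × ℝ × ℝ) × ℝ → Config} (hy : Measurable y) (R δ : ℝ) :
    MeasurableSet (layer y R δ) := by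
  have h : ∀ f g : (ℝ × ℝ × ℝ) × ℝ → ℝ, Measurable f → Measurable g →
      MeasurableSet {q | f q < g q} := fun f g => measurableSet_lt
  exact (h (fun _ => 0) (fun q => q.1.1) (by fun_prop) (by fun_prop)).inter <|
    (h (fun q => q.1.1) (fun _ => R) (by fun_prop) (by fun_prop)).inter <|
    (h (fun q => |q.1.2.1|) (fun _ => R) (by fun_prop) (by fun_prop)).inter <|
    (h (fun q => |q.1.2.2|) (fun _ => R) (by fun_prop) (by fun_prop)).inter <|
    (h (fun _ => 0) (fun q => q.2) (by fun_prop) (by fun_prop)).inter <|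
    (h (fun q => q.2) (fun _ => δ) (by fun_prop) (by fun_prop)).inter (hy measurableSet_S1)

/-- If the slices at depth `h` tend to zero, so does the mean over the depths up to `δ`. -/
theorem tendsto_mean_of_tendsto_slice {Q : Type*} [MeasurableSpace Q] {m : Measure Q} [SFinite m]
    {b : Set Q} {Φ : Q × ℝ → ℝ≥0∞} (hΦ : Measurable Φ)
    (h : Tendsto (fun h => ∫⁻ q in b, Φ (q, h) ∂m) (𝓝[>] 0) (𝓝 0)) :
    Tendsto (fun δ : ℝ => (ENNReal.ofReal δ)⁻¹ * ∫⁻ z in b ×ˢ Ioo 0 δ, Φ z ∂(m.prod volume))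
      (𝓝[>] 0) (𝓝 0) := by
  rw [ENNReal.tendsto_nhds_zero] at h ⊢
  intro ε hε
  obtain ⟨δ₀, hδ₀, hsub⟩ := mem_nhdsGT_iff_exists_Ioo_subset.1 (h ε hε)
  filter_upwards [Ioo_mem_nhdsGT hδ₀] with δ hδ
  rw [← Measure.prod_restrict, lintegral_prod_symm' _ hΦ]
  have hδe : ENNReal.ofReal δ ≠ 0 := by simpa using hδ.1
  calc (ENNReal.ofReal δ)⁻¹ * ∫⁻ h in Ioo 0 δ, ∫⁻ q in b, Φ (q, h) ∂m
      ≤ (ENNReal.ofReal δ)⁻¹ * ∫⁻ h in Ioo 0 δ, ε := by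
        refine mul_le_mul' le_rfl (setLIntegral_mono measurable_const fun h hh => ?_)
        exact hsub ⟨hh.1, hh.2.trans hδ.2⟩
    _ = ε := by
        rw [setLIntegral_const, Real.volume_Ioo, sub_zero, mul_left_comm,
          ENNReal.inv_mul_cancel hδe ENNReal.ofReal_ne_top, mul_one]

variable {μ : ℝ → ℝ} {θ₁ θ₂ κ : ℝ} {φ₀ : Label → Config → ℂ} {ψ : ℝ → Label → Config → ℂ}
  {B : ℝ} {N : ℝ≥0∞}

/-- A mild solution has boundary values on a wall to which the characteristics are transversal:
following the characteristic to the wall changes the solution by a multiple of the depth and moves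
the foot point along the wall by the depth times `e`, and translations are continuous in `L¹`. -/
theorem IsMild.hasTraceAlong (hψ : IsMild μ θ₁ θ₂ κ φ₀ B N ψ) (hμ : ∀ s, ‖μ |s|‖ ≤ 1)
    (hμm : Measurable fun s => μ |s|) (hκ : 0 ≤ κ) {w : Label}
    {y : (ℝ × ℝ × ℝ) × ℝ → Config} (hym : Measurable y) {e : ℝ × ℝ × ℝ} {τ : ℝ} (hτ : |τ| = 1)
    (he : e.1 = 1)
    (hy : ∀ q h, y (q, h) + (τ * h) • vel3 w = y (q + (τ * h) • e, 0)) :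
    HasTraceAlong y (fun t x => ofComponents ψ t x w) (fun q => ψ q.1 w (y (q, 0))) := by
  set g : ℝ × ℝ × ℝ → ℂ := fun q => ψ q.1 w (y (q, 0)) with hg
  have hgm : Measurable g := (hψ.measurable w).comp
    (f := fun q : ℝ × ℝ × ℝ => (q.1, y (q, 0))) (by fun_prop)
  refine ⟨hgm.aestronglyMeasurable, fun R => ?_⟩
  set b : Set (ℝ × ℝ × ℝ) := {q | 0 < q.1 ∧ q.1 < R ∧ |q.2.1| < R ∧ |q.2.2| < R} with hb
  set Φ : (ℝ × ℝ × ℝ) × ℝ → ℝ≥0∞ := fun z => ‖ψ z.1.1 w (y z) - g z.1‖ₑ with hΦ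
  have hΦm : Measurable Φ := (((hψ.measurable w).comp
    (f := fun z : (ℝ × ℝ × ℝ) × ℝ => (z.1.1, y z)) (by fun_prop)).sub
    (hgm.comp measurable_fst)).enorm
  have hbnorm : ∀ q ∈ b, ‖q‖ ≤ R := by
    rintro q ⟨h1, h2, h3, h4⟩
    refine max_le ?_ (max_le h3.le h4.le)
    rw [Real.norm_of_nonneg h1.le]
    exact h2.le
  obtain ⟨K, hK0, hK⟩ := hψ.exists_norm_sub_le hμ hμm hκ (R + 1)
  set b' : Set (ℝ × ℝ × ℝ) := Metric.closedBall 0 (R + ‖e‖) with hb'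
  have hint : MemLp (b'.indicator g) 1 volume := by
    have hBn := hψ.bound_nonneg
    refine memLp_one_iff_integrable.2 ((Measure.integrableOn_of_bounded
      (M := 10 * B * Real.exp (rate κ * (R + ‖e‖))) measure_closedBall_lt_top.ne
      hgm.aestronglyMeasurable ?_).integrable_indicator Metric.isClosed_closedBall.measurableSet)
    filter_upwards [ae_restrict_mem Metric.isClosed_closedBall.measurableSet] with q hq
    refine (hψ.norm_le _ _ _).trans (mul_le_mul_of_nonneg_left (exp_rate_mono hκ ?_)
      (by positivity))
    exact (le_max_left _ _).trans (mem_closedBall_zero_iff.1 hq)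
  have hslice : Tendsto (fun h => ∫⁻ q in b, Φ (q, h)) (𝓝[>] 0) (𝓝 0) := by
    have h1 := tendsto_eLpNorm_translate (by norm_num) hint
    have h2 : Tendsto (fun h : ℝ => (τ * h) • e) (𝓝[>] 0) (𝓝 0) :=
      ((by fun_prop : Continuous fun h : ℝ => (τ * h) • e).tendsto' 0 0
        (by simp)).mono_left nhdsWithin_le_nhds
    have h3 : Tendsto (fun h : ℝ => ENNReal.ofReal (K * h) * volume b') (𝓝[>] 0) (𝓝 0) := by
      have h4 : Tendsto (fun h : ℝ => ENNReal.ofReal (K * h)) (𝓝[>] 0) (𝓝 0) :=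
        ((ENNReal.continuous_ofReal.comp (by fun_prop : Continuous fun h : ℝ => K * h)).tendsto'
          0 0 (by simp)).mono_left nhdsWithin_le_nhds
      simpa using ENNReal.Tendsto.mul_const h4 (Or.inr measure_closedBall_lt_top.ne)
    have h5 := h3.add (h1.comp h2)
    rw [add_zero] at h5
    refine tendsto_of_tendsto_of_tendsto_of_le_of_le' tendsto_const_nhds h5
      (Eventually.of_forall fun _ => zero_le) ?_
    filter_upwards [Ioo_mem_nhdsGT (zero_lt_one' ℝ)] with h hh
    have hτh : |τ * h| = h := by rw [abs_mul, hτ, one_mul, abs_of_pos hh.1]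
    have hbb' : b ⊆ b' := fun q hq => mem_closedBall_zero_iff.2
      ((hbnorm q hq).trans (by linarith [norm_nonneg e]))
    have hbm : MeasurableSet b := by
      have h : ∀ f g : ℝ × ℝ × ℝ → ℝ, Measurable f → Measurable g →
          MeasurableSet {q | f q < g q} := fun f g => measurableSet_lt
      exact (h (fun _ => 0) (fun q => q.1) (by fun_prop) (by fun_prop)).inter <|
        (h (fun q => q.1) (fun _ => R) (by fun_prop) (by fun_prop)).inter <|
        (h (fun q => |q.2.1|) (fun _ => R) (by fun_prop) (by fun_prop)).inter <|
        h (fun q => |q.2.2|) (fun _ => R) (by fun_prop) (by fun_prop)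
    calc ∫⁻ q in b, Φ (q, h)
        ≤ ∫⁻ q in b, (ENNReal.ofReal (K * h)
            + ‖b'.indicator g (q + (τ * h) • e) - b'.indicator g q‖ₑ) := by
          refine setLIntegral_mono' hbm fun q hq => ?_
          have hq' : q + (τ * h) • e ∈ b' := by
            rw [mem_closedBall_zero_iff]
            refine (norm_add_le _ _).trans (add_le_add (hbnorm q hq) ?_)
            rw [norm_smul, Real.norm_eq_abs, hτh]
            nlinarith [norm_nonneg e, hh.2]
          rw [indicator_of_mem hq', indicator_of_mem (hbb' hq)]
          have h6 := hK w q.1 (τ * h) (y (q, h)) (by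
            rw [abs_of_pos hq.1]
            linarith [hq.2.1]) (by
            have := abs_add_le q.1 (τ * h)
            rw [hτh, abs_of_pos hq.1] at this
            linarith [hq.2.1, hh.2])
          rw [hy, hτh, norm_sub_rev] at h6
          have h7 : g (q + (τ * h) • e)
              = ψ (q.1 + τ * h) w (y (q + (τ * h) • e, 0)) := by
            simp [hg, he]
          rw [← h7] at h6
          have h8 : ψ q.1 w (y (q, h)) - g q = (ψ q.1 w (y (q, h)) - g (q + (τ * h) • e))
            + (g (q + (τ * h) • e) - g q) := by ring
          show ‖ψ q.1 w (y (q, h)) - g q‖ₑ ≤ _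
          rw [h8]
          refine (enorm_add_le _ _).trans (add_le_add ?_ le_rfl)
          rw [← ofReal_norm]
          exact ENNReal.ofReal_le_ofReal h6
      _ = ENNReal.ofReal (K * h) * volume b
            + ∫⁻ q in b, ‖b'.indicator g (q + (τ * h) • e) - b'.indicator g q‖ₑ := by
          rw [lintegral_add_left measurable_const, setLIntegral_const]
      _ ≤ _ := by
          refine add_le_add (mul_le_mul' le_rfl (measure_mono hbb')) ?_
          rw [Function.comp_apply, eLpNorm_one_eq_lintegral_enorm]
          exact setLIntegral_le_lintegral _ _
  refine tendsto_of_tendsto_of_tendsto_of_le_of_le tendsto_const_nhds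
    (tendsto_mean_of_tendsto_slice (m := volume) hΦm hslice) (fun _ => zero_le) fun δ => ?_
  refine mul_le_mul' le_rfl ?_
  calc ∫⁻ q in layer y R δ, ‖ofComponents ψ q.1.1 (y q) w - g q.1‖ₑ
      = ∫⁻ q in layer y R δ, Φ q := by
        refine setLIntegral_congr_fun (measurableSet_layer hym R δ) fun q hq => ?_
        simp only [ofComponents_apply, onS1_of_mem hq.2.2.2.2.2.2, hΦ]
    _ ≤ ∫⁻ q in b ×ˢ Ioo 0 δ, Φ q :=
        lintegral_mono_set fun q hq =>
          ⟨⟨hq.1, hq.2.1, hq.2.2.1, hq.2.2.2.1⟩, hq.2.2.2.2.1, hq.2.2.2.2.2.1⟩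

/-- On a wall, the component entering the domain is the leaving one times the amplitude. -/
theorem IsMild.eq_ampL_mul (hψ : IsMild μ θ₁ θ₂ κ φ₀ B N ψ) (c : Fin 2) {t : ℝ} (ht : 0 < t)
    {x : Config} (hx : x.1 = x.2.1) :
    ψ t (0, 1, c) x = ampL μ θ₁ (0, 1, c) x * ψ t (1, 0, c) x := by
  have hsw : swapL x = x := Prod.ext hx.symm (Prod.ext hx rfl)
  have hv : swapL (vel3 (0, 1, c)) = vel3 (1, 0, c) := rfl
  rw [hψ.eq_duhamel, hψ.eq_duhamel t, duhamel, duhamel, mul_add, ← integral_const_mul]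
  have key : ∀ (φ : Label → Config → ℂ) (s : ℝ), 0 ≤ s →
      unfolded μ θ₁ θ₂ φ (0, 1, c) (x - s • vel3 (0, 1, c))
      = ampL μ θ₁ (0, 1, c) x * unfolded μ θ₁ θ₂ φ (1, 0, c) (x - s • vel3 (1, 0, c)) := by
    intro φ s hs
    rw [unfolded_swapL c (by simp [vel3, hx]; linarith), sub_eq_add_neg, ← neg_smul,
      ampL_add_smul, swapL_add_smul, hsw, hv, neg_smul, ← sub_eq_add_neg]
  rw [key _ _ ht.le]
  congr 1
  refine setIntegral_congr_fun measurableSet_Ioc fun s hs => ?_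
  exact key _ _ (by linarith [hs.2])

theorem IsMild.eq_ampR_mul (hψ : IsMild μ θ₁ θ₂ κ φ₀ B N ψ) (b : Fin 2) {t : ℝ} (ht : 0 < t)
    {x : Config} (hx : x.1 = x.2.2) :
    ψ t (1, b, 0) x = ampR μ θ₂ (1, b, 0) x * ψ t (0, b, 1) x := by
  have hsw : swapR x = x := Prod.ext hx.symm (Prod.ext rfl hx)
  have hv : swapR (vel3 (1, b, 0)) = vel3 (0, b, 1) := rfl
  rw [hψ.eq_duhamel, hψ.eq_duhamel t, duhamel, duhamel, mul_add, ← integral_const_mul]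
  have key : ∀ (φ : Label → Config → ℂ) (s : ℝ), 0 ≤ s →
      unfolded μ θ₁ θ₂ φ (1, b, 0) (x - s • vel3 (1, b, 0))
      = ampR μ θ₂ (1, b, 0) x * unfolded μ θ₁ θ₂ φ (0, b, 1) (x - s • vel3 (0, b, 1)) := by
    intro φ s hs
    rw [unfolded_swapR b (by simp [vel3, hx]; linarith), sub_eq_add_neg, ← neg_smul,
      ampR_add_smul, swapR_add_smul, hsw, hv, neg_smul, ← sub_eq_add_neg]
  rw [key _ _ ht.le]
  congr 1
  refine setIntegral_congr_fun measurableSet_Ioc fun s hs => ?_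
  exact key _ _ (by linarith [hs.2])

theorem ampL_wall (μ : ℝ → ℝ) (θ : ℝ) (c : Fin 2) (s r : ℝ) :
    ampL μ θ (0, 1, c) (s, s, r) = (μ |s - r| : ℂ) * Complex.exp (Complex.I * (θ : ℂ)) := by
  rw [ampL, if_pos ⟨rfl, rfl⟩, abs_sub_comm s r]
  congr 4
  simp only
  ring_nf

theorem ampR_wall (μ : ℝ → ℝ) (θ : ℝ) (b : Fin 2) (s r : ℝ) :
    ampR μ θ (1, b, 0) (s, r, s) = (μ |r - s| : ℂ) * Complex.exp (Complex.I * (θ : ℂ)) := by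
  rw [ampR, if_pos ⟨rfl, rfl⟩, abs_sub_comm r s]
  congr 4
  simp only
  ring_nf

theorem IsMild.boundaryC1 (hψ : IsMild μ θ₁ θ₂ κ φ₀ B N ψ) (hμ : ∀ s, ‖μ |s|‖ ≤ 1)
    (hμm : Measurable fun s => μ |s|) (hκ : 0 ≤ κ) : BoundaryC1 μ θ₁ (ofComponents ψ) := by
  intro c
  refine ⟨_, _, hasTraceC1_iff.2 (hψ.hasTraceAlong hμ hμm hκ (w := (0, 1, c)) measurable_chartL
    (e := (1, 0, vel c)) (τ := -1) (by simp) rfl fun q h => ?_),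
    hasTraceC1_iff.2 (hψ.hasTraceAlong hμ hμm hκ (w := (1, 0, c)) measurable_chartL
    (e := (1, 0, vel c)) (τ := 1) (by simp) rfl fun q h => ?_),
    Eventually.of_forall fun p hp _ => ?_⟩
  · simp [chartL, vel3]
  · simp [chartL, vel3]
  · rw [hψ.eq_ampL_mul c hp (by simp [chartL])]
    simp only [chartL, add_zero, sub_zero, ampL_wall]

theorem IsMild.boundaryC2 (hψ : IsMild μ θ₁ θ₂ κ φ₀ B N ψ) (hμ : ∀ s, ‖μ |s|‖ ≤ 1)
    (hμm : Measurable fun s => μ |s|) (hκ : 0 ≤ κ) : BoundaryC2 μ θ₂ (ofComponents ψ) := by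
  intro b
  refine ⟨_, _, hasTraceC2_iff.2 (hψ.hasTraceAlong hμ hμm hκ (w := (1, b, 0)) measurable_chartR
    (e := (1, 0, vel b)) (τ := -1) (by simp) rfl fun q h => ?_),
    hasTraceC2_iff.2 (hψ.hasTraceAlong hμ hμm hκ (w := (0, b, 1)) measurable_chartR
    (e := (1, 0, vel b)) (τ := 1) (by simp) rfl fun q h => ?_),
    Eventually.of_forall fun p hp _ => ?_⟩
  · simp [chartR, vel3]
  · simp [chartR, vel3]
  · rw [hψ.eq_ampR_mul b hp (by simp [chartR])]
    simp only [chartR, add_zero, sub_zero, ampR_wall]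

/-- A mild solution, restricted to `S1`, solves the initial-boundary value problem. -/
theorem IsMild.isSolution {hbar m : ℝ} (hh : 0 < hbar) (hm : 0 ≤ m)
    (hψ : IsMild μ θ₁ θ₂ (m / hbar) φ₀ B N ψ) (hμ : ∀ s, ‖μ |s|‖ ≤ 1)
    (hμm : Measurable fun s => μ |s|) (hN : N ≠ ⊤) {Ψ₀ : Config → Spinor}
    (h₀ : ∀ᵐ x ∂(volume.restrict S1), ∀ w, φ₀ w x = Ψ₀ x w) :
    IsSolution hbar m θ₁ θ₂ μ Ψ₀ (ofComponents ψ) := by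
  have hκ : 0 ≤ m / hbar := by positivity
  have hmeas : ∀ t, Measurable (ofComponents ψ t) := fun t =>
    (measurable_ofComponents hψ.measurable).comp measurable_prodMk_left
  refine ⟨(measurable_ofComponents hψ.measurable).aestronglyMeasurable, fun t _ => ?_,
    fun t₀ ht₀ => ?_, solvesWeakly_ofComponents hh.ne' hψ.locallyIntegrable
      (hψ.locallyIntegrable_massTerm hκ) (hψ.weakTransport hμ hμm hκ), ?_,
    hψ.boundaryC1 hμ hμm hκ, hψ.boundaryC2 hμ hμm hκ⟩
  · refine ⟨(hmeas t).aestronglyMeasurable, (eLpNorm_le_sum_component (by norm_num)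
      (hmeas t).aestronglyMeasurable).trans_lt (ENNReal.sum_lt_top.2 fun w _ => ?_)⟩
    refine lt_of_le_of_lt ?_ ((hψ.eLpNorm_le t w).trans_lt (by finiteness))
    refine (eLpNorm_mono_measure _ Measure.restrict_le_self).trans ?_
    exact eLpNorm_mono fun x => norm_indicator_le_norm_self _ _
  · have h1 := tendsto_finsetSum Finset.univ fun (w : Label) _ =>
      hψ.tendsto_eLpNorm_sub hμ hμm hκ hN w ht₀
    simp only [Finset.sum_const_zero] at h1
    refine tendsto_of_tendsto_of_tendsto_of_le_of_le tendsto_const_nhds h1 (fun _ => zero_le)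
      fun t => ?_
    refine (eLpNorm_le_sum_component (by norm_num)
      ((hmeas t).sub (hmeas t₀)).aestronglyMeasurable).trans (Finset.sum_le_sum fun w _ => ?_)
    refine (eLpNorm_mono_measure _ Measure.restrict_le_self).trans (eLpNorm_mono fun x => ?_)
    by_cases hx : x ∈ S1
    · simp [ofComponents_apply, onS1_of_mem hx]
    · simp [ofComponents_apply, onS1_of_notMem hx]
  · filter_upwards [h₀, ae_restrict_mem measurableSet_S1] with x hx hxS
    ext w
    rw [ofComponents_apply, onS1_of_mem hxS, hψ.eq_duhamel, duhamel, zero_smul, sub_zero,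
      Ioc_self, setIntegral_empty, add_zero, unfolded_of_mem hxS, hx w]

/-! ### Growth along characteristics -/

section Grows

variable {E : Type*} [NormedAddCommGroup E] [NormedSpace ℝ E] [MeasurableSpace E]
  [BorelSpace E] [FiniteDimensional ℝ E] {ν : Measure E} {V : E} {D : Set E} {u G : E → ℂ}

/-- Along almost every characteristic segment with end points in `D`, the function `u` changes by
the integral of `G`. -/
def GrowsAlong (ν : Measure E) (V : E) (D : Set E) (u G : E → ℂ) : Prop :=
  ∀ σ : ℝ, 0 ≤ σ → ∀ᵐ p ∂ν, p ∈ D → p + σ • V ∈ D →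
    u (p + σ • V) = u p + ∫ s in (0 : ℝ)..σ, G (p + s • V)

theorem norm_add_smul_lt {p : E} {s σ : ℝ} (hs : s ∈ Icc 0 σ) {n : ℕ}
    (hn : ‖p‖ + σ * ‖V‖ < n) : p + s • V ∈ Metric.ball (0 : E) n := by
  rw [mem_ball_zero_iff]
  refine (norm_add_le _ _).trans_lt (lt_of_le_of_lt ?_ hn)
  rw [norm_smul, Real.norm_of_nonneg hs.1]
  nlinarith [norm_nonneg V, hs.2]

variable [ν.IsAddHaarMeasure]

theorem ae_intervalIntegrable_shear (hG : ∀ n : ℕ, IntegrableOn G (Metric.ball 0 n) ν) (V : E)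
    {σ : ℝ} (hσ : 0 ≤ σ) :
    ∀ᵐ p ∂ν, IntervalIntegrable (fun s => G (p + s • V)) volume 0 σ := by
  have h : ∀ n : ℕ, ∀ᵐ p ∂ν, Integrable
      (fun s => (Metric.ball (0 : E) n).indicator G (p + s • V)) (volume.restrict (Ioc 0 σ)) :=
    fun n => (integrable_shear ((hG n).integrable_indicator measurableSet_ball) V σ).prod_left_ae
  filter_upwards [ae_all_iff.2 h] with p hp
  obtain ⟨n, hn⟩ := exists_nat_gt (‖p‖ + σ * ‖V‖)
  rw [intervalIntegrable_iff, uIoc_of_le hσ]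
  refine (hp n).congr ?_
  filter_upwards [ae_restrict_mem measurableSet_Ioc] with s hs
  exact indicator_of_mem (norm_add_smul_lt ⟨hs.1.le, hs.2⟩ hn) G

theorem growsAlong_of_weakTransport (hD : IsOpen D) (hc : Convex ℝ D)
    (hu : ∀ n : ℕ, IntegrableOn u (Metric.ball 0 n) ν)
    (hG : ∀ n : ℕ, IntegrableOn G (Metric.ball 0 n) ν)
    (h : ∀ n : ℕ, WeakTransport ν V (D ∩ Metric.ball 0 n) ((Metric.ball 0 n).indicator u)
      ((Metric.ball 0 n).indicator G)) : GrowsAlong ν V D u G := by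
  intro σ hσ
  have h1 := fun n : ℕ => (h n).ae_eq ((hu n).integrable_indicator measurableSet_ball)
    ((hG n).integrable_indicator measurableSet_ball) (hD.inter Metric.isOpen_ball)
    (hc.inter (convex_ball _ _)) hσ
  filter_upwards [ae_all_iff.2 h1] with p hp hp1 hp2
  obtain ⟨n, hn⟩ := exists_nat_gt (‖p‖ + σ * ‖V‖)
  have hb : ∀ s ∈ Icc 0 σ, p + s • V ∈ Metric.ball (0 : E) n := fun s hs =>
    norm_add_smul_lt hs hn
  have hb0 : p ∈ Metric.ball (0 : E) n := by simpa using hb 0 ⟨le_rfl, hσ⟩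
  have hb1 := hb σ ⟨hσ, le_rfl⟩
  have h2 := hp n ⟨hp1, hb0⟩ ⟨hp2, hb1⟩
  rw [indicator_of_mem hb0, indicator_of_mem hb1] at h2
  rw [h2]
  congr 1
  refine intervalIntegral.integral_congr fun s hs => ?_
  rw [uIcc_of_le hσ] at hs
  exact indicator_of_mem (hb s hs) G

/-- Growth along characteristics in two open sets gives growth in every convex set covered by them:
a segment that leaves one of the sets is divided at a point of the intersection, which can be taken
at a rational parameter. -/
theorem GrowsAlong.union {D₁ D₂ : Set E} (h1 : GrowsAlong ν V D₁ u G) (h2 : GrowsAlong ν V D₂ u G)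
    (ho1 : IsOpen D₁) (ho2 : IsOpen D₂) (hc : Convex ℝ D) (hD : D ⊆ D₁ ∪ D₂)
    (hG : ∀ n : ℕ, IntegrableOn G (Metric.ball 0 n) ν) : GrowsAlong ν V D u G := by
  intro σ hσ
  have hsplit : ∀ D₁ D₂ : Set E, GrowsAlong ν V D₁ u G → GrowsAlong ν V D₂ u G → ∀ᵐ p ∂ν, ∀ s : ℚ,
      0 ≤ (s : ℝ) → (s : ℝ) ≤ σ → p ∈ D₁ → p + (s : ℝ) • V ∈ D₁ → p + (s : ℝ) • V ∈ D₂ →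
      p + σ • V ∈ D₂ → u (p + σ • V) = u p + ∫ s in (0 : ℝ)..σ, G (p + s • V) := by
    intro D₁ D₂ h1 h2
    rw [ae_all_iff]
    intro s
    by_cases hs0 : 0 ≤ (s : ℝ)
    swap
    · exact Eventually.of_forall fun p h => absurd h hs0
    by_cases hs1 : (s : ℝ) ≤ σ
    swap
    · exact Eventually.of_forall fun p _ h => absurd h hs1
    have h3 := (quasiMeasurePreserving_add_right ν ((s : ℝ) • V)).ae
      (h2 (σ - s) (by linarith))
    filter_upwards [h1 s hs0, h3, ae_intervalIntegrable_shear hG V hσ]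
      with p hp1 hp2 hp3 _ _ a b c d
    have e1 : p + (s : ℝ) • V + (σ - s) • V = p + σ • V := by module
    have e2 : ∀ r : ℝ, p + (s : ℝ) • V + r • V = p + ((s : ℝ) + r) • V := fun r => by module
    have hp2' := hp2 c (by rwa [e1])
    rw [e1, hp1 a b] at hp2'
    simp only [e2] at hp2'
    rw [intervalIntegral.integral_comp_add_left (fun r => G (p + r • V)) (s : ℝ), add_zero,
      add_sub_cancel] at hp2'
    rw [hp2', add_assoc, intervalIntegral.integral_add_adjacent_intervals]
    · exact hp3.mono_set (by
        rw [uIcc_of_le hs0, uIcc_of_le hσ]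
        exact Icc_subset_Icc_right hs1)
    · exact hp3.mono_set (by
        rw [uIcc_of_le hs1, uIcc_of_le hσ]
        exact Icc_subset_Icc_left hs0)
  have hrat : ∀ (A₁ A₂ : Set E), IsOpen A₁ → IsOpen A₂ → D ⊆ A₁ ∪ A₂ → ∀ p, p ∈ D → p + σ • V ∈ D →
      0 < σ → p ∈ A₁ → p + σ • V ∈ A₂ →
      ∃ s : ℚ, 0 ≤ (s : ℝ) ∧ (s : ℝ) ≤ σ ∧ p + (s : ℝ) • V ∈ A₁ ∧ p + (s : ℝ) • V ∈ A₂ := by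
    intro A₁ A₂ o1 o2 hA p hp hpσ hσ' h3 h4
    have hcont : Continuous fun s : ℝ => p + s • V := by fun_prop
    have hseg : ∀ s ∈ Icc 0 σ, p + s • V ∈ D := fun s hs =>
      add_smul_mem_of_convex hc hp hpσ hs
    obtain ⟨s, hs, hs'⟩ := isPreconnected_Icc (a := (0 : ℝ)) (b := σ)
      ((fun s : ℝ => p + s • V) ⁻¹' A₁) ((fun s : ℝ => p + s • V) ⁻¹' A₂) (o1.preimage hcont)
      (o2.preimage hcont) (fun s hs => hA (hseg s hs)) ⟨0, ⟨le_rfl, hσ⟩, by simpa using h3⟩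
      ⟨σ, ⟨hσ, le_rfl⟩, h4⟩
    rw [← closure_Ioo hσ'.ne] at hs
    obtain ⟨s', hs1, hs2⟩ := mem_closure_iff.1 hs _
      ((o1.preimage hcont).inter (o2.preimage hcont)) hs'
    obtain ⟨r, hr⟩ := Rat.denseRange_cast.exists_mem_open
      (((o1.preimage hcont).inter (o2.preimage hcont)).inter (isOpen_Ioo (a := (0 : ℝ)) (b := σ)))
      ⟨s', hs1, hs2⟩
    exact ⟨r, hr.2.1.le, hr.2.2.le, hr.1.1, hr.1.2⟩
  rcases eq_or_lt_of_le hσ with rfl | hσ'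
  · exact Eventually.of_forall fun p _ _ => by simp
  filter_upwards [h1 σ hσ, h2 σ hσ, hsplit D₁ D₂ h1 h2, hsplit D₂ D₁ h2 h1]
    with p a1 a2 a3 a4 hp hpσ
  rcases hD hp with b1 | b1 <;> rcases hD hpσ with b2 | b2
  · exact a1 b1 b2
  · obtain ⟨s, c1, c2, c3, c4⟩ := hrat D₁ D₂ ho1 ho2 hD p hp hpσ hσ' b1 b2
    exact a3 s c1 c2 b1 c3 c4 b2
  · obtain ⟨s, c1, c2, c3, c4⟩ := hrat D₂ D₁ ho2 ho1 (by rwa [union_comm]) p hp hpσ hσ' b1 b2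
    exact a4 s c1 c2 b1 c3 c4 b2
  · exact a2 b1 b2

/-- Growth along characteristics is transported by a measure-preserving linear map, and the
function may be multiplied by an amplitude that is constant along the characteristics. -/
theorem GrowsAlong.comp_mul {V' : E} {D' : Set E} {u' G' : E → ℂ} (h : GrowsAlong ν V' D' u' G')
    {ρ : E →ₗ[ℝ] E} (hρ : MeasurePreserving ρ ν ν) (hV : ρ V = V') {a : E → ℂ}
    (ha : ∀ (p : E) (s : ℝ), a (p + s • V) = a p) (hc : Convex ℝ D) (hD : ∀ p ∈ D, ρ p ∈ D')
    (hu : ∀ p ∈ D, u p = a p * u' (ρ p)) (hG : ∀ p ∈ D, G p = a p * G' (ρ p)) :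
    GrowsAlong ν V D u G := by
  intro σ hσ
  filter_upwards [hρ.quasiMeasurePreserving.ae (h σ hσ)] with p hp h1 h2
  have hmap : ∀ s : ℝ, ρ (p + s • V) = ρ p + s • V' := fun s => by rw [map_add, map_smul, hV]
  have h3 := hp (hD p h1) (by rw [← hmap]; exact hD _ h2)
  rw [hu _ h2, hu _ h1, ha, hmap, h3, mul_add, ← intervalIntegral.integral_const_mul]
  congr 1
  refine intervalIntegral.integral_congr fun s hs => ?_
  rw [uIcc_of_le hσ] at hs
  have hseg : p + s • V ∈ D := add_smul_mem_of_convex hc h1 h2 hs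
  simp only [hG _ hseg, ha, hmap]

end Grows

/-! ### Matching across a wall -/

/-- The chart of space-time by the points of the wall `C₁` and the depth. -/
noncomputable def chartLₗ : ((ℝ × ℝ × ℝ) × ℝ) ≃L[ℝ] (ℝ × Config) :=
  LinearEquiv.toContinuousLinearEquiv
    { toFun := fun q => (q.1.1, chartL q)
      invFun := fun p => ((p.1, (p.2.1 + p.2.2.1) / 2, p.2.2.2), (p.2.1 - p.2.2.1) / 2)
      map_add' := fun p q => by ext <;> simp [chartL] <;> ring
      map_smul' := fun c p => by ext <;> simp [chartL] <;> ring
      left_inv := fun p => by ext <;> simp [chartL]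
      right_inv := fun p => by
        ext <;> simp only [chartL] <;> ring }

/-- The chart of space-time by the points of the wall `C₂` and the depth. -/
noncomputable def chartRₗ : ((ℝ × ℝ × ℝ) × ℝ) ≃L[ℝ] (ℝ × Config) :=
  LinearEquiv.toContinuousLinearEquiv
    { toFun := fun q => (q.1.1, chartR q)
      invFun := fun p => ((p.1, (p.2.1 + p.2.2.2) / 2, p.2.2.1), (p.2.2.2 - p.2.1) / 2)
      map_add' := fun p q => by ext <;> simp [chartR] <;> ring
      map_smul' := fun c p => by ext <;> simp [chartR] <;> ring
      left_inv := fun p => by ext <;> simp [chartR]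
      right_inv := fun p => by
        ext <;> simp only [chartR] <;> ring }

theorem chartLₗ_apply (q : (ℝ × ℝ × ℝ) × ℝ) : chartLₗ q = (q.1.1, chartL q) := rfl

theorem chartRₗ_apply (q : (ℝ × ℝ × ℝ) × ℝ) : chartRₗ q = (q.1.1, chartR q) := rfl

/-- Up to a constant, Haar measure is transported by linear equivalences. -/
theorem exists_volume_eq_smul_map (e : ((ℝ × ℝ × ℝ) × ℝ) ≃L[ℝ] (ℝ × Config)) :
    ∃ c : ℝ≥0∞, c ≠ ⊤ ∧ (volume : Measure (ℝ × Config)) = c • Measure.map e volume := by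
  exact ⟨Measure.addHaarScalarFactor volume (Measure.map e volume), ENNReal.coe_ne_top,
    Measure.isAddLeftInvariant_eq_smul _ _⟩

theorem setLIntegral_eq_mul_comp_chart {e : ((ℝ × ℝ × ℝ) × ℝ) ≃L[ℝ] (ℝ × Config)} {c : ℝ≥0∞}
    (hc : (volume : Measure (ℝ × Config)) = c • Measure.map e volume) (A : Set (ℝ × Config))
    (F : ℝ × Config → ℝ≥0∞) : ∫⁻ p in A, F p = c * ∫⁻ q in e ⁻¹' A, F (e q) := by
  conv_lhs => rw [hc]
  rw [Measure.restrict_smul, lintegral_smul_measure, smul_eq_mul]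
  congr 1
  exact ((MeasurePreserving.mk e.continuous.measurable rfl :
    MeasurePreserving e volume (Measure.map e volume)).setLIntegral_comp_preimage_emb
      e.toHomeomorph.measurableEmbedding F A).symm

/-- The matching condition of the gluing lemma: when the boundary values of `f` and `f'` on a wall
differ by the factor `a`, and `A` extends this factor into the interior at a Lipschitz rate, then
`f - A f'` tends to zero at the wall, in the mean over layers of vanishing depth. -/
theorem tendsto_layer_of_hasTraceAlong {y : (ℝ × ℝ × ℝ) × ℝ → Config}
    (e : ((ℝ × ℝ × ℝ) × ℝ) ≃L[ℝ] (ℝ × Config)) (he : ∀ q, e q = (q.1.1, y q))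
    {f f' : ℝ → Config → ℂ} (hf : Measurable fun p : ℝ × Config => f p.1 p.2)
    (hf' : Measurable fun p : ℝ × Config => f' p.1 p.2)
    (hint : ∀ n : ℕ, IntegrableOn (fun p : ℝ × Config => f' p.1 p.2) (Metric.ball 0 n))
    {g h a : ℝ × ℝ × ℝ → ℂ} (hg : HasTraceAlong y f g) (hh : HasTraceAlong y f' h)
    (ha : ∀ q, ‖a q‖ ≤ 1) {A : ℝ × Config → ℂ} {K : ℝ} (hK : 0 ≤ K)
    (hA : ∀ q : (ℝ × ℝ × ℝ) × ℝ, 0 < q.2 → ‖A (e q) - a q.1‖ ≤ K * q.2)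
    {P : ℝ × ℝ × ℝ → Prop} (hP : ∀ q, 0 < q.2 → y q ∈ S1 → P q.1)
    (hgh : ∀ᵐ q : ℝ × ℝ × ℝ, 0 < q.1 → P q → g q = a q * h q)
    {ℓ : ℝ × Config → ℝ} (hℓm : Measurable ℓ) (hℓ : ∀ q, ℓ (e q) = q.2) (n : ℕ) :
    Tendsto (fun δ : ℝ => (ENNReal.ofReal δ)⁻¹ *
      ∫⁻ p in (Ioi (0 : ℝ) ×ˢ S1 ∩ Metric.ball 0 n) ∩ {p | 0 < ℓ p ∧ ℓ p < δ},
        ‖f p.1 p.2 - A p * f' p.1 p.2‖ₑ) (𝓝[>] 0) (𝓝 0) := by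
  obtain ⟨c, hc, hvol⟩ := exists_volume_eq_smul_map e
  have hem : Measurable e := e.continuous.measurable
  have hym : Measurable y := by
    have : y = fun q => (e q).2 := by funext q; rw [he]
    rw [this]; exact measurable_snd.comp hem
  set R : ℝ := ‖(e.symm : (ℝ × Config) →L[ℝ] ((ℝ × ℝ × ℝ) × ℝ))‖ * n + 1 with hR
  set F₁ : (ℝ × ℝ × ℝ) × ℝ → ℝ≥0∞ := fun q => ‖f q.1.1 (y q) - g q.1‖ₑ with hF₁
  set F₂ : (ℝ × ℝ × ℝ) × ℝ → ℝ≥0∞ := fun q => ‖f' q.1.1 (y q) - h q.1‖ₑ with hF₂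
  set F₃ : (ℝ × ℝ × ℝ) × ℝ → ℝ≥0∞ := fun q => ‖f' q.1.1 (y q)‖ₑ with hF₃
  set W : Set ((ℝ × ℝ × ℝ) × ℝ) := e ⁻¹' Metric.ball 0 n with hW
  have hye : Measurable fun q : (ℝ × ℝ × ℝ) × ℝ => (q.1.1, y q) :=
    (measurable_fst.comp measurable_fst).prodMk hym
  have hF₁m : AEMeasurable F₁ volume :=
    ((hf.comp hye).aestronglyMeasurable.sub hg.1.comp_fst).enorm
  have hF₂m : AEMeasurable F₂ volume :=
    ((hf'.comp hye).aestronglyMeasurable.sub hh.1.comp_fst).enorm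
  have hF₃m : Measurable F₃ := (hf'.comp hye).enorm
  have hWfin : ∫⁻ q in W, F₃ q ≠ ⊤ := by
    have hc0 : c ≠ 0 := by
      rintro rfl
      rw [zero_smul] at hvol
      have h1 := Metric.isOpen_ball.measure_ne_zero (volume : Measure (ℝ × Config))
        ⟨0, Metric.mem_ball_self (x := (0 : ℝ × Config)) one_pos⟩
      exact h1 (by rw [hvol]; rfl)
    have h1 := setLIntegral_eq_mul_comp_chart hvol (Metric.ball 0 n)
      (fun p => ‖f' p.1 p.2‖ₑ)
    simp only [he] at h1
    intro h2
    have h3 := (hint n).2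
    rw [hasFiniteIntegral_iff_enorm, h1] at h3
    rw [show (∫⁻ q in e ⁻¹' Metric.ball 0 n, ‖f' q.1.1 (y q)‖ₑ) = ⊤ from h2,
      ENNReal.mul_top hc0] at h3
    exact lt_irrefl _ h3
  have h3 := tendsto_lintegral_layer (m := volume.restrict W) hF₃m.aemeasurable hWfin
    (measurable_snd : Measurable fun q : (ℝ × ℝ × ℝ) × ℝ => q.2)
  have hmain : Tendsto (fun δ : ℝ =>
      c * ((ENNReal.ofReal δ)⁻¹ * ∫⁻ q in layer y R δ, F₁ q)
      + c * ((ENNReal.ofReal δ)⁻¹ * ∫⁻ q in layer y R δ, F₂ q)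
      + c * (ENNReal.ofReal K *
        ∫⁻ q in {q | 0 < q.2 ∧ q.2 < δ}, F₃ q ∂(volume.restrict W))) (𝓝[>] 0) (𝓝 0) := by
    have t1 := ENNReal.Tendsto.const_mul (a := c) (hg.2 R) (Or.inr hc)
    have t2 := ENNReal.Tendsto.const_mul (a := c) (hh.2 R) (Or.inr hc)
    have t3 := ENNReal.Tendsto.const_mul (a := c)
      (ENNReal.Tendsto.const_mul (a := ENNReal.ofReal K) h3 (Or.inr ENNReal.ofReal_ne_top))
      (Or.inr hc)
    simpa using (t1.add t2).add t3
  refine tendsto_of_tendsto_of_tendsto_of_le_of_le' tendsto_const_nhds hmain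
    (Eventually.of_forall fun _ => zero_le) ?_
  filter_upwards [self_mem_nhdsWithin] with δ hδ
  have hδ0 : ENNReal.ofReal δ ≠ 0 := by simpa using hδ
  rw [setLIntegral_eq_mul_comp_chart hvol]
  simp only [he]
  set L : Set ((ℝ × ℝ × ℝ) × ℝ) :=
    e ⁻¹' ((Ioi (0 : ℝ) ×ˢ S1 ∩ Metric.ball 0 n) ∩ {p | 0 < ℓ p ∧ ℓ p < δ}) with hL
  have hmem : ∀ q ∈ L, 0 < q.1.1 ∧ y q ∈ S1 ∧ q ∈ W ∧ 0 < q.2 ∧ q.2 < δ := by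
    rintro q ⟨⟨h1, h2⟩, h4, h5⟩
    rw [hℓ] at h4 h5
    rw [he] at h1
    exact ⟨h1.1, h1.2, h2, h4, h5⟩
  have hLl : L ⊆ layer y R δ := by
    intro q hq
    obtain ⟨h1, h2, h4, h5, h6⟩ := hmem q hq
    have h7 : ‖q‖ < R := by
      have h8 := (e.symm : (ℝ × Config) →L[ℝ] ((ℝ × ℝ × ℝ) × ℝ)).le_opNorm (e q)
      rw [ContinuousLinearEquiv.coe_coe, e.symm_apply_apply] at h8
      have h9 : ‖e q‖ < n := mem_ball_zero_iff.1 h4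
      nlinarith [norm_nonneg (e.symm : (ℝ × Config) →L[ℝ] ((ℝ × ℝ × ℝ) × ℝ))]
    have h10 : ‖q.1‖ < R := (le_max_left _ _).trans_lt h7
    have h11 : ‖q.1.2‖ < R := (le_max_right _ _).trans_lt h10
    exact ⟨h1, (le_abs_self _).trans_lt ((le_max_left _ _).trans_lt h10),
      (le_max_left _ _).trans_lt h11, (le_max_right _ _).trans_lt h11, h5, h6, h2⟩
  have hLm : MeasurableSet L := hem ((((measurableSet_Ioi.prod measurableSet_S1).inter
    measurableSet_ball).inter ((measurableSet_lt measurable_const hℓm).inter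
      (measurableSet_lt hℓm measurable_const))))
  have hae : ∀ᵐ q : (ℝ × ℝ × ℝ) × ℝ, 0 < q.1.1 → P q.1 → g q.1 = a q.1 * h q.1 :=
    Measure.quasiMeasurePreserving_fst.ae hgh
  have hle : ∫⁻ q in L, ‖f q.1.1 (y q) - A (q.1.1, y q) * f' q.1.1 (y q)‖ₑ
      ≤ ∫⁻ q in L, (F₁ q + F₂ q + ENNReal.ofReal (K * δ) * F₃ q) := by
    refine lintegral_mono_ae ?_
    filter_upwards [ae_restrict_of_ae hae, ae_restrict_mem hLm] with q h1 hq
    obtain ⟨b1, b2, b3, b4, b5⟩ := hmem q hq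
    have h2 := h1 b1 (hP q b4 b2)
    have h4 := hA q b4
    rw [he] at h4
    have h5 : f q.1.1 (y q) - A (q.1.1, y q) * f' q.1.1 (y q)
        = (f q.1.1 (y q) - g q.1) - a q.1 * (f' q.1.1 (y q) - h q.1)
          - (A (q.1.1, y q) - a q.1) * f' q.1.1 (y q) := by
      rw [h2]; ring
    rw [h5]
    refine (enorm_sub_le).trans (add_le_add ((enorm_sub_le).trans (add_le_add le_rfl ?_)) ?_)
    · rw [enorm_mul]
      refine mul_le_of_le_one_left zero_le ?_
      rw [← ofReal_norm, ENNReal.ofReal_le_one]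
      exact ha _
    · rw [enorm_mul]
      refine mul_le_mul' ?_ le_rfl
      rw [← ofReal_norm]
      exact ENNReal.ofReal_le_ofReal (h4.trans (mul_le_mul_of_nonneg_left b5.le hK))
  have hLW : L ⊆ {q | 0 < q.2 ∧ q.2 < δ} ∩ W := fun q hq =>
    ⟨⟨(hmem q hq).2.2.2.1, (hmem q hq).2.2.2.2⟩, (hmem q hq).2.2.1⟩
  calc (ENNReal.ofReal δ)⁻¹ * (c * ∫⁻ q in L, ‖f q.1.1 (y q) - A (q.1.1, y q) * f' q.1.1 (y q)‖ₑ)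
      ≤ (ENNReal.ofReal δ)⁻¹ * (c * ∫⁻ q in L, (F₁ q + F₂ q + ENNReal.ofReal (K * δ) * F₃ q)) := by
        gcongr
    _ = c * ((ENNReal.ofReal δ)⁻¹ * ∫⁻ q in L, F₁ q)
        + c * ((ENNReal.ofReal δ)⁻¹ * ∫⁻ q in L, F₂ q)
        + c * (ENNReal.ofReal K * ∫⁻ q in L, F₃ q) := by
        rw [lintegral_add_right _ (hF₃m.const_mul _), lintegral_add_left' hF₁m.restrict,
          lintegral_const_mul _ hF₃m, ENNReal.ofReal_mul hK]
        have h6 := ENNReal.inv_mul_cancel hδ0 ENNReal.ofReal_ne_top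
        calc _ = c * ((ENNReal.ofReal δ)⁻¹ * ∫⁻ q in L, F₁ q)
            + c * ((ENNReal.ofReal δ)⁻¹ * ∫⁻ q in L, F₂ q)
            + c * (((ENNReal.ofReal δ)⁻¹ * ENNReal.ofReal δ)
              * (ENNReal.ofReal K * ∫⁻ q in L, F₃ q)) := by ring
          _ = _ := by rw [h6, one_mul]
    _ ≤ _ := by
        have hm : MeasurableSet {q : (ℝ × ℝ × ℝ) × ℝ | 0 < q.2 ∧ q.2 < δ} :=
          (measurableSet_lt measurable_const measurable_snd).inter
            (measurableSet_lt measurable_snd measurable_const)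
        rw [Measure.restrict_restrict hm]
        gcongr

/-! ### Weak solutions grow along the unfolded characteristics -/

variable {μ : ℝ → ℝ} {θ₁ θ₂ κ : ℝ} {ψ : ℝ → Label → Config → ℂ}

/-- A weak solution of the boundary value problem in components, given by a
jointly measurable, locally integrable representative. No initial value is prescribed. -/
structure IsWeakState (μ : ℝ → ℝ) (θ₁ θ₂ κ : ℝ) (ψ : ℝ → Label → Config → ℂ) : Prop where
  measurable : ∀ w, Measurable fun p : ℝ × Config => ψ p.1 w p.2
  integrableOn : ∀ w (n : ℕ),
    IntegrableOn (fun p : ℝ × Config => ψ p.1 w p.2) (Metric.ball 0 n) volume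
  transport : ∀ w, WeakTransport volume (velST w) (Ioi (0 : ℝ) ×ˢ S1) (fun p => ψ p.1 w p.2)
    (fun p => massTerm κ (ψ p.1) w p.2)
  trace₁ : ∀ c : Fin 2, ∃ g h : ℝ × ℝ × ℝ → ℂ,
    HasTraceAlong chartL (fun t x => ψ t (0, 1, c) x) g ∧
    HasTraceAlong chartL (fun t x => ψ t (1, 0, c) x) h ∧
    ∀ᵐ p : ℝ × ℝ × ℝ, 0 < p.1 → p.2.1 < p.2.2 →
      g p = (μ |p.2.1 - p.2.2| : ℂ) * Complex.exp (Complex.I * (θ₁ : ℂ)) * h p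
  trace₂ : ∀ b : Fin 2, ∃ g h : ℝ × ℝ × ℝ → ℂ,
    HasTraceAlong chartR (fun t x => ψ t (1, b, 0) x) g ∧
    HasTraceAlong chartR (fun t x => ψ t (0, b, 1) x) h ∧
    ∀ᵐ p : ℝ × ℝ × ℝ, 0 < p.1 → p.2.2 < p.2.1 →
      g p = (μ |p.2.2 - p.2.1| : ℂ) * Complex.exp (Complex.I * (θ₂ : ℂ)) * h p

/-- The exchange of the photon and the first electron in space-time. -/
noncomputable def swapLST : (ℝ × Config) ≃L[ℝ] (ℝ × Config) :=
  (ContinuousLinearEquiv.refl ℝ ℝ).prodCongr swapLₗ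

/-- The exchange of the photon and the second electron in space-time. -/
noncomputable def swapRST : (ℝ × Config) ≃L[ℝ] (ℝ × Config) :=
  (ContinuousLinearEquiv.refl ℝ ℝ).prodCongr swapRₗ

theorem swapLST_apply (p : ℝ × Config) : swapLST p = (p.1, swapL p.2) := rfl

theorem swapRST_apply (p : ℝ × Config) : swapRST p = (p.1, swapR p.2) := rfl

theorem measurePreserving_swapLST : MeasurePreserving swapLST volume volume :=
  (MeasurePreserving.id volume).prod measurePreserving_swapL

theorem measurePreserving_swapRST : MeasurePreserving swapRST volume volume :=
  (MeasurePreserving.id volume).prod measurePreserving_swapR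

theorem norm_swapLST (p : ℝ × Config) : ‖swapLST p‖ = ‖p‖ := by
  simp only [swapLST_apply, swapL, Prod.norm_def]
  congr 1
  rw [← max_assoc, max_comm ‖p.2.2.1‖, max_assoc]

theorem norm_swapRST (p : ℝ × Config) : ‖swapRST p‖ = ‖p‖ := by
  simp only [swapRST_apply, swapR, Prod.norm_def]
  congr 1
  rw [max_comm ‖p.2.2.1‖, ← max_assoc, max_comm, max_comm ‖p.2.2.2‖, max_left_comm]

theorem integrableOn_ball_comp {e : (ℝ × Config) ≃L[ℝ] (ℝ × Config)}
    (he : MeasurePreserving e volume volume) (hn : ∀ p, ‖e p‖ = ‖p‖) {f : ℝ × Config → ℂ} {n : ℕ}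
    (hf : IntegrableOn f (Metric.ball 0 n) volume) :
    IntegrableOn (fun p => f (e p)) (Metric.ball 0 n) volume := by
  have h := (he.integrableOn_comp_preimage e.toHomeomorph.measurableEmbedding).2 hf
  have h1 : e ⁻¹' Metric.ball 0 n = Metric.ball 0 n := by
    ext p
    simp [hn]
  rwa [h1] at h

/-- Unfolding preserves local integrability in space-time. -/
theorem integrableOn_unfolded (hμ : ∀ s, ‖μ |s|‖ ≤ 1) (hμm : Measurable fun s => μ |s|)
    {n : ℕ} (h : ∀ w, IntegrableOn (fun p : ℝ × Config => ψ p.1 w p.2) (Metric.ball 0 n) volume)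
    (w : Label) : IntegrableOn (fun p : ℝ × Config => unfolded μ θ₁ θ₂ (ψ p.1) w p.2)
      (Metric.ball 0 n) volume := by
  have h0 : ∀ w, IntegrableOn (fun p : ℝ × Config => onS1 (ψ p.1) w p.2)
      (Metric.ball 0 n) volume := fun w =>
    (h w).indicator (measurable_snd measurableSet_S1)
  have hL : ∀ {f : ℝ × Config → ℂ}, IntegrableOn f (Metric.ball 0 n) volume →
      IntegrableOn (fun p : ℝ × Config => f (p.1, swapL p.2)) (Metric.ball 0 n) volume := fun hf =>
    integrableOn_ball_comp measurePreserving_swapLST norm_swapLST hf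
  have hR : ∀ {f : ℝ × Config → ℂ}, IntegrableOn f (Metric.ball 0 n) volume →
      IntegrableOn (fun p : ℝ × Config => f (p.1, swapR p.2)) (Metric.ball 0 n) volume := fun hf =>
    integrableOn_ball_comp measurePreserving_swapRST norm_swapRST hf
  have aL : ∀ w, ∀ {f : ℝ × Config → ℂ}, IntegrableOn f (Metric.ball 0 n) volume →
      IntegrableOn (fun p => ampL μ θ₁ w p.2 * f p) (Metric.ball 0 n) volume := fun w f hf =>
    hf.bdd_smul 1 ((measurable_ampL hμm w).comp measurable_snd).aestronglyMeasurable
      (Eventually.of_forall fun p => norm_ampL_le hμ w p.2)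
  have aR : ∀ w, ∀ {f : ℝ × Config → ℂ}, IntegrableOn f (Metric.ball 0 n) volume →
      IntegrableOn (fun p => ampR μ θ₂ w p.2 * f p) (Metric.ball 0 n) volume := fun w f hf =>
    hf.bdd_smul 1 ((measurable_ampR hμm w).comp measurable_snd).aestronglyMeasurable
      (Eventually.of_forall fun p => norm_ampR_le hμ w p.2)
  exact ((h0 w).add (aL w ((hL (h0 _)).add (hL (aR (swapL w) (hR (h0 _))))))).add
    (aR w ((hR (h0 _)).add (hR (aL (swapR w) (hL (h0 _))))))

theorem IsWeakState.integrableOn_massTerm (hψ : IsWeakState μ θ₁ θ₂ κ ψ) (w : Label) (n : ℕ) :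
    IntegrableOn (fun p : ℝ × Config => massTerm κ (ψ p.1) w p.2) (Metric.ball 0 n) volume :=
  ((hψ.integrableOn _ n).add (hψ.integrableOn _ n)).const_mul _

/-- The unfolded solution in space-time. -/
noncomputable def unfoldedST (μ : ℝ → ℝ) (θ₁ θ₂ : ℝ) (ψ : ℝ → Label → Config → ℂ) (w : Label)
    (p : ℝ × Config) : ℂ := unfolded μ θ₁ θ₂ (ψ p.1) w p.2

/-- The unfolded source in space-time. -/
noncomputable def sourceST (μ : ℝ → ℝ) (θ₁ θ₂ κ : ℝ) (ψ : ℝ → Label → Config → ℂ) (w : Label)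
    (p : ℝ × Config) : ℂ := unfolded μ θ₁ θ₂ (massTerm κ (ψ p.1)) w p.2

/-- Weak transport on the two sides of a wall with matching boundary values. Here `ℓ` is the depth,
`ρ` the reflection, and `A = a z` the amplitude with which component `w'` enters component `w`. -/
theorem IsWeakState.growsAlong_across (hψ : IsWeakState μ θ₁ θ₂ κ ψ) (hμ : ∀ s, ‖μ |s|‖ ≤ 1)
    (hμm : Measurable fun s => μ |s|) {w w' : Label} {y : (ℝ × ℝ × ℝ) × ℝ → Config}
    (e : ((ℝ × ℝ × ℝ) × ℝ) ≃L[ℝ] (ℝ × Config)) (he : ∀ q, e q = (q.1.1, y q))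
    {g h b : ℝ × ℝ × ℝ → ℂ} (hg : HasTraceAlong y (fun t x => ψ t w x) g)
    (hh : HasTraceAlong y (fun t x => ψ t w' x) h) (hb : ∀ q, ‖b q‖ ≤ 1)
    {A : ℝ × Config → ℂ} (ρ : (ℝ × Config) ≃L[ℝ] (ℝ × Config)) {K : ℝ} (hK : 0 ≤ K)
    (hA : ∀ q : (ℝ × ℝ × ℝ) × ℝ, 0 < q.2 → ‖A (ρ (e q)) - b q.1‖ ≤ K * q.2)
    {P : ℝ × ℝ × ℝ → Prop} (hP : ∀ q, 0 < q.2 → y q ∈ S1 → P q.1)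
    (hgh : ∀ᵐ q : ℝ × ℝ × ℝ, 0 < q.1 → P q → g q = b q * h q)
    {ℓ : (ℝ × Config) →L[ℝ] ℝ} (hℓ : ∀ q, ℓ (e q) = q.2) {n : ℝ × Config}
    (hρ : ∀ p, ρ p = p - (2 * ℓ p) • n) (hρρ : ∀ p, ρ (ρ p) = p) (hρℓ : ∀ p, ℓ (ρ p) = -ℓ p)
    (hρν : MeasurePreserving ρ volume volume) (hρn : ∀ p, ‖ρ p‖ = ‖p‖)
    (hρV : ρ (velST w) = velST w') {D : Set (ℝ × Config)} (hD : IsOpen D) (hDc : Convex ℝ D)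
    (hpos : ∀ p ∈ D, 0 < ℓ p → p ∈ Ioi (0 : ℝ) ×ˢ S1)
    (hneg : ∀ p ∈ D, ℓ p < 0 → ρ p ∈ Ioi (0 : ℝ) ×ˢ S1)
    {a : ℝ × Config → ℝ} {z : ℂ} (haA : ∀ p ∈ ρ ⁻¹' (Ioi (0 : ℝ) ×ˢ S1), A p = z * a p)
    (ha : ContDiffOn ℝ ∞ a (ρ ⁻¹' (Ioi (0 : ℝ) ×ˢ S1)))
    (haV : ∀ (p : ℝ × Config) (s : ℝ), a (p + s • velST w) = a p)
    (hU : ∀ (φ : ℝ → Label → Config → ℂ) p, ℓ p < 0 →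
      unfoldedST μ θ₁ θ₂ φ w p = A p * unfoldedST μ θ₁ θ₂ φ w' (ρ p)) :
    GrowsAlong volume (velST w) D (unfoldedST μ θ₁ θ₂ ψ w) (sourceST μ θ₁ θ₂ κ ψ w) := by
  have hUi := fun n => integrableOn_unfolded (θ₁ := θ₁) (θ₂ := θ₂) hμ hμm
    (fun w => hψ.integrableOn w n) w
  have hGi := fun n => integrableOn_unfolded (ψ := fun t => massTerm κ (ψ t)) (θ₁ := θ₁) (θ₂ := θ₂)
    hμ hμm (fun w => hψ.integrableOn_massTerm w n) w
  refine growsAlong_of_weakTransport hD hDc hUi hGi fun k => ?_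
  have hS : IsOpen (ρ ⁻¹' (Ioi (0 : ℝ) ×ˢ S1)) := (isOpen_Ioi.prod isOpen_S1).preimage ρ.continuous
  have hUS : ∀ (φ : ℝ → Label → Config → ℂ) w, ∀ p ∈ Ioi (0 : ℝ) ×ˢ S1,
      unfoldedST μ θ₁ θ₂ φ w p = φ p.1 w p.2 := fun φ w p hp => unfolded_of_mem hp.2 w
  have hball : ∀ p ∈ Metric.ball (0 : ℝ × Config) k, ρ p ∈ Metric.ball (0 : ℝ × Config) k := by
    intro p hp
    simpa [hρn] using hp
  have hℓ0 : ℓ ≠ 0 := by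
    rintro rfl
    have := hℓ (0, 1)
    simp at this
  refine WeakTransport.glue ℓ hρ hρℓ hρν ρ.toHomeomorph.measurableEmbedding
    ((hUi k).integrable_indicator measurableSet_ball)
    ((hGi k).integrable_indicator measurableSet_ball) hℓ0
    (hD.inter Metric.isOpen_ball).measurableSet
    ?_ ?_ ?_
  · refine ((hψ.transport w).mono (D' := (D ∩ Metric.ball 0 k) ∩ {p | 0 < ℓ p})
      fun p hp => hpos p hp.1.1 hp.2).congr_on (fun p hp => ?_) (fun p hp => ?_)
    · rw [indicator_of_mem hp.1.2]
      exact hUS ψ w p (hpos p hp.1.1 hp.2)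
    · rw [indicator_of_mem hp.1.2]
      exact hUS (fun t => massTerm κ (ψ t)) w p (hpos p hp.1.1 hp.2)
  · have h1 := hψ.transport w'
    rw [← hρV] at h1
    have h2 := ((h1.comp_equiv ρ hρν).mul_invariant hS ha haV).const_mul z
    refine (h2.mono (D' := (D ∩ Metric.ball 0 k) ∩ {p | ℓ p < 0})
      fun p hp => hneg p hp.1.1 hp.2).congr_on (fun p hp => ?_) (fun p hp => ?_)
    · rw [indicator_of_mem hp.1.2, hU ψ p hp.2, haA p (hneg p hp.1.1 hp.2),
        hUS ψ w' _ (hneg p hp.1.1 hp.2), Complex.real_smul, mul_assoc]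
    · rw [indicator_of_mem hp.1.2]
      refine (hU (fun t => massTerm κ (ψ t)) p hp.2).trans ?_
      rw [haA p (hneg p hp.1.1 hp.2), hUS (fun t => massTerm κ (ψ t)) w' _ (hneg p hp.1.1 hp.2),
        Complex.real_smul, mul_assoc]
  · have h1 := tendsto_layer_of_hasTraceAlong e he (hψ.measurable w) (hψ.measurable w')
      (hψ.integrableOn w') hg hh hb (A := fun p => A (ρ p)) hK hA hP hgh
      ℓ.continuous.measurable hℓ k
    refine tendsto_of_tendsto_of_tendsto_of_le_of_le tendsto_const_nhds h1
      (fun _ => zero_le) fun δ => ?_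
    refine mul_le_mul' le_rfl ?_
    have hm : MeasurableSet ((D ∩ Metric.ball 0 k) ∩ {p | 0 < ℓ p ∧ ℓ p < δ}) :=
      (hD.inter Metric.isOpen_ball).measurableSet.inter
        ((measurableSet_lt measurable_const ℓ.continuous.measurable).inter
          (measurableSet_lt ℓ.continuous.measurable measurable_const))
    refine (setLIntegral_congr_fun hm fun p hp => ?_).le.trans
      (lintegral_mono_set (f := fun p => ‖ψ p.1 w p.2 - A (ρ p) * ψ p.1 w' p.2‖ₑ)
        fun p hp => ⟨⟨hpos p hp.1.1 hp.2.1, hp.1.2⟩, hp.2⟩)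
    have h2 := hpos p hp.1.1 hp.2.1
    have h3 : ℓ (ρ p) < 0 := by rw [hρℓ]; linarith [hp.2.1]
    rw [indicator_of_mem hp.1.2, indicator_of_mem (hball p hp.1.2), hUS ψ w p h2, hU ψ _ h3, hρρ,
      hUS ψ w' p h2]

theorem isOpen_space {Ω : Set Config} (h : IsOpen Ω) : IsOpen (Ioi (0 : ℝ) ×ˢ Ω) :=
  isOpen_Ioi.prod h

theorem convex_lt (f g : Config →L[ℝ] ℝ) : Convex ℝ {x | f x < g x} := by
  have h := convex_halfSpace_lt (𝕜 := ℝ) (f := (f - g : Config →L[ℝ] ℝ))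
    (f - g : Config →L[ℝ] ℝ).isBoundedLinearMap.toIsLinearMap 0
  simpa [sub_neg] using h

theorem isOpen_clm_lt (f g : Config →L[ℝ] ℝ) : IsOpen {x | f x < g x} :=
  isOpen_lt f.continuous g.continuous

/-- The coordinate of the photon. -/
noncomputable def coordPh : Config →L[ℝ] ℝ := ContinuousLinearMap.fst ℝ ℝ (ℝ × ℝ)

/-- The coordinate of the first electron. -/
noncomputable def coordE1 : Config →L[ℝ] ℝ :=
  (ContinuousLinearMap.fst ℝ ℝ ℝ).comp (ContinuousLinearMap.snd ℝ ℝ (ℝ × ℝ))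

/-- The coordinate of the second electron. -/
noncomputable def coordE2 : Config →L[ℝ] ℝ :=
  (ContinuousLinearMap.snd ℝ ℝ ℝ).comp (ContinuousLinearMap.snd ℝ ℝ (ℝ × ℝ))

/-- The set on which the coordinate `f` is less than `g`, and `f'` is less than `g'`. -/
def sector (f g f' g' : Config →L[ℝ] ℝ) : Set Config := {x | f x < g x} ∩ {x | f' x < g' x}

theorem isOpen_sector (f g f' g' : Config →L[ℝ] ℝ) : IsOpen (sector f g f' g') :=
  (isOpen_clm_lt f g).inter (isOpen_clm_lt f' g')

theorem convex_sector (f g f' g' : Config →L[ℝ] ℝ) : Convex ℝ (sector f g f' g') :=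
  (convex_lt f g).inter (convex_lt f' g')

/-- The configurations on both sides of `C₁`. -/
def acrossL : Set Config := {x | x.1 < x.2.2 ∧ x.2.1 < x.2.2}

/-- The configurations on both sides of `C₂`. -/
def acrossR : Set Config := {x | x.2.1 < x.1 ∧ x.2.1 < x.2.2}

theorem isOpen_acrossL : IsOpen acrossL := isOpen_sector coordPh coordE2 coordE1 coordE2

theorem isOpen_acrossR : IsOpen acrossR := isOpen_sector coordE1 coordPh coordE1 coordE2

theorem convex_acrossL : Convex ℝ acrossL := convex_sector coordPh coordE2 coordE1 coordE2

theorem convex_acrossR : Convex ℝ acrossR := convex_sector coordE1 coordPh coordE1 coordE2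

variable {μ : ℝ → ℝ} {θ₁ θ₂ κ : ℝ} {ψ : ℝ → Label → Config → ℂ} {K : ℝ}

theorem norm_wall_factor_le (hμ : ∀ s, ‖μ |s|‖ ≤ 1) (θ s : ℝ) :
    ‖(μ |s| : ℂ) * Complex.exp (Complex.I * (θ : ℂ))‖ ≤ 1 := by
  rw [norm_mul, mul_comm Complex.I, Complex.norm_exp_ofReal_mul_I, mul_one, Complex.norm_real]
  exact hμ s

theorem norm_wall_factor_sub_le (hμL : ∀ s t, ‖μ |s| - μ |t|‖ ≤ K * |s - t|) (θ s t : ℝ) :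
    ‖(μ |s| : ℂ) * Complex.exp (Complex.I * (θ : ℂ))
      - (μ |t| : ℂ) * Complex.exp (Complex.I * (θ : ℂ))‖ ≤ K * |s - t| := by
  rw [← sub_mul, norm_mul, mul_comm Complex.I, Complex.norm_exp_ofReal_mul_I, mul_one,
    ← Complex.ofReal_sub, Complex.norm_real]
  exact hμL s t

theorem abs_vel (i : Fin 2) : |vel i| = 1 := by
  fin_cases i <;> simp

/-- The component `(0, 1, c)` is the one that leaves the wall `s_ph = s_e1`; its unfolded form
crosses this wall while the second electron stays on the right of the other two particles. -/
theorem IsWeakState.growsAlong_acrossL (hψ : IsWeakState μ θ₁ θ₂ κ ψ) (hμ : ∀ s, ‖μ |s|‖ ≤ 1)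
    (hμm : Measurable fun s => μ |s|) (hμL : ∀ s t, ‖μ |s| - μ |t|‖ ≤ K * |s - t|)
    (hμs : ContDiffOn ℝ ∞ μ (Ici 0)) (hK : 0 ≤ K) (c : Fin 2) :
    GrowsAlong volume (velST (0, 1, c)) (Ioi (0 : ℝ) ×ˢ acrossL) (unfoldedST μ θ₁ θ₂ ψ (0, 1, c))
      (sourceST μ θ₁ θ₂ κ ψ (0, 1, c)) := by
  obtain ⟨g, h, hg, hh, hgh⟩ := hψ.trace₁ c
  have hdist : ∀ p ∈ swapLST ⁻¹' (Ioi (0 : ℝ) ×ˢ S1),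
      0 < p.2.2.2 - ((1 + vel c) / 2 * p.2.1 + (1 - vel c) / 2 * p.2.2.1) := by
    rintro p ⟨-, h1, h2⟩
    simp only [swapLST_apply, swapL] at h1 h2
    fin_cases c <;> simp <;> linarith
  refine hψ.growsAlong_across hμ hμm chartLₗ chartLₗ_apply hg hh
    (b := fun q => (μ |q.2.1 - q.2.2| : ℂ) * Complex.exp (Complex.I * (θ₁ : ℂ)))
    (fun q => norm_wall_factor_le hμ _ _) (A := fun p => ampL μ θ₁ (0, 1, c) p.2) swapLST hK ?_
    (P := fun q => q.2.1 < q.2.2) ?_ hgh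
    (ℓ := (1 / 2 : ℝ) • (coordPh - coordE1).comp (ContinuousLinearMap.snd ℝ ℝ Config)) ?_
    (n := (0, 1, -1, 0)) ?_ (fun p => rfl) ?_ measurePreserving_swapLST norm_swapLST rfl
    (isOpen_space isOpen_acrossL) ((convex_Ioi 0).prod convex_acrossL) ?_ ?_
    (a := fun p => μ (p.2.2.2 - ((1 + vel c) / 2 * p.2.1 + (1 - vel c) / 2 * p.2.2.1)))
    (z := Complex.exp (Complex.I * (θ₁ : ℂ))) ?_ ?_ ?_ ?_
  · rintro ⟨⟨t, s, r⟩, h⟩ (hh : 0 < h)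
    rw [ampL, if_pos ⟨rfl, rfl⟩, abs_sub_comm s r]
    refine (norm_wall_factor_sub_le hμL _ _ _).trans_eq ?_
    congr 1
    refine (congrArg abs (?_ : _ = vel c * h)).trans
      (by rw [abs_mul, abs_vel, one_mul, abs_of_pos hh])
    simp only [chartLₗ_apply, swapLST_apply, chartL, swapL]
    ring
  · rintro q h1 ⟨-, h2⟩
    simp only [chartL] at h2
    linarith
  · intro q
    simp [chartLₗ_apply, chartL, coordPh, coordE1]
    ring
  · intro p
    refine Prod.ext ?_ (Prod.ext ?_ (Prod.ext ?_ ?_)) <;>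
      simp [swapLST_apply, swapL, coordPh, coordE1]
  · intro p
    simp [swapLST_apply, swapL, coordPh, coordE1]
    ring
  · rintro p ⟨h1, h2, h3⟩ h4
    simp [coordPh, coordE1] at h4
    exact ⟨h1, h4, h2⟩
  · rintro p ⟨h1, h2, h3⟩ h4
    simp [coordPh, coordE1] at h4
    exact ⟨h1, by simp [swapLST_apply, swapL]; linarith, h3⟩
  · intro p hp
    rw [ampL, if_pos ⟨rfl, rfl⟩, abs_of_pos (hdist p hp), mul_comm]
  · exact hμs.comp (f := fun p : ℝ × Config =>
      p.2.2.2 - ((1 + vel c) / 2 * p.2.1 + (1 - vel c) / 2 * p.2.2.1))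
      (ContDiff.contDiffOn (by fun_prop)) fun p hp => (hdist p hp).le
  · intro p s
    congr 1
    fin_cases c <;> simp [velST, vel3]
  · intro φ p hp
    refine unfolded_swapL c ?_
    simp [coordPh, coordE1] at hp
    linarith

/-- The component `(1, b, 0)` is the one that leaves the wall `s_ph = s_e2`; its unfolded form
crosses this wall while the first electron stays on the left of the other two particles. -/
theorem IsWeakState.growsAlong_acrossR (hψ : IsWeakState μ θ₁ θ₂ κ ψ) (hμ : ∀ s, ‖μ |s|‖ ≤ 1)
    (hμm : Measurable fun s => μ |s|) (hμL : ∀ s t, ‖μ |s| - μ |t|‖ ≤ K * |s - t|)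
    (hμs : ContDiffOn ℝ ∞ μ (Ici 0)) (hK : 0 ≤ K) (b : Fin 2) :
    GrowsAlong volume (velST (1, b, 0)) (Ioi (0 : ℝ) ×ˢ acrossR) (unfoldedST μ θ₁ θ₂ ψ (1, b, 0))
      (sourceST μ θ₁ θ₂ κ ψ (1, b, 0)) := by
  obtain ⟨g, h, hg, hh, hgh⟩ := hψ.trace₂ b
  have hdist : ∀ p ∈ swapRST ⁻¹' (Ioi (0 : ℝ) ×ˢ S1),
      0 < (1 - vel b) / 2 * p.2.1 + (1 + vel b) / 2 * p.2.2.2 - p.2.2.1 := by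
    rintro p ⟨-, h1, h2⟩
    simp only [swapRST_apply, swapR] at h1 h2
    fin_cases b <;> simp <;> linarith
  refine hψ.growsAlong_across hμ hμm chartRₗ chartRₗ_apply hg hh
    (b := fun q => (μ |q.2.2 - q.2.1| : ℂ) * Complex.exp (Complex.I * (θ₂ : ℂ)))
    (fun q => norm_wall_factor_le hμ _ _) (A := fun p => ampR μ θ₂ (1, b, 0) p.2) swapRST hK ?_
    (P := fun q => q.2.2 < q.2.1) ?_ hgh
    (ℓ := (1 / 2 : ℝ) • (coordE2 - coordPh).comp (ContinuousLinearMap.snd ℝ ℝ Config)) ?_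
    (n := (0, -1, 0, 1)) ?_ (fun p => rfl) ?_ measurePreserving_swapRST norm_swapRST rfl
    (isOpen_space isOpen_acrossR) ((convex_Ioi 0).prod convex_acrossR) ?_ ?_
    (a := fun p => μ ((1 - vel b) / 2 * p.2.1 + (1 + vel b) / 2 * p.2.2.2 - p.2.2.1))
    (z := Complex.exp (Complex.I * (θ₂ : ℂ))) ?_ ?_ ?_ ?_
  · rintro ⟨⟨t, s, r⟩, h⟩ (hh : 0 < h)
    rw [ampR, if_pos ⟨rfl, rfl⟩, abs_sub_comm r s]
    refine (norm_wall_factor_sub_le hμL _ _ _).trans_eq ?_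
    congr 1
    refine (congrArg abs (?_ : _ = -(vel b * h))).trans
      (by rw [abs_neg, abs_mul, abs_vel, one_mul, abs_of_pos hh])
    simp only [chartRₗ_apply, swapRST_apply, chartR, swapR]
    ring
  · rintro q h1 ⟨h2, -⟩
    simp only [chartR] at h2
    linarith
  · intro q
    simp [chartRₗ_apply, chartR, coordPh, coordE2]
    ring
  · intro p
    refine Prod.ext ?_ (Prod.ext ?_ (Prod.ext ?_ ?_)) <;>
      simp [swapRST_apply, swapR, coordPh, coordE2]
  · intro p
    simp [swapRST_apply, swapR, coordPh, coordE2]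
    ring
  · rintro p ⟨h1, h2, h3⟩ h4
    simp [coordPh, coordE2] at h4
    exact ⟨h1, h2, h4⟩
  · rintro p ⟨h1, h2, h3⟩ h4
    simp [coordPh, coordE2] at h4
    exact ⟨h1, h3, by simp [swapRST_apply, swapR]; linarith⟩
  · intro p hp
    rw [ampR, if_pos ⟨rfl, rfl⟩, abs_of_pos (hdist p hp), mul_comm]
  · exact hμs.comp (f := fun p : ℝ × Config =>
      (1 - vel b) / 2 * p.2.1 + (1 + vel b) / 2 * p.2.2.2 - p.2.2.1)
      (ContDiff.contDiffOn (by fun_prop)) fun p hp => (hdist p hp).le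
  · intro p s
    congr 1
    fin_cases b <;> simp [velST, vel3]
  · intro φ p hp
    refine unfolded_swapR b ?_
    simp [coordPh, coordE2] at hp
    linarith

theorem IsWeakState.growsAlong_S1 (hψ : IsWeakState μ θ₁ θ₂ κ ψ) (hμ : ∀ s, ‖μ |s|‖ ≤ 1)
    (hμm : Measurable fun s => μ |s|) (w : Label) :
    GrowsAlong volume (velST w) (Ioi (0 : ℝ) ×ˢ S1) (unfoldedST μ θ₁ θ₂ ψ w)
      (sourceST μ θ₁ θ₂ κ ψ w) := by
  refine growsAlong_of_weakTransport (isOpen_space isOpen_S1) ((convex_Ioi 0).prod convex_S1)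
    (fun n => integrableOn_unfolded hμ hμm (fun w => hψ.integrableOn w n) w)
    (fun n => integrableOn_unfolded (ψ := fun t => massTerm κ (ψ t)) hμ hμm
      (fun w => hψ.integrableOn_massTerm w n) w) fun n => ?_
  refine ((hψ.transport w).mono inter_subset_left).congr_on (fun p hp => ?_) fun p hp => ?_
  · rw [indicator_of_mem hp.2]
    exact unfolded_of_mem hp.1.2 w
  · rw [indicator_of_mem hp.2]
    exact unfolded_of_mem hp.1.2 w

/-- Along every backward characteristic that starts in `S1` the unfolded solution changes by the
integral of the unfolded source. The characteristic meets at most two walls; one that meets two is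
reflected to one that meets one. -/
theorem IsWeakState.ae_unfolded_eq (hψ : IsWeakState μ θ₁ θ₂ κ ψ) (hμ : ∀ s, ‖μ |s|‖ ≤ 1)
    (hμm : Measurable fun s => μ |s|) (hμL : ∀ s t, ‖μ |s| - μ |t|‖ ≤ K * |s - t|)
    (hμs : ContDiffOn ℝ ∞ μ (Ici 0)) (hK : 0 ≤ K) (w : Label) {σ : ℝ} (hσ : 0 ≤ σ) :
    ∀ᵐ p : ℝ × Config, 0 < p.1 → p.2 + σ • vel3 w ∈ S1 →
      ψ (p.1 + σ) w (p.2 + σ • vel3 w) = unfoldedST μ θ₁ θ₂ ψ w p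
        + ∫ s in (0 : ℝ)..σ, sourceST μ θ₁ θ₂ κ ψ w (p + s • velST w) := by
  have key : ∀ Ω : Set Config, S1 ⊆ Ω → (∀ x, x + σ • vel3 w ∈ S1 → x ∈ Ω) →
      GrowsAlong volume (velST w) (Ioi (0 : ℝ) ×ˢ Ω) (unfoldedST μ θ₁ θ₂ ψ w)
        (sourceST μ θ₁ θ₂ κ ψ w) → ∀ᵐ p : ℝ × Config, 0 < p.1 → p.2 + σ • vel3 w ∈ S1 →
      ψ (p.1 + σ) w (p.2 + σ • vel3 w) = unfoldedST μ θ₁ θ₂ ψ w p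
        + ∫ s in (0 : ℝ)..σ, sourceST μ θ₁ θ₂ κ ψ w (p + s • velST w) := by
    intro Ω hΩ1 hΩ2 h
    filter_upwards [h σ hσ] with p hp h1 h2
    have h3 : p + σ • velST w = (p.1 + σ, p.2 + σ • vel3 w) :=
      Prod.ext (by simp [velST]) rfl
    rw [← hp ⟨h1, hΩ2 _ h2⟩ (by rw [h3]; exact ⟨by simp only [mem_Ioi]; linarith, hΩ1 h2⟩), h3]
    exact (unfolded_of_mem h2 w).symm
  have hGi := fun (w : Label) n => integrableOn_unfolded (ψ := fun t => massTerm κ (ψ t))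
    (θ₁ := θ₁) (θ₂ := θ₂) hμ hμm (fun w => hψ.integrableOn_massTerm w n) w
  have hL := fun c => hψ.growsAlong_acrossL hμ hμm hμL hμs hK c
  have hR := fun b => hψ.growsAlong_acrossR hμ hμm hμL hμs hK b
  obtain ⟨a, b, c⟩ := w
  fin_cases a <;> fin_cases b <;> fin_cases c
  all_goals simp only [Fin.zero_eta, Fin.mk_one, Fin.isValue] at key ⊢
  · exact key S1 le_rfl (fun x hx => by
      simp [S1, vel3] at hx ⊢; exact hx) (hψ.growsAlong_S1 hμ hμm _)
  · exact key S1 le_rfl (fun x hx => by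
      simp [S1, vel3] at hx ⊢; exact ⟨hx.1, by linarith⟩) (hψ.growsAlong_S1 hμ hμm _)
  · refine key {x | x.1 < x.2.2} (fun x hx => hx.2) (fun x hx => by
      simp [S1, vel3] at hx ⊢; exact hx.2) ?_
    refine (hL 0).union (D₂ := Ioi (0 : ℝ) ×ˢ sector coordPh coordE1 coordPh coordE2) ?_
      (isOpen_space isOpen_acrossL) (isOpen_space (isOpen_sector _ _ _ _))
      ((convex_Ioi 0).prod (convex_lt coordPh coordE2)) ?_ (hGi _)
    · refine (hR 0).comp_mul (ρ := swapLST) (a := fun p => ampL μ θ₁ (0, 1, 0) p.2)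
        measurePreserving_swapLST rfl (fun p s => ampL_add_smul _ _ _)
        ((convex_Ioi 0).prod (convex_sector _ _ _ _)) ?_ ?_ ?_
      · rintro p ⟨h1, h2, h3⟩
        exact ⟨h1, h2, h3⟩
      · rintro p ⟨h1, h2, h3⟩
        exact unfolded_swapL 0 (le_of_lt h2)
      · rintro p ⟨h1, h2, h3⟩
        exact unfolded_swapL 0 (le_of_lt h2)
    · rintro p ⟨h1, h2⟩
      rcases lt_or_ge p.2.2.1 p.2.2.2 with h3 | h3
      · exact Or.inl ⟨h1, h2, h3⟩
      · exact Or.inr ⟨h1, lt_of_lt_of_le h2 h3, h2⟩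
  · exact key acrossL (fun x hx => ⟨hx.2, hx.1.trans hx.2⟩) (fun x hx => by
      simp [S1, vel3, acrossL] at hx ⊢; exact ⟨by linarith, by linarith⟩) (hL 1)
  · exact key acrossR (fun x hx => ⟨hx.1, hx.1.trans hx.2⟩) (fun x hx => by
      simp [S1, vel3, acrossR] at hx ⊢; exact ⟨by linarith, by linarith⟩) (hR 0)
  · exact key S1 le_rfl (fun x hx => by
      simp [S1, vel3] at hx ⊢; exact ⟨by linarith, hx.2⟩) (hψ.growsAlong_S1 hμ hμm _)
  · refine key {x | x.2.1 < x.1} (fun x hx => hx.1) (fun x hx => by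
      simp [S1, vel3] at hx ⊢; exact hx.1) ?_
    refine (hR 1).union (D₂ := Ioi (0 : ℝ) ×ˢ sector coordE2 coordPh coordE1 coordPh) ?_
      (isOpen_space isOpen_acrossR) (isOpen_space (isOpen_sector _ _ _ _))
      ((convex_Ioi 0).prod (convex_lt coordE1 coordPh)) ?_ (hGi _)
    · refine (hL 1).comp_mul (ρ := swapRST) (a := fun p => ampR μ θ₂ (1, 1, 0) p.2)
        measurePreserving_swapRST rfl (fun p s => ampR_add_smul _ _ _)
        ((convex_Ioi 0).prod (convex_sector _ _ _ _)) ?_ ?_ ?_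
      · rintro p ⟨h1, h2, h3⟩
        exact ⟨h1, h2, h3⟩
      · rintro p ⟨h1, h2, h3⟩
        exact unfolded_swapR 1 (le_of_lt h2)
      · rintro p ⟨h1, h2, h3⟩
        exact unfolded_swapR 1 (le_of_lt h2)
    · rintro p ⟨h1, h2⟩
      rcases lt_or_ge p.2.2.1 p.2.2.2 with h3 | h3
      · exact Or.inl ⟨h1, h2, h3⟩
      · exact Or.inr ⟨h1, lt_of_le_of_lt h3 h2, h2⟩
  · exact key S1 le_rfl (fun x hx => by
      simp [S1, vel3] at hx ⊢; exact hx) (hψ.growsAlong_S1 hμ hμm _)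

/-! ### The energy estimate -/

theorem frequently_nhdsGT_of_ae {P : ℝ → Prop} (h : ∀ᵐ t : ℝ, 0 < t → P t) :
    ∃ᶠ t in 𝓝[>] 0, P t := by
  rw [frequently_iff]
  intro U hU
  obtain ⟨η, hη, hsub⟩ := mem_nhdsGT_iff_exists_Ioo_subset.1 hU
  have h1 : (volume : Measure ℝ) (Ioo 0 η) ≠ 0 := by
    rw [Real.volume_Ioo]
    simpa using hη
  by_contra hcon
  push Not at hcon
  refine h1 (measure_mono_null (fun t ht => ?_) (ae_iff.1 h))
  exact fun h2 => hcon t (hsub ht) (h2 ht.1)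

variable {μ : ℝ → ℝ} {θ₁ θ₂ κ : ℝ} {ψ : ℝ → Label → Config → ℂ} {K : ℝ}

/-- The growth of the norms over one time step. -/
theorem IsWeakState.ae_eLpNorm_add_le (hψ : IsWeakState μ θ₁ θ₂ κ ψ) (hμ : ∀ s, ‖μ |s|‖ ≤ 1)
    (hμm : Measurable fun s => μ |s|) (hμL : ∀ s t, ‖μ |s| - μ |t|‖ ≤ K * |s - t|)
    (hμs : ContDiffOn ℝ ∞ μ (Ici 0)) (hK : 0 ≤ K) (hκ : 0 ≤ κ) {S : ℝ≥0∞} {T : ℝ}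
    (hS : ∀ᵐ s : ℝ, s ∈ Ioc 0 T → ∀ w,
      eLpNorm (ψ s w) 2 (volume.restrict S1) ≤ S * ENNReal.ofReal (Real.exp (rate κ * |s|)))
    (w : Label) {σ : ℝ} (hσ : 0 ≤ σ) :
    ∀ᵐ t : ℝ, 0 < t → t + σ ≤ T → ∀ M : ℝ≥0∞,
      (∀ w, eLpNorm (ψ t w) 2 (volume.restrict S1) ≤ M) →
      eLpNorm (ψ (t + σ) w) 2 (volume.restrict S1)
        ≤ 5 * M + S / 2 * ENNReal.ofReal (Real.exp (rate κ * |t + σ|)) := by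
  have h1 := Measure.ae_ae_of_ae_prod (hψ.ae_unfolded_eq hμ hμm hμL hμs hK w hσ)
  filter_upwards [h1] with t ht ht0 htT M hM
  have hm : ∀ t w, Measurable (ψ t w) := fun t w => measurable_slice hψ.measurable t w
  have hU : Measurable (unfolded μ θ₁ θ₂ (ψ t) w) := measurable_unfolded_state hμm (hm t) w
  set I : Set ℝ := Ioc t (t + σ) with hI
  have hIm : Measurable fun x => ∫ s in I, sourceAlong μ θ₁ θ₂ κ ψ w t s x := by
    have h2 : Measurable fun q : Config × ℝ => sourceAlong μ θ₁ θ₂ κ ψ w t q.2 q.1 :=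
      (measurable_sourceAlong hμm hψ.measurable w).comp
        (f := fun q : Config × ℝ => ((t, q.1), q.2)) (by fun_prop)
    exact h2.stronglyMeasurable.integral_prod_right.measurable
  have hIT : I ⊆ Ioc 0 T := fun s hs => ⟨ht0.trans hs.1, hs.2.trans htT⟩
  have hint : eLpNorm (fun x => ∫ s in I, sourceAlong μ θ₁ θ₂ κ ψ w t s x) 2 volume
      ≤ S / 2 * ENNReal.ofReal (Real.exp (rate κ * |t + σ|)) := by
    refine (eLpNorm_integral_sourceAlong_le hμ hμm hκ hψ.measurable hS w measurableSet_Ioc hIT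
      t).trans (le_trans ?_ (ofReal_rate_mul_integral_le hκ S (t + σ)))
    refine mul_le_mul' le_rfl (ENNReal.ofReal_le_ofReal ?_)
    exact setIntegral_mono_set (integrableOn_exp_rate κ _)
      (Eventually.of_forall fun s => (Real.exp_pos _).le)
      (Eventually.of_forall fun s hs => ⟨ht0.trans hs.1, hs.2⟩)
  calc eLpNorm (ψ (t + σ) w) 2 (volume.restrict S1)
      = eLpNorm (S1.indicator (ψ (t + σ) w)) 2 volume :=
        (eLpNorm_indicator_eq_eLpNorm_restrict measurableSet_S1).symm
    _ = eLpNorm (fun x => S1.indicator (ψ (t + σ) w) (x + σ • vel3 w)) 2 volume :=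
        (eLpNorm_comp_measurePreserving (((hm _ w).indicator measurableSet_S1).aestronglyMeasurable)
          (measurePreserving_add_right volume (σ • vel3 w))).symm
    _ ≤ eLpNorm (fun x => unfolded μ θ₁ θ₂ (ψ t) w x
          + ∫ s in I, sourceAlong μ θ₁ θ₂ κ ψ w t s x) 2 volume := by
        refine eLpNorm_mono_ae ?_
        filter_upwards [ht] with x hx
        by_cases hxS : x + σ • vel3 w ∈ S1
        · rw [indicator_of_mem hxS, hx ht0 hxS, intervalIntegral.integral_of_le hσ, hI]
          refine le_of_eq ?_
          congr 2
          rw [← intervalIntegral.integral_of_le hσ,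
            ← intervalIntegral.integral_of_le (by linarith : t ≤ t + σ)]
          have h3 := intervalIntegral.integral_comp_add_left (a := 0) (b := σ)
            (fun s => sourceAlong μ θ₁ θ₂ κ ψ w t s x) t
          rw [add_zero] at h3
          rw [← h3]
          refine intervalIntegral.integral_congr fun s _ => ?_
          simp only [sourceAlong_shift]
          simp [sourceST, velST]
        · rw [indicator_of_notMem hxS, norm_zero]
          exact norm_nonneg _
    _ ≤ eLpNorm (unfolded μ θ₁ θ₂ (ψ t) w) 2 volume
          + eLpNorm (fun x => ∫ s in I, sourceAlong μ θ₁ θ₂ κ ψ w t s x) 2 volume :=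
        eLpNorm_add_le hU.aestronglyMeasurable hIm.aestronglyMeasurable (by norm_num)
    _ ≤ _ := add_le_add (eLpNorm_unfolded_le hμ hμm (hm t) hM w) hint

/-- A priori estimate: the norms of the components are controlled by their initial values. The best
constant on an interval satisfies `S ≤ 5 M + S / 2`, hence `S ≤ 10 M`. -/
theorem IsWeakState.le_of_continuousOn (hψ : IsWeakState μ θ₁ θ₂ κ ψ) (hμ : ∀ s, ‖μ |s|‖ ≤ 1)
    (hμm : Measurable fun s => μ |s|) (hμL : ∀ s t, ‖μ |s| - μ |t|‖ ≤ K * |s - t|)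
    (hμs : ContDiffOn ℝ ∞ μ (Ici 0)) (hK : 0 ≤ K) (hκ : 0 ≤ κ) {N : Label → ℝ → ℝ≥0∞}
    (hN : ∀ᵐ t : ℝ, 0 < t → ∀ w, eLpNorm (ψ t w) 2 (volume.restrict S1) = N w t)
    (hfin : ∀ w t, 0 ≤ t → N w t ≠ ⊤) (hcont : ∀ w, ContinuousOn (N w) (Ici 0)) {M : ℝ≥0∞}
    (hM : ∀ w, N w 0 ≤ M) (w : Label) {t : ℝ} (ht : 0 ≤ t) :
    N w t ≤ 10 * M * ENNReal.ofReal (Real.exp (rate κ * |t|)) := by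
  set T : ℝ := t + 1 with hT
  set F : Label → ℝ → ℝ≥0∞ := fun w s => N w s * ENNReal.ofReal (Real.exp (-(rate κ * |s|))) with hF
  have hFN : ∀ w s, N w s = F w s * ENNReal.ofReal (Real.exp (rate κ * |s|)) := by
    intro w s
    rw [hF]
    simp only
    rw [mul_assoc, ← ENNReal.ofReal_mul (Real.exp_pos _).le, ← Real.exp_add]
    simp
  set S : ℝ≥0∞ := ⨆ w : Label, ⨆ s ∈ Ico 0 T, F w s with hS
  have hle : ∀ w, ∀ s ∈ Ico 0 T, F w s ≤ S := fun w s hs =>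
    le_iSup_of_le w (le_iSup₂_of_le s hs le_rfl)
  have hT0 : 0 ≤ T := by linarith
  have hbd : ∀ w, ∃ C : ℝ≥0∞, C ≠ ⊤ ∧ ∀ s ∈ Icc 0 T, N w s ≤ C := by
    intro w
    obtain ⟨s, hs, hmax⟩ := isCompact_Icc.exists_isMaxOn (nonempty_Icc.2 hT0)
      ((hcont w).mono Icc_subset_Ici_self)
    exact ⟨N w s, hfin w s hs.1, fun r hr => hmax hr⟩
  have hStop : S ≠ ⊤ := by
    choose C hC hCle using hbd
    refine ne_top_of_le_ne_top (b := ∑ w, C w) (by simpa using hC) ?_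
    refine iSup_le fun w => iSup₂_le fun s hs => ?_
    calc F w s ≤ N w s * 1 := by
          refine mul_le_mul' le_rfl ?_
          rw [ENNReal.ofReal_le_one, Real.exp_le_one_iff]
          have := (rate_pos hκ).le
          have := abs_nonneg s
          nlinarith
      _ ≤ C w := by rw [mul_one]; exact hCle w s ⟨hs.1, hs.2.le⟩
      _ ≤ ∑ w, C w := Finset.single_le_sum (f := C) (fun _ _ => zero_le) (Finset.mem_univ w)
  have hSae : ∀ T' < T, ∀ᵐ s : ℝ, s ∈ Ioc 0 T' → ∀ w,
      eLpNorm (ψ s w) 2 (volume.restrict S1) ≤ S * ENNReal.ofReal (Real.exp (rate κ * |s|)) := by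
    intro T' hT'
    filter_upwards [hN] with s hs hsT w
    rw [hs hsT.1, hFN]
    exact mul_le_mul' (hle w s ⟨hsT.1.le, hsT.2.trans_lt hT'⟩) le_rfl
  set Q : ℝ → ℝ≥0∞ := fun s => Finset.univ.sup fun w => N w s with hQ
  have hQc : ContinuousOn Q (Ici 0) := ContinuousOn.finset_sup_apply fun w _ => hcont w
  have hNQ : ∀ w s, N w s ≤ Q s := fun w s =>
    Finset.le_sup (f := fun w => N w s) (Finset.mem_univ w)
  have hstep : ∀ w, ∀ σ ∈ Ico 0 T,
      N w σ ≤ 5 * Q 0 + S / 2 * ENNReal.ofReal (Real.exp (rate κ * |σ|)) := by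
    intro w σ hσ
    obtain ⟨T', hT'1, hT'2⟩ := exists_between hσ.2
    have h1 : ∀ᵐ t : ℝ, 0 < t → (t + σ ≤ T' →
        N w (t + σ) ≤ 5 * Q t + S / 2 * ENNReal.ofReal (Real.exp (rate κ * |t + σ|))) := by
      have h2 := (quasiMeasurePreserving_add_right volume σ).ae hN
      filter_upwards [hψ.ae_eLpNorm_add_le hμ hμm hμL hμs hK hκ (hSae T' hT'2) w hσ.1, hN, h2]
        with t a1 a2 a3 ht htT
      rw [← a3 (by linarith [hσ.1])]
      refine a1 ht htT (Q t) fun w => ?_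
      rw [a2 ht]
      exact hNQ w t
    have h3 : Tendsto (fun t : ℝ => t + σ) (𝓝[>] 0) (𝓝[Ici 0] σ) := by
      refine tendsto_nhdsWithin_iff.2 ⟨?_, ?_⟩
      · exact ((continuous_add_const σ).tendsto' 0 σ (by simp)).mono_left nhdsWithin_le_nhds
      · filter_upwards [self_mem_nhdsWithin] with t (ht : 0 < t)
        exact add_nonneg ht.le hσ.1
    have h4 : Tendsto (fun t => N w (t + σ)) (𝓝[>] 0) (𝓝 (N w σ)) :=
      Tendsto.comp (hcont w σ hσ.1) h3
    have h5 : Tendsto Q (𝓝[>] 0) (𝓝 (Q 0)) :=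
      (hQc 0 self_mem_Ici).mono_left (nhdsWithin_mono _ Ioi_subset_Ici_self)
    have h6 : Tendsto (fun t : ℝ => ENNReal.ofReal (Real.exp (rate κ * |t + σ|))) (𝓝[>] 0)
        (𝓝 (ENNReal.ofReal (Real.exp (rate κ * |σ|)))) :=
      ((ENNReal.continuous_ofReal.comp (by fun_prop : Continuous fun t : ℝ =>
        Real.exp (rate κ * |t + σ|))).tendsto' 0 _ (by simp)).mono_left nhdsWithin_le_nhds
    refine le_of_tendsto_of_tendsto_of_frequently h4
      ((ENNReal.Tendsto.const_mul h5 (Or.inr (by norm_num))).add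
        (ENNReal.Tendsto.const_mul h6 (Or.inr ?_))) ?_
    · exact ENNReal.div_ne_top hStop (by norm_num)
    · refine ((frequently_nhdsGT_of_ae h1).and_eventually
        (Ioo_mem_nhdsGT (sub_pos.2 hT'1))).mono fun t ht => ht.1 ?_
      linarith [ht.2.2]
  have hSle : S ≤ 5 * Q 0 + S / 2 := by
    refine iSup_le fun w => iSup₂_le fun σ hσ => ?_
    have h1 : ENNReal.ofReal (Real.exp (-(rate κ * |σ|))) ≤ 1 := by
      rw [ENNReal.ofReal_le_one, Real.exp_le_one_iff]
      have := (rate_pos hκ).le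
      have := abs_nonneg σ
      nlinarith
    calc F w σ ≤ (5 * Q 0 + S / 2 * ENNReal.ofReal (Real.exp (rate κ * |σ|)))
          * ENNReal.ofReal (Real.exp (-(rate κ * |σ|))) := mul_le_mul' (hstep w σ hσ) le_rfl
      _ = 5 * Q 0 * ENNReal.ofReal (Real.exp (-(rate κ * |σ|))) + S / 2 := by
          rw [add_mul, mul_assoc (S / 2), ← ENNReal.ofReal_mul (Real.exp_pos _).le, ← Real.exp_add]
          simp
      _ ≤ 5 * Q 0 + S / 2 := by
          exact add_le_add (mul_le_of_le_one_right zero_le h1) le_rfl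
  have hS10 : S ≤ 10 * Q 0 := by
    have h1 : S / 2 ≠ ⊤ := ENNReal.div_ne_top hStop (by norm_num)
    have h2 : S / 2 ≤ 5 * Q 0 := by
      have h3 : S / 2 + S / 2 ≤ 5 * Q 0 + S / 2 := by rwa [ENNReal.add_halves]
      exact (ENNReal.add_le_add_iff_right h1).1 h3
    calc S = S / 2 + S / 2 := (ENNReal.add_halves S).symm
      _ ≤ 5 * Q 0 + 5 * Q 0 := add_le_add h2 h2
      _ = 10 * Q 0 := by ring
  rw [hFN]
  refine mul_le_mul' ((hle w t ⟨ht, by linarith⟩).trans (hS10.trans (mul_le_mul' le_rfl ?_))) le_rfl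
  exact Finset.sup_le fun w _ => hM w

/-! ### Evolutions: solutions without the initial condition -/

section Linear

variable {μ : ℝ → ℝ} {θ₁ θ₂ κ : ℝ} {ψ φ : ℝ → Label → Config → ℂ}

theorem HasTraceAlong.sub {y : (ℝ × ℝ × ℝ) × ℝ → Config} (hy : Measurable y) {f f' : ℝ → Config → ℂ}
    {g g' : ℝ × ℝ × ℝ → ℂ} (hf : Measurable fun p : ℝ × Config => f p.1 p.2)
    (h : HasTraceAlong y f g) (h' : HasTraceAlong y f' g') :
    HasTraceAlong y (fun t x => f t x - f' t x) (fun q => g q - g' q) := by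
  refine ⟨h.1.sub h'.1, fun R => ?_⟩
  have h1 := (h.2 R).add (h'.2 R)
  rw [add_zero] at h1
  refine tendsto_of_tendsto_of_tendsto_of_le_of_le tendsto_const_nhds h1 (fun _ => zero_le)
    fun δ => ?_
  simp only [← mul_add]
  have hm : AEMeasurable (fun q : (ℝ × ℝ × ℝ) × ℝ => ‖f q.1.1 (y q) - g q.1‖ₑ) volume :=
    ((hf.comp ((measurable_fst.comp measurable_fst).prodMk hy)).aestronglyMeasurable.sub
      h.1.comp_fst).enorm
  rw [← lintegral_add_left' hm.restrict]
  gcongr with q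
  rw [sub_sub_sub_comm]
  exact enorm_sub_le

theorem HasTraceAlong.congr {y : (ℝ × ℝ × ℝ) × ℝ → Config} (hy : Measurable y)
    (e : ((ℝ × ℝ × ℝ) × ℝ) ≃L[ℝ] (ℝ × Config)) (he : ∀ q, e q = (q.1.1, y q))
    {f f' : ℝ → Config → ℂ} {g : ℝ × ℝ × ℝ → ℂ} (h : HasTraceAlong y f g)
    (hff : ∀ᵐ p : ℝ × Config, p ∈ Ioi (0 : ℝ) ×ˢ S1 → f p.1 p.2 = f' p.1 p.2) :
    HasTraceAlong y f' g := by
  refine ⟨h.1, fun R => ?_⟩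
  have hq : Measure.QuasiMeasurePreserving e volume volume :=
    ⟨e.continuous.measurable, Measure.absolutelyContinuous_isAddHaarMeasure _ _⟩
  refine (h.2 R).congr fun δ => ?_
  congr 1
  refine setLIntegral_congr_fun_ae (measurableSet_layer hy R δ) ?_
  filter_upwards [hq.ae hff] with q h1 h2
  simp only [he] at h1
  rw [h1 ⟨h2.1, h2.2.2.2.2.2.2⟩]

theorem locallyIntegrable_of_ball {f : ℝ × Config → ℂ}
    (h : ∀ n : ℕ, IntegrableOn f (Metric.ball 0 n) volume) : LocallyIntegrable f volume := by
  intro p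
  obtain ⟨n, hn⟩ := exists_nat_gt ‖p‖
  exact ⟨_, Metric.isOpen_ball.mem_nhds (mem_ball_zero_iff.2 hn), h n⟩

theorem IsWeakState.sub (hψ : IsWeakState μ θ₁ θ₂ κ ψ) (hφ : IsWeakState μ θ₁ θ₂ κ φ) :
    IsWeakState μ θ₁ θ₂ κ (fun t w x => ψ t w x - φ t w x) where
  measurable w := (hψ.measurable w).sub (hφ.measurable w)
  integrableOn w n := (hψ.integrableOn w n).sub (hφ.integrableOn w n)
  transport w := by
    intro ρ h1 h2 h3
    have hint : ∀ {χ : ℝ → Label → Config → ℂ}, IsWeakState μ θ₁ θ₂ κ χ → Integrable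
        (fun p : ℝ × Config => fderiv ℝ ρ p (velST w) • χ p.1 w p.2
          + ρ p • massTerm κ (χ p.1) w p.2) volume := fun hχ =>
      ((locallyIntegrable_of_ball (hχ.integrableOn w)).integrable_smul_left_of_hasCompactSupport
        (continuous_fderiv_apply_const h1 _) (hasCompactSupport_fderiv_apply_const h2 _)).add
      ((locallyIntegrable_of_ball
        (hχ.integrableOn_massTerm w)).integrable_smul_left_of_hasCompactSupport h1.continuous h2)
    have h4 := integral_sub (hint hψ) (hint hφ)
    rw [hψ.transport w ρ h1 h2 h3, hφ.transport w ρ h1 h2 h3, sub_zero] at h4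
    rw [← h4]
    congr 1
    funext p
    simp only [massTerm, Complex.real_smul]
    ring
  trace₁ c := by
    obtain ⟨g, h, h1, h2, h3⟩ := hψ.trace₁ c
    obtain ⟨g', h', h1', h2', h3'⟩ := hφ.trace₁ c
    refine ⟨_, _, h1.sub measurable_chartL (hψ.measurable _) h1',
      h2.sub measurable_chartL (hψ.measurable _) h2', ?_⟩
    filter_upwards [h3, h3'] with p a1 a2 b1 b2
    rw [a1 b1 b2, a2 b1 b2, mul_sub]
  trace₂ b := by
    obtain ⟨g, h, h1, h2, h3⟩ := hψ.trace₂ b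
    obtain ⟨g', h', h1', h2', h3'⟩ := hφ.trace₂ b
    refine ⟨_, _, h1.sub measurable_chartR (hψ.measurable _) h1',
      h2.sub measurable_chartR (hψ.measurable _) h2', ?_⟩
    filter_upwards [h3, h3'] with p a1 a2 b1 b2
    rw [a1 b1 b2, a2 b1 b2, mul_sub]

/-- A curve of square-integrable functions that is continuous in `L²` and almost everywhere equal
to a weak solution of the boundary value problem. -/
structure IsEvolution (μ : ℝ → ℝ) (θ₁ θ₂ κ : ℝ) (Ψ : ℝ → Config → Spinor) : Prop where
  memLp : ∀ t : ℝ, 0 ≤ t → MemLp (Ψ t) 2 (volume.restrict S1)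
  continuous : ∀ t₀ : ℝ, 0 ≤ t₀ →
    Tendsto (fun t => eLpNorm (Ψ t - Ψ t₀) 2 (volume.restrict S1)) (𝓝[Ici 0] t₀) (𝓝 0)
  exists_state : ∃ ψ, IsWeakState μ θ₁ θ₂ κ ψ ∧
    ∀ᵐ t : ℝ, 0 < t → ∀ᵐ x ∂(volume.restrict S1), ∀ w, ψ t w x = Ψ t x w

theorem tendsto_eLpNorm_sub_sub {Ψ Φ : ℝ → Config → Spinor} {l : Filter ℝ} {t₀ : ℝ} (ht₀ : 0 ≤ t₀)
    (hl : l ≤ 𝓟 (Ici 0)) (hΨm : ∀ t, 0 ≤ t → MemLp (Ψ t) 2 (volume.restrict S1))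
    (hΦm : ∀ t, 0 ≤ t → MemLp (Φ t) 2 (volume.restrict S1))
    (hΨ : Tendsto (fun t => eLpNorm (Ψ t - Ψ t₀) 2 (volume.restrict S1)) l (𝓝 0))
    (hΦ : Tendsto (fun t => eLpNorm (Φ t - Φ t₀) 2 (volume.restrict S1)) l (𝓝 0)) :
    Tendsto (fun t => eLpNorm ((Ψ t - Φ t) - (Ψ t₀ - Φ t₀)) 2 (volume.restrict S1)) l (𝓝 0) := by
  have h := hΨ.add hΦ
  rw [add_zero] at h
  refine tendsto_of_tendsto_of_tendsto_of_le_of_le' tendsto_const_nhds h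
    (Eventually.of_forall fun _ => zero_le) ?_
  filter_upwards [hl (mem_principal_self _)] with t ht
  rw [sub_sub_sub_comm]
  exact eLpNorm_sub_le ((hΨm t ht).sub (hΨm t₀ ht₀)).1 ((hΦm t ht).sub (hΦm t₀ ht₀)).1 (by norm_num)

theorem IsEvolution.sub {Ψ Φ : ℝ → Config → Spinor} (hΨ : IsEvolution μ θ₁ θ₂ κ Ψ)
    (hΦ : IsEvolution μ θ₁ θ₂ κ Φ) : IsEvolution μ θ₁ θ₂ κ (fun t => Ψ t - Φ t) where
  memLp t ht := (hΨ.memLp t ht).sub (hΦ.memLp t ht)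
  continuous t₀ ht₀ := tendsto_eLpNorm_sub_sub ht₀ inf_le_right hΨ.memLp hΦ.memLp
    (hΨ.continuous t₀ ht₀) (hΦ.continuous t₀ ht₀)
  exists_state := by
    obtain ⟨ψ, h1, h2⟩ := hΨ.exists_state
    obtain ⟨φ, h3, h4⟩ := hΦ.exists_state
    refine ⟨_, h1.sub h3, ?_⟩
    filter_upwards [h2, h4] with t a1 a2 ht
    filter_upwards [a1 ht, a2 ht] with x b1 b2 w
    rw [b1, b2]
    rfl

theorem continuousOn_eLpNorm_component {Ψ : ℝ → Config → Spinor}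
    (hmem : ∀ t : ℝ, 0 ≤ t → MemLp (Ψ t) 2 (volume.restrict S1))
    (hcont : ∀ t₀ : ℝ, 0 ≤ t₀ →
      Tendsto (fun t => eLpNorm (Ψ t - Ψ t₀) 2 (volume.restrict S1)) (𝓝[Ici 0] t₀) (𝓝 0))
    (w : Label) :
    ContinuousOn (fun t => eLpNorm (fun x => Ψ t x w) 2 (volume.restrict S1)) (Ici 0) := by
  intro t₀ ht₀
  have hm : ∀ t, 0 ≤ t → AEStronglyMeasurable (fun x => Ψ t x w) (volume.restrict S1) := fun t ht =>
    (EuclideanSpace.proj w : Spinor →L[ℂ] ℂ).continuous.comp_aestronglyMeasurable (hmem t ht).1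
  have hle : ∀ s t, 0 ≤ s → 0 ≤ t → eLpNorm (fun x => Ψ s x w) 2 (volume.restrict S1)
      ≤ eLpNorm (fun x => Ψ t x w) 2 (volume.restrict S1)
        + eLpNorm (Ψ s - Ψ t) 2 (volume.restrict S1) := by
    intro s t hs ht
    have h1 : (fun x => Ψ s x w) = (fun x => Ψ t x w) + fun x => (Ψ s - Ψ t) x w := by
      funext x
      simp
    calc _ = eLpNorm ((fun x => Ψ t x w) + fun x => (Ψ s - Ψ t) x w) 2 (volume.restrict S1) := by
          rw [← h1]
      _ ≤ _ := (eLpNorm_add_le (hm t ht) ((hm s hs).sub (hm t ht)) (by norm_num)).trans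
          (add_le_add le_rfl (eLpNorm_component_le (Ψ s - Ψ t) 2 (volume.restrict S1) w))
  have hfin : eLpNorm (fun x => Ψ t₀ x w) 2 (volume.restrict S1) ≠ ⊤ :=
    ((eLpNorm_component_le (Ψ t₀) 2 (volume.restrict S1) w).trans_lt (hmem t₀ ht₀).2).ne
  refine ENNReal.tendsto_nhds_of_Icc fun ε hε => ?_
  filter_upwards [self_mem_nhdsWithin, ENNReal.tendsto_nhds_zero.1 (hcont t₀ ht₀) ε hε]
    with t ht h1
  refine ⟨tsub_le_iff_right.2 ((hle t₀ t ht₀ ht).trans (add_le_add le_rfl ?_)),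
    (hle t t₀ ht ht₀).trans (add_le_add le_rfl h1)⟩
  rwa [eLpNorm_sub_comm]

end Linear

section FromSolution

variable {hbar m θ₁ θ₂ : ℝ} {μ : ℝ → ℝ} {Ψ₀ : Config → Spinor} {Ψ : ℝ → Config → Spinor}

/-- The transport equation of the component `w`, from testing the Dirac equation with a real
function times the basis spinor of `w`. -/
theorem SolvesWeakly.weakTransport (h : SolvesWeakly hbar m Ψ) (hh : hbar ≠ 0)
    {ψ : ℝ → Label → Config → ℂ}
    (hψ : ∀ᵐ p : ℝ × Config, p ∈ Ioi (0 : ℝ) ×ˢ S1 → ∀ w, ψ p.1 w p.2 = Ψ p.1 p.2 w) (w : Label) :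
    WeakTransport volume (velST w) (Ioi (0 : ℝ) ×ˢ S1) (fun p => ψ p.1 w p.2)
      (fun p => massTerm (m / hbar) (ψ p.1) w p.2) := by
  intro ρ h1 h2 h3
  set φ : ℝ × Config → Spinor := fun p => (ρ p) • EuclideanSpace.single w (1 : ℂ) with hφ
  have hφ1 : ContDiff ℝ ∞ φ := h1.smul contDiff_const
  have hsub : tsupport φ ⊆ tsupport ρ := closure_mono fun p hp => by
    intro h0
    exact hp (by simp [hφ, h0])
  have hφ2 : HasCompactSupport φ := h2.mono' (subset_closure.trans hsub)
  have hD : MeasurableSet (Ioi (0 : ℝ) ×ˢ S1) := measurableSet_Ioi.prod measurableSet_S1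
  have h4 := h φ hφ1 hφ2 (hsub.trans h3)
  have hcomp : ∀ w', (fun p => starRingEnd ℂ (φ p w'))
      = fun p => if w' = w then ((ρ p : ℝ) : ℂ) else 0 := by
    intro w'
    funext p
    simp only [hφ, PiLp.smul_apply, EuclideanSpace.single, PiLp.single_apply]
    split_ifs <;> simp
  have hder : ∀ p, fderiv ℝ (fun p => ((ρ p : ℝ) : ℂ)) p (velST w)
      = ((fderiv ℝ ρ p (velST w) : ℝ) : ℂ) := by
    intro p
    have h5 := Complex.ofRealCLM.hasFDerivAt.comp p ((h1.differentiable (by simp)) p).hasFDerivAt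
    simp only [Function.comp_def, Complex.ofRealCLM_apply] at h5
    rw [h5.fderiv]
    rfl
  have hpt : ∀ᵐ p : ℝ × Config, p ∈ Ioi (0 : ℝ) ×ˢ S1 →
      inner ℂ ((Complex.I * (hbar : ℂ)) • fderiv ℝ φ p (1, 0)
        - hamiltonian hbar m (fun x => φ (p.1, x)) p.2) (Ψ p.1 p.2)
      = -(Complex.I * hbar) * (fderiv ℝ ρ p (velST w) • ψ p.1 w p.2
          + ρ p • massTerm (m / hbar) (ψ p.1) w p.2) := by
    filter_upwards [hψ] with p hp hpD
    rw [inner_equation hh p ((hφ1.differentiable (by simp)) p)]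
    congr 1
    rw [Finset.sum_eq_single w]
    · have h6 := congrFun (hcomp w) p
      simp only [if_true] at h6
      rw [hcomp w, h6]
      simp only [if_true, hder, Complex.real_smul, massTerm, hp hpD]
    · intro w' _ hw'
      have h6 := congrFun (hcomp w') p
      simp only [if_neg hw'] at h6
      rw [hcomp w', h6]
      simp [if_neg hw']
    · simp
  rw [setIntegral_congr_ae hD hpt, integral_const_mul] at h4
  have h5 : -(Complex.I * (hbar : ℂ)) ≠ 0 := by
    simpa using hh
  rw [← (mul_eq_zero.1 h4).resolve_left h5, setIntegral_eq_integral_of_forall_compl_eq_zero]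
  intro p hp
  have hp1 : p ∉ tsupport ρ := fun h' => hp (h3 h')
  have hp2 : fderiv ℝ ρ p = 0 := by
    by_contra h6
    exact hp1 (support_fderiv_subset ℝ h6)
  simp [hp2, image_eq_zero_of_notMem_tsupport hp1]

/-- A solution gives a weak solution in components. -/
theorem IsSolution.isEvolution (hΨ : IsSolution hbar m θ₁ θ₂ μ Ψ₀ Ψ) (hh : hbar ≠ 0) :
    IsEvolution μ θ₁ θ₂ (m / hbar) Ψ := by
  refine ⟨hΨ.memLp, hΨ.continuous, ?_⟩
  set D : Set (ℝ × Config) := Ioi (0 : ℝ) ×ˢ S1 with hD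
  have hDm : MeasurableSet D := measurableSet_Ioi.prod measurableSet_S1
  set f : ℝ × Config → Spinor := hΨ.measurable.mk _ with hf
  have hfm : Measurable f := hΨ.measurable.stronglyMeasurable_mk.measurable
  set ψ : ℝ → Label → Config → ℂ := fun t w x => D.indicator (fun p => f p w) (t, x) with hψ
  have hψm : ∀ w, Measurable fun p : ℝ × Config => ψ p.1 w p.2 := fun w =>
    ((EuclideanSpace.proj w : Spinor →L[ℂ] ℂ).continuous.measurable.comp hfm).indicator hDm
  have hae : ∀ᵐ p : ℝ × Config, p ∈ D → ∀ w, ψ p.1 w p.2 = Ψ p.1 p.2 w := by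
    filter_upwards [(ae_restrict_iff' hDm).1 hΨ.measurable.ae_eq_mk] with p hp hpD w
    rw [hp hpD]
    exact indicator_of_mem hpD _
  have hslice : ∀ᵐ t : ℝ, 0 < t → ∀ᵐ x ∂(volume.restrict S1), ∀ w, ψ t w x = Ψ t x w := by
    filter_upwards [Measure.ae_ae_of_ae_prod hae] with t ht ht0
    rw [ae_restrict_iff' measurableSet_S1]
    filter_upwards [ht] with x hx hxS
    exact hx ⟨ht0, hxS⟩
  have htrace : ∀ {y : (ℝ × ℝ × ℝ) × ℝ → Config} (_ : Measurable y)
      (e : ((ℝ × ℝ × ℝ) × ℝ) ≃L[ℝ] (ℝ × Config)) (_ : ∀ q, e q = (q.1.1, y q)) (w : Label)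
      {g : ℝ × ℝ × ℝ → ℂ}, HasTraceAlong y (fun t x => Ψ t x w) g →
      HasTraceAlong y (fun t x => ψ t w x) g := fun hy e he w g hg =>
    hg.congr hy e he (by
      filter_upwards [hae] with p hp hpD
      exact (hp hpD w).symm)
  refine ⟨ψ, ⟨hψm, fun w n => ?_, hΨ.equation.weakTransport hh hae, fun c => ?_, fun b => ?_⟩,
    hslice⟩
  · obtain ⟨s, hs, hmax⟩ :=
      isCompact_Icc.exists_isMaxOn (nonempty_Icc.2 (Nat.cast_nonneg (α := ℝ) n))
      ((continuousOn_eLpNorm_component hΨ.memLp hΨ.continuous w).mono Icc_subset_Ici_self)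
    have hC : eLpNorm (fun x => Ψ s x w) 2 (volume.restrict S1) ≠ ⊤ :=
      ((eLpNorm_component_le (Ψ s) 2 (volume.restrict S1) w).trans_lt (hΨ.memLp s hs.1).2).ne
    set C := eLpNorm (fun x => Ψ s x w) 2 (volume.restrict S1) with hCdef
    have hmem : MemLp (fun p : ℝ × Config => ψ p.1 w p.2) 2
        (volume.restrict (Metric.ball 0 (n : ℝ))) := by
      refine ⟨(hψm w).aestronglyMeasurable, ?_⟩
      have h1 : eLpNorm (fun p : ℝ × Config => ψ p.1 w p.2) 2
          (volume.restrict (Metric.ball 0 (n : ℝ))) ^ 2 < ⊤ := by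
        rw [eLpNorm_two_sq]
        calc ∫⁻ p in Metric.ball (0 : ℝ × Config) n, ‖ψ p.1 w p.2‖ₑ ^ 2
            ≤ ∫⁻ p in Ioo (-(n : ℝ)) n ×ˢ (univ : Set Config), ‖ψ p.1 w p.2‖ₑ ^ 2 := by
              refine lintegral_mono_set fun p hp => ⟨?_, mem_univ _⟩
              exact abs_lt.1 ((le_max_left _ _).trans_lt (mem_ball_zero_iff.1 hp))
          _ = ∫⁻ t in Ioo (-(n : ℝ)) n, ∫⁻ x, ‖ψ t w x‖ₑ ^ 2 := by
              rw [Measure.volume_eq_prod, ← Measure.prod_restrict, Measure.restrict_univ,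
                lintegral_prod _ ((hψm w).enorm.pow_const 2).aemeasurable]
          _ ≤ ∫⁻ _ in Ioo (-(n : ℝ)) n, C ^ 2 := by
              refine lintegral_mono_ae ?_
              filter_upwards [ae_restrict_of_ae hslice, ae_restrict_mem measurableSet_Ioo]
                with t h2 ht
              rcases le_or_gt t 0 with h3 | h3
              · have h4 : ∀ x, ψ t w x = 0 := fun x =>
                  indicator_of_notMem (fun h => absurd h.1 (not_lt.2 h3)) _
                simp [h4]
              · have h4 : S1.indicator (fun x => ψ t w x) = fun x => ψ t w x := by
                  refine indicator_eq_self.2 fun x hx => ?_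
                  by_contra h5
                  exact hx (indicator_of_notMem (fun h => h5 h.2) _)
                have h5 : ∫⁻ x, ‖ψ t w x‖ₑ ^ 2
                    = eLpNorm (fun x => Ψ t x w) 2 (volume.restrict S1) ^ 2 := by
                  rw [← eLpNorm_two_sq (fun x => ψ t w x), ← h4,
                    eLpNorm_indicator_eq_eLpNorm_restrict measurableSet_S1]
                  congr 1
                  refine eLpNorm_congr_ae ?_
                  filter_upwards [h2 h3] with x hx using hx w
                rw [h5]
                exact pow_le_pow_left₀ zero_le (hmax ⟨h3.le, ht.2.le⟩) 2
          _ < ⊤ := by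
              rw [setLIntegral_const, Real.volume_Ioo]
              finiteness
      by_contra h2
      rw [not_lt, top_le_iff] at h2
      rw [h2] at h1
      simp at h1
    have : IsFiniteMeasure ((volume : Measure (ℝ × Config)).restrict (Metric.ball 0 (n : ℝ))) :=
      ⟨by rw [Measure.restrict_apply_univ]; exact measure_ball_lt_top⟩
    exact hmem.integrable (by norm_num)
  · obtain ⟨g, h, h1, h2, h3⟩ := hΨ.boundary₁ c
    exact ⟨g, h, htrace measurable_chartL chartLₗ chartLₗ_apply _ (hasTraceC1_iff.1 h1),
      htrace measurable_chartL chartLₗ chartLₗ_apply _ (hasTraceC1_iff.1 h2), h3⟩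
  · obtain ⟨g, h, h1, h2, h3⟩ := hΨ.boundary₂ b
    exact ⟨g, h, htrace measurable_chartR chartRₗ chartRₗ_apply _ (hasTraceC2_iff.1 h1),
      htrace measurable_chartR chartRₗ chartRₗ_apply _ (hasTraceC2_iff.1 h2), h3⟩

end FromSolution

/-! ### Well-posedness -/

section WellPosed

variable {μ : ℝ → ℝ} {θ₁ θ₂ κ K : ℝ}

theorem card_label : Fintype.card Label = 8 := rfl

theorem IsEvolution.eLpNorm_le {Ψ : ℝ → Config → Spinor} (hΨ : IsEvolution μ θ₁ θ₂ κ Ψ)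
    (hμ : ∀ s, ‖μ |s|‖ ≤ 1) (hμm : Measurable fun s => μ |s|)
    (hμL : ∀ s t, ‖μ |s| - μ |t|‖ ≤ K * |s - t|) (hμs : ContDiffOn ℝ ∞ μ (Ici 0)) (hK : 0 ≤ K)
    (hκ : 0 ≤ κ) {t : ℝ} (ht : 0 ≤ t) :
    eLpNorm (Ψ t) 2 (volume.restrict S1)
      ≤ ENNReal.ofReal (80 * Real.exp (rate κ * |t|)) * eLpNorm (Ψ 0) 2 (volume.restrict S1) := by
  obtain ⟨ψ, h1, h2⟩ := hΨ.exists_state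
  have h3 : ∀ w, eLpNorm (fun x => Ψ t x w) 2 (volume.restrict S1)
      ≤ 10 * eLpNorm (Ψ 0) 2 (volume.restrict S1)
        * ENNReal.ofReal (Real.exp (rate κ * |t|)) := fun w =>
    h1.le_of_continuousOn hμ hμm hμL hμs hK hκ
      (N := fun w t => eLpNorm (fun x => Ψ t x w) 2 (volume.restrict S1))
      (by
        filter_upwards [h2] with t ht ht0 w
        refine eLpNorm_congr_ae ?_
        filter_upwards [ht ht0] with x hx using hx w)
      (fun w t ht =>
        ((eLpNorm_component_le (Ψ t) 2 (volume.restrict S1) w).trans_lt (hΨ.memLp t ht).2).ne)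
      (continuousOn_eLpNorm_component hΨ.memLp hΨ.continuous)
      (fun w => eLpNorm_component_le (Ψ 0) 2 (volume.restrict S1) w) w ht
  refine (eLpNorm_le_sum_component (by norm_num) (hΨ.memLp t ht).1).trans
    ((Finset.sum_le_sum fun w _ => h3 w).trans_eq ?_)
  rw [Finset.sum_const, Finset.card_univ, card_label, ENNReal.ofReal_mul (by norm_num),
    ENNReal.ofReal_ofNat, nsmul_eq_mul]
  push_cast
  ring

/-- Evolutions with the same initial value agree. -/
theorem IsEvolution.ae_eq {Ψ Φ : ℝ → Config → Spinor} (hΨ : IsEvolution μ θ₁ θ₂ κ Ψ)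
    (hΦ : IsEvolution μ θ₁ θ₂ κ Φ) (hμ : ∀ s, ‖μ |s|‖ ≤ 1) (hμm : Measurable fun s => μ |s|)
    (hμL : ∀ s t, ‖μ |s| - μ |t|‖ ≤ K * |s - t|) (hμs : ContDiffOn ℝ ∞ μ (Ici 0)) (hK : 0 ≤ K)
    (hκ : 0 ≤ κ) (h0 : Ψ 0 =ᵐ[volume.restrict S1] Φ 0) {t : ℝ} (ht : 0 ≤ t) :
    Ψ t =ᵐ[volume.restrict S1] Φ t := by
  have h1 := (hΨ.sub hΦ).eLpNorm_le hμ hμm hμL hμs hK hκ ht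
  have h2 : eLpNorm (Ψ 0 - Φ 0) 2 (volume.restrict S1) = 0 := by
    refine (eLpNorm_eq_zero_iff ((hΨ.memLp 0 le_rfl).sub (hΦ.memLp 0 le_rfl)).1 (by norm_num)).2 ?_
    filter_upwards [h0] with x hx
    simp [hx]
  rw [h2, mul_zero, nonpos_iff_eq_zero,
    eLpNorm_eq_zero_iff ((hΨ.memLp t ht).sub (hΦ.memLp t ht)).1 (by norm_num)] at h1
  filter_upwards [h1] with x hx
  exact sub_eq_zero.1 hx

variable {hbar m : ℝ}

/-- Existence of a solution, with a bound in the supremum norm, for bounded square-integrable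
initial values. -/
theorem exists_isSolution (hh : 0 < hbar) (hm : 0 ≤ m) (hμ : ∀ s, ‖μ |s|‖ ≤ 1)
    (hμm : Measurable fun s => μ |s|) (θ₁ θ₂ : ℝ) {Ψ₀ : Config → Spinor}
    (h2 : MemLp Ψ₀ 2 (volume.restrict S1)) (hi : MemLp Ψ₀ ⊤ (volume.restrict S1)) :
    ∃ Ψ : ℝ → Config → Spinor, IsSolution hbar m θ₁ θ₂ μ Ψ₀ Ψ ∧
      (∀ t : ℝ, tsupport (Ψ t) ⊆ closure S1) ∧
      ∀ t : ℝ, eLpNorm (Ψ t) ⊤ (volume.restrict S1)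
        ≤ ENNReal.ofReal (80 * Real.exp (rate (m / hbar) * |t|))
          * eLpNorm Ψ₀ ⊤ (volume.restrict S1) := by
  have hκ : 0 ≤ m / hbar := by positivity
  set B : ℝ := (eLpNorm Ψ₀ ⊤ (volume.restrict S1)).toReal with hB
  have hB0 : 0 ≤ B := ENNReal.toReal_nonneg
  set f : Config → Spinor := h2.1.mk Ψ₀ with hf
  have hfm : ∀ w : Label, Measurable fun x => f x w := fun w =>
    (EuclideanSpace.proj w : Spinor →L[ℂ] ℂ).continuous.measurable.comp
      h2.1.stronglyMeasurable_mk.measurable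
  set φ₀ : Label → Config → ℂ := fun w => {x | ‖f x w‖ ≤ B}.indicator fun x => f x w with hφ₀
  have hφm : ∀ w, Measurable (φ₀ w) := fun w =>
    (hfm w).indicator (measurableSet_le (hfm w).norm measurable_const)
  have hφB : ∀ w x, ‖φ₀ w x‖ ≤ B := by
    intro w x
    by_cases hx : x ∈ {x | ‖f x w‖ ≤ B}
    · rw [hφ₀]
      simp only
      rw [indicator_of_mem hx]
      exact hx
    · rw [hφ₀]
      simp only
      rw [indicator_of_notMem hx, norm_zero]
      exact hB0
  have hφae : ∀ᵐ x ∂(volume.restrict S1), ∀ w, φ₀ w x = Ψ₀ x w := by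
    filter_upwards [h2.1.ae_eq_mk, ae_le_eLpNormEssSup (f := Ψ₀) (μ := volume.restrict S1)]
      with x hx1 hx2 w
    have h3 : ‖f x w‖ ≤ B := by
      rw [hf, ← hx1]
      refine (PiLp.norm_apply_le (Ψ₀ x) w).trans ?_
      rw [← eLpNorm_exponent_top] at hx2
      have h4 := ENNReal.toReal_mono hi.2.ne hx2
      rwa [toReal_enorm] at h4
    rw [hφ₀]
    simp only
    rw [indicator_of_mem (show x ∈ {x | ‖f x w‖ ≤ B} from h3), hf, ← hx1]
  have hφN : ∀ w, eLpNorm (φ₀ w) 2 (volume.restrict S1) ≤ eLpNorm Ψ₀ 2 (volume.restrict S1) := by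
    intro w
    refine eLpNorm_mono_ae ?_
    filter_upwards [hφae] with x hx
    rw [hx w]
    exact PiLp.norm_apply_le (Ψ₀ x) w
  obtain ⟨ψ, hψ⟩ := exists_isMild hμ hμm hκ θ₁ θ₂ hB0 hφm hφB hφN
  refine ⟨ofComponents ψ, hψ.isSolution hh hm hμ hμm h2.2.ne hφae, fun t => ?_, fun t => ?_⟩
  · refine closure_mono fun x hx => ?_
    by_contra h3
    refine hx ?_
    ext w
    simp [ofComponents_apply, onS1_of_notMem h3]
  · rw [eLpNorm_exponent_top]
    refine eLpNormEssSup_le_of_ae_enorm_bound (Eventually.of_forall fun x => ?_)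
    have h3 : ‖ofComponents ψ t x‖ ≤ 80 * Real.exp (rate (m / hbar) * |t|) * B := by
      refine (norm_spinor_le_sum _).trans ((Finset.sum_le_sum (g := fun _ =>
        10 * B * Real.exp (rate (m / hbar) * |t|)) fun w _ => ?_).trans_eq ?_)
      · rw [ofComponents_apply]
        exact (norm_indicator_le_norm_self _ _).trans (hψ.norm_le t w x)
      · rw [Finset.sum_const, Finset.card_univ, card_label, nsmul_eq_mul]
        push_cast
        ring
    rw [← ofReal_norm]
    refine (ENNReal.ofReal_le_ofReal h3).trans_eq ?_
    rw [ENNReal.ofReal_mul (by positivity), hB, ENNReal.ofReal_toReal]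
    exact hi.2.ne

theorem IsData.memLp {Ψ₀ : Config → Spinor} (h : IsData Ψ₀) (p : ℝ≥0∞) :
    MemLp Ψ₀ p (volume.restrict S1) := by
  obtain ⟨K, hK⟩ := h.bounded
  have h1 : MemLp Ψ₀ ⊤ volume :=
    memLp_top_of_bound h.measurable K (Eventually.of_forall hK)
  exact (h1.mono_exponent_of_measure_support_ne_top
    (fun x hx => image_eq_zero_of_notMem_tsupport hx)
    h.compact.isCompact.measure_lt_top.ne le_top).restrict _

/-- A function on the half-line that is continuously differentiable and eventually constant is
Lipschitz continuous. -/
theorem exists_lipschitz {μ : ℝ → ℝ} {a c : ℝ} (ha : 0 ≤ a) (hμ : ContDiffOn ℝ ∞ μ (Ici 0))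
    (hc : ∀ s ∈ Ici a, μ s = c) : ∃ K : ℝ, 0 ≤ K ∧ ∀ s t, ‖μ |s| - μ |t|‖ ≤ K * |s - t| := by
  obtain ⟨K, hK⟩ :=
    (hμ.mono (Icc_subset_Ici_self : Icc 0 a ⊆ Ici 0)).exists_lipschitzOnWith (by simp)
    (convex_Icc 0 a) isCompact_Icc
  refine ⟨K, K.2, fun s t => ?_⟩
  have hmin : ∀ s, μ |s| = μ (min |s| a) := by
    intro s
    rcases le_total |s| a with h | h
    · rw [min_eq_left h]
    · rw [min_eq_right h, hc _ h, hc a self_mem_Ici]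
  have hmem : ∀ s : ℝ, min |s| a ∈ Icc 0 a := fun s => ⟨le_min (abs_nonneg s) ha, min_le_right _ _⟩
  rw [hmin s, hmin t]
  refine (hK.norm_sub_le (hmem s) (hmem t)).trans (mul_le_mul_of_nonneg_left ?_ K.2)
  exact (abs_min_sub_min_le_max |s| a |t| a).trans (by
    rw [sub_self, abs_zero, max_eq_left (abs_nonneg _)]
    exact abs_abs_sub_abs_le s t)

end WellPosed

end LeakyIBVP

theorem mainTheorem3 (hbar m ε θ₁ θ₂ : ℝ) (hhbar : 0 < hbar) (hm : 0 ≤ m) (hε : 0 < ε)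
    (hθ₁ : θ₁ ∈ Set.Ico 0 (2 * Real.pi)) (hθ₂ : θ₂ ∈ Set.Ico 0 (2 * Real.pi))
    (μ : ℝ → ℝ) (hμ_smooth : ContDiffOn ℝ ∞ μ (Set.Ici 0))
    (hμ_range : ∀ s ∈ Set.Ici (0 : ℝ), μ s ∈ Set.Icc (0 : ℝ) 1)
    (hμ_zero : ∀ s ∈ Set.Icc (0 : ℝ) ε, μ s = 0)
    (hμ_one : ∀ s ∈ Set.Ici (2 * ε), μ s = 1) :
    -- existence and uniqueness of a global solution supported in the closure of `S1`
    (∀ Ψ₀ : LeakyIBVP.Config → LeakyIBVP.Spinor, LeakyIBVP.IsData Ψ₀ →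
      ∃ Ψ : ℝ → LeakyIBVP.Config → LeakyIBVP.Spinor,
        LeakyIBVP.IsSolution hbar m θ₁ θ₂ μ Ψ₀ Ψ ∧
        (∀ t : ℝ, 0 ≤ t → tsupport (Ψ t) ⊆ closure LeakyIBVP.S1) ∧
        ∀ Φ : ℝ → LeakyIBVP.Config → LeakyIBVP.Spinor,
          LeakyIBVP.IsSolution hbar m θ₁ θ₂ μ Ψ₀ Φ →
          ∀ t : ℝ, 0 ≤ t → Φ t =ᵐ[volume.restrict LeakyIBVP.S1] Ψ t) ∧
    -- continuous dependence on the data, in the `L²` norm and in the supremum norm,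
    -- uniformly on bounded time intervals
    (∀ T : ℝ, ∃ K : ℝ≥0, ∀ Ψ₀ Φ₀ : LeakyIBVP.Config → LeakyIBVP.Spinor,
      LeakyIBVP.IsData Ψ₀ → LeakyIBVP.IsData Φ₀ →
      ∀ Ψ Φ : ℝ → LeakyIBVP.Config → LeakyIBVP.Spinor,
        LeakyIBVP.IsSolution hbar m θ₁ θ₂ μ Ψ₀ Ψ → LeakyIBVP.IsSolution hbar m θ₁ θ₂ μ Φ₀ Φ →
        ∀ t ∈ Set.Icc (0 : ℝ) T,
          eLpNorm (Ψ t - Φ t) 2 (volume.restrict LeakyIBVP.S1)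
            ≤ K * eLpNorm (Ψ₀ - Φ₀) 2 (volume.restrict LeakyIBVP.S1) ∧
          eLpNorm (Ψ t - Φ t) (⊤ : ℝ≥0∞) (volume.restrict LeakyIBVP.S1)
            ≤ K * eLpNorm (Ψ₀ - Φ₀) (⊤ : ℝ≥0∞) (volume.restrict LeakyIBVP.S1)) := by
  have hμ : ∀ s, ‖μ |s|‖ ≤ 1 := fun s => by
    obtain ⟨h1, h2⟩ := hμ_range |s| (abs_nonneg s)
    rwa [Real.norm_of_nonneg h1]
  have hμm : Measurable fun s => μ |s| :=
    (hμ_smooth.continuousOn.comp_continuous continuous_abs fun s => abs_nonneg s).measurable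
  obtain ⟨K, hK, hμL⟩ := LeakyIBVP.exists_lipschitz (by positivity : 0 ≤ 2 * ε) hμ_smooth hμ_one
  have hκ : 0 ≤ m / hbar := by positivity
  have hinit : ∀ {Ψ₀ Φ₀ : LeakyIBVP.Config → LeakyIBVP.Spinor}
      {Ψ Φ : ℝ → LeakyIBVP.Config → LeakyIBVP.Spinor},
      LeakyIBVP.IsSolution hbar m θ₁ θ₂ μ Ψ₀ Ψ → LeakyIBVP.IsSolution hbar m θ₁ θ₂ μ Φ₀ Φ →
      Ψ 0 - Φ 0 =ᵐ[volume.restrict LeakyIBVP.S1] Ψ₀ - Φ₀ := fun hΨ hΦ =>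
    hΨ.initial.sub hΦ.initial
  refine ⟨fun Ψ₀ hΨ₀ => ?_, fun T => ?_⟩
  · obtain ⟨Ψ, h1, h2, -⟩ := LeakyIBVP.exists_isSolution hhbar hm hμ hμm θ₁ θ₂ (hΨ₀.memLp 2)
      (hΨ₀.memLp ⊤)
    exact ⟨Ψ, h1, fun t _ => h2 t, fun Φ hΦ t ht => (hΦ.isEvolution hhbar.ne').ae_eq
      (h1.isEvolution hhbar.ne') hμ hμm hμL hμ_smooth hK hκ (hΦ.initial.trans h1.initial.symm) ht⟩
  · refine ⟨(80 * Real.exp (LeakyIBVP.rate (m / hbar) * |T|)).toNNReal,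
      fun Ψ₀ Φ₀ hΨ₀ hΦ₀ Ψ Φ hΨ hΦ t ht => ?_⟩
    have hexp : ENNReal.ofReal (80 * Real.exp (LeakyIBVP.rate (m / hbar) * |t|))
        ≤ ((80 * Real.exp (LeakyIBVP.rate (m / hbar) * |T|)).toNNReal : ℝ≥0∞) := by
      refine ENNReal.ofReal_le_ofReal (mul_le_mul_of_nonneg_left
        (LeakyIBVP.exp_rate_mono hκ ?_) (by norm_num))
      rw [abs_of_nonneg ht.1]
      exact ht.2.trans (le_abs_self T)
    have hev := (hΨ.isEvolution hhbar.ne').sub (hΦ.isEvolution hhbar.ne')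
    refine ⟨?_, ?_⟩
    · refine (hev.eLpNorm_le hμ hμm hμL hμ_smooth hK hκ ht.1).trans (mul_le_mul' hexp ?_)
      exact (eLpNorm_congr_ae (hinit hΨ hΦ)).le
    · -- the difference agrees with the solution constructed from the difference of the data
      obtain ⟨X, h1, -, h2⟩ := LeakyIBVP.exists_isSolution hhbar hm hμ hμm θ₁ θ₂
        ((hΨ₀.memLp 2).sub (hΦ₀.memLp 2)) ((hΨ₀.memLp ⊤).sub (hΦ₀.memLp ⊤))
      have h3 := hev.ae_eq (h1.isEvolution hhbar.ne') hμ hμm hμL hμ_smooth hK hκ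
        ((hinit hΨ hΦ).trans h1.initial.symm) ht.1
      rw [eLpNorm_congr_ae h3]
      exact (h2 t).trans (mul_le_mul' hexp le_rfl)
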